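/- Let $p$ be a prime, $L/\mathbb{Q}_p$ and $K/L$ finite extensions with rings of integers $\mathcal{O}_L,\mathcal{O}_K$, let $\pi_L,\pi_K$ be uniformizers, and let $q_L=|\mathcal{O}_L/\pi_L|$, $q_K=|\mathcal{O}_K/\pi_K|=q_L^{f_{K/L}}$. Put $f_L(x)=\pi_Lx+x^{q_L}$ and $f_K(x)=\pi_Kx+x^{q_K}$. Let $F_L$, $F_K$ be the Lubin-Tate formal group laws attached to $f_L$, $f_K$ (the unique formal group law $F$ with $f(F(x,y))=F(f(x),f(y))$), write $\oplus_L,\oplus_K$ for the corresponding additions and $\sum^{\mathrm{LT},L}$ for summation with respect to $\oplus_L$, and let $[a]_L$ (for $a\in\mathcal{O}_L$), $[a]_K$ (for $a\in\mathcal{O}_K$) be the corresponding endomorphisms, i.e. the unique series $\equiv ax$ modulo degree $2$ that commute with $f_L$, resp. $f_K$, under composition. Let $\mathfrak{F}_0(F_K)$ be the set of all $q_K$ roots of $f_K$ in an algebraic closure of $K$. For $\alpha\in\mathcal{O}_L$ let $\mathscr{A}^\alpha_{L,K}$ be the set of all $r\in\mathcal{O}_K[[x]]$ with $|r(0)|<1$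 and $$\sum^{\mathrm{LT},L}_{z\in\mathfrak{F}_0(F_K)}r(x\oplus_Kz)=[\alpha]_L\bigl(r([\pi_K]_K(x))\bigr),$$ all composites being taken as coefficientwise limits. Assume $q_L\ge 3$, $\pi_K^2\mid\pi_L$, and that $\alpha=q_K/\pi_L^{f_{K/L}}$ lies in $\mathcal{O}_L$ and is divisible by $\pi_L$. Then for every $s\in\mathcal{O}_K[[x]]$ with $|s(0)|<1$ there exists $r\in\mathscr{A}^\alpha_{L,K}$ with $r\equiv s \bmod \pi_K$ if and only if $$\sum^{\mathrm{LT},L}_{z\in\mathfrak{F}_0(F_K)}s(x\oplus_Kz)\equiv[\alpha]_L\bigl(s([\pi_K]_K(x))\bigr)\mod \pi_K^2.$$ -/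

import Mathlib

open Polynomial PowerSeries

noncomputable section

namespace ColemanTrace

/-! ### Rings of integers of finite extensions of `ℚ_p` -/

/-- The ring of integers of an extension `F` of `ℚ_p`: the elements integral over `ℤ_p`. -/
abbrev Integers (p : ℕ) [Fact p.Prime] (F : Type*) [Field F] [Algebra ℚ_[p] F] :
    Subalgebra (PadicInt.subring p) F :=
  integralClosure (PadicInt.subring p) F

/-- The inclusion `𝒪_E → 𝒪_F` for an extension `F / E` of extensions of `ℚ_p`. -/
def integersMap (p : ℕ) [Fact p.Prime] (E F : Type*) [Field E] [Field F] [Algebra ℚ_[p] E]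
    [Algebra ℚ_[p] F] [Algebra E F] [IsScalarTower ℚ_[p] E F] :
    Integers p E →+* Integers p F :=
  (((IsScalarTower.toAlgHom ℚ_[p] E F).restrictScalars
    (PadicInt.subring p)).mapIntegralClosure : Integers p E →ₐ[PadicInt.subring p] Integers p F)

/-- The size `q` of the residue ring `R / πR`. -/
def residueCard {R : Type*} [CommRing R] (π : R) : ℕ :=
  Nat.card (R ⧸ Ideal.span {π})

/-! ### Lubin-Tate formal group laws and their endomorphisms -/

/-- The polynomial `π x + x ^ q`, where `q = |R / πR|`. -/
def basicPoly {R : Type*} [CommRing R] (π : R) : R[X] :=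
  Polynomial.C π * Polynomial.X + Polynomial.X ^ residueCard π

/-- The polynomial `π x + x ^ q` as a power series. -/
def basicSeries {R : Type*} [CommRing R] (π : R) : R⟦X⟧ :=
  (basicPoly π : R⟦X⟧)

/-- `F` is the formal group law attached to `f`: `f (F (x, y)) = F (f x, f y)`.
(The structure `FormalGroup` contains `F (x, y) ≡ x + y` modulo degree two.) -/
def IsLubinTateLaw {R : Type*} [CommRing R] (f : R⟦X⟧) (F : FormalGroup R) : Prop :=
  PowerSeries.subst F.toPowerSeries f =
    MvPowerSeries.subst
      (fun i : Fin 2 => PowerSeries.subst (MvPowerSeries.X i : MvPowerSeries (Fin 2) R) f)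
      F.toPowerSeries

open Classical in
/-- The Lubin-Tate formal group law attached to `f`. For a Lubin-Tate series `f` over the ring of
integers of a local field there is exactly one formal group law attached to `f`. -/
def lubinTateLaw {R : Type*} [CommRing R] (f : R⟦X⟧) : FormalGroup R :=
  if h : ∃ F, IsLubinTateLaw f F then h.choose else FormalGroup.𝔾ₐ

/-- `φ` is the endomorphism `[a]` attached to `f`: `φ (x) ≡ a x` modulo degree two and
`f (φ (x)) = φ (f (x))`. -/
def IsLubinTateEndo {R : Type*} [CommRing R] (f : R⟦X⟧) (a : R) (φ : R⟦X⟧) : Prop :=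
  PowerSeries.coeff 0 φ = 0 ∧ PowerSeries.coeff 1 φ = a ∧
    PowerSeries.subst φ f = PowerSeries.subst f φ

open Classical in
/-- The endomorphism `[a]` of the Lubin-Tate formal group law attached to `f`. For a Lubin-Tate
series `f` over the ring of integers of a local field there is exactly one such series. -/
def lubinTateEndo {R : Type*} [CommRing R] (f : R⟦X⟧) (a : R) : R⟦X⟧ :=
  if h : ∃ φ, IsLubinTateEndo f a φ then h.choose else 0

/-! ### Substitution by coefficientwise convergence -/

/-- The composite `h (g)` of a power series `h` in variables indexed by `σ` with a family `g` of
series in `A⟦X⟧`, as a coefficientwise limit for the `p`-adic topology of `A`: its `n`-th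
coefficient is the sum over all monomials `d` of `(coeff of d in h) * (n-th coeff of g ^ d)`. -/
def compSeries {σ A : Type*} [CommRing A] (p : ℕ) (h : MvPowerSeries σ A) (g : σ → A⟦X⟧) : A⟦X⟧ :=
  PowerSeries.mk fun n =>
    letI : TopologicalSpace A := (Ideal.span {(p : A)}).adicTopology
    ∑' d : σ →₀ ℕ, MvPowerSeries.coeff d h * PowerSeries.coeff n (d.prod fun i k => g i ^ k)

/-- The composite `h (g)` for a power series `h` in one variable. -/
def comp₁ {A : Type*} [CommRing A] (p : ℕ) (h g : A⟦X⟧) : A⟦X⟧ :=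
  compSeries (σ := Unit) p h (fun _ => g)

/-- The sum `g₁ ⊕ g₂ = F (g₁, g₂)` with respect to a formal group law `F`. -/
def fglAdd {A : Type*} [CommRing A] (p : ℕ) (F : FormalGroup A) (g₁ g₂ : A⟦X⟧) : A⟦X⟧ :=
  compSeries p F.toPowerSeries ![g₁, g₂]

/-- The sum of the family `g` over the finite set `T` with respect to a formal group law `F`.
(The terms are added in some order, on which nothing depends for a commutative law.) -/
def fglSum {A ι : Type*} [CommRing A] (p : ℕ) (F : FormalGroup A) (T : Finset ι) (g : ι → A⟦X⟧) :
    A⟦X⟧ :=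
  T.toList.foldr (fun z acc => fglAdd p F (g z) acc) 0

/-! ### The setting: `K / L / ℚ_p` with uniformizers `πK`, `πL` -/

section Setting

variable (p : ℕ) [Fact p.Prime]

/-- The extension of `K` generated by the roots of `f_K = πK x + x ^ qK`. -/
abbrev TorsionField {K : Type*} [Field K] [Algebra ℚ_[p] K] (πK : Integers p K) : Type _ :=
  ((basicPoly πK).map (algebraMap (Integers p K) K)).SplittingField

/-- The ring of integers of the extension of `K` generated by the roots of `f_K`. -/
abbrev TorsionIntegers {K : Type*} [Field K] [Algebra ℚ_[p] K] (πK : Integers p K) : Type _ :=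
  Integers p (TorsionField p πK)

/-- The inclusion of `𝒪_K` into the ring of integers of the field generated by the roots
of `f_K`. -/
def inclK {K : Type*} [Field K] [Algebra ℚ_[p] K] (πK : Integers p K) :
    Integers p K →+* TorsionIntegers p πK :=
  integersMap p K (TorsionField p πK)

open Classical in
/-- The set of all roots of `f_K = πK x + x ^ qK`. -/
def torsionPoints {K : Type*} [Field K] [Algebra ℚ_[p] K] (πK : Integers p K) :
    Finset (TorsionIntegers p πK) :=
  ((basicPoly πK).map (inclK p πK)).roots.toFinset

/-- The series `x ⊕_K z`, for a root `z` of `f_K`. -/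
def translate {K : Type*} [Field K] [Algebra ℚ_[p] K] (πK : Integers p K)
    (z : TorsionIntegers p πK) : (TorsionIntegers p πK)⟦X⟧ :=
  fglAdd p ((lubinTateLaw (basicSeries πK)).map (inclK p πK)) PowerSeries.X (PowerSeries.C z)

variable {L K : Type*} [Field L] [Field K] [Algebra ℚ_[p] L] [Algebra ℚ_[p] K] [Algebra L K]
  [IsScalarTower ℚ_[p] L K]

/-- The series `∑ s (x ⊕_K z)`, where `z` runs over the roots of `f_K` and the sum is taken with
respect to the formal group law `F_L`. -/
def traceSum (πL : Integers p L) (πK : Integers p K) (s : (Integers p K)⟦X⟧) :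
    (TorsionIntegers p πK)⟦X⟧ :=
  fglSum p ((lubinTateLaw (basicSeries πL)).map ((inclK p πK).comp (integersMap p L K)))
    (torsionPoints p πK)
    (fun z => comp₁ p (s.map (inclK p πK)) (translate p πK z))

/-- The series `[α]_L (s ([πK]_K (x)))`. -/
def endoSide (πL : Integers p L) (πK : Integers p K) (α : Integers p L)
    (s : (Integers p K)⟦X⟧) : (TorsionIntegers p πK)⟦X⟧ :=
  comp₁ p
    ((lubinTateEndo (basicSeries πL) α).map ((inclK p πK).comp (integersMap p L K)))
    (comp₁ p (s.map (inclK p πK)) ((lubinTateEndo (basicSeries πK) πK).map (inclK p πK)))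

/-- The set `𝒜^α_{L,K}` of all `r ∈ 𝒪_K⟦X⟧` with `|r(0)| < 1` and
`∑ r (x ⊕_K z) = [α]_L (r ([πK]_K (x)))`. -/
def interpolating (πL : Integers p L) (πK : Integers p K) (α : Integers p L) :
    Set (Integers p K)⟦X⟧ :=
  {r | πK ∣ PowerSeries.constantCoeff r ∧ traceSum p πL πK r = endoSide p πL πK α r}

end Setting

end ColemanTrace

end

open Polynomial PowerSeries

/-! ### Order of vanishing and the Lubin-Tate lemma. -/

namespace MvPowerSeries

section Order

variable {R : Type*} [CommRing R] {σ τ : Type*}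

/-! Write `π` for `π_K`, `q` for `q_K` and `y = π X + X ^ q`, which is `[π_K]_K`. Let `Δ(s)` be the
`F_L`-difference of the trace of `s` and `[α]_L (s (y))`. It is an additive endomorphism of the
group of `F_L`-points in power series with topologically nilpotent constant term, so everything can
be measured along the filtration by divisibility by `π ^ n` (`TraceSetting.level`).

The translates `X ⊕_K z` are the `q` distinct roots of `T ^ q + π T - y`. Newton's identities show
that all their power sums are divisible by `π` and that the sum of the `(q - 1)`-st powers is
exactly `(1 - q) π`. Since `q_L ≥ 3`, `F_L` agrees with `X + Y` below degree three, so on multiples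
of `π ^ n` the `F_L`-trace is the ordinary trace modulo `π ^ (3 n)`. Since `α = β π_L`, one has
`[α]_L = [β]_L ∘ (π_L X + X ^ q_L)`, and `π ^ 2 ∣ π_L` together with `q_L ≥ 3` makes `[α]_L` raise
the level of a multiple of `π ^ n`, `n ≥ 1`, by at least two.

Necessity: if `r ≡ s` modulo `π`, then `r - s` lies in level one, where both the trace and the
`[α]_L` term land in level two. Hence `Δ(s) ≡ Δ(r) = 0` modulo `π ^ 2`.

Sufficiency is successive approximation (`exists_defect_add_mem_level`). The trace of an integral
`s` is symmetric in the translates, whose elementary symmetric functions are `0`, `±π` and `±y`, so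
`Δ(s) = D (y)` with `D` over `𝒪_K` (`exists_trace_eq`). Modulo `π`, `y` is `X ^ q`, so if `π ^ (n +
2)` divides `D (y)` it divides `D`, say `D = π E`. The term `t = -(1 - q)⁻¹ X ^ (q - 1) E (y)` is
divisible by `π ^ (n + 1)` and has ordinary trace `-D (y)`. The two estimates above put `Δ(s + t)`
in level `n + 3`. Compactness of `𝒪_K⟦X⟧` supplies a limit of the corrected series, and it is an
exact solution congruent to `s` modulo `π`.

The remaining work constructs the Lubin-Tate objects, turns formal identities into identities of
points, and identifies the coefficientwise composites of the statement with continuous evaluation.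
-/

theorem natCast_le_order_iff {n : ℕ} {φ : MvPowerSeries σ R} :
    (n : ℕ∞) ≤ φ.order ↔ ∀ d : σ →₀ ℕ, d.degree < n → coeff d φ = 0 :=
  ⟨fun h _ hd => coeff_of_lt_order (lt_of_lt_of_le (by exact_mod_cast hd) h),
    fun h => nat_le_order h⟩

theorem one_le_order_of_constantCoeff {φ : MvPowerSeries σ R} (h : constantCoeff φ = 0) :
    ((1 : ℕ) : ℕ∞) ≤ φ.order := by
  rw [natCast_le_order_iff]
  intro d hd
  have : d = 0 := by rwa [Nat.lt_one_iff, Finsupp.degree_eq_zero_iff] at hd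
  rw [this, coeff_zero_eq_constantCoeff_apply, h]

theorem natCast_le_order_subst {n : ℕ} {a : σ → MvPowerSeries τ R} (ha : HasSubst a)
    (ha0 : ∀ i, constantCoeff (a i) = 0) {φ : MvPowerSeries σ R} (h : (n : ℕ∞) ≤ φ.order) :
    (n : ℕ∞) ≤ (subst a φ).order := by
  refine le_trans ?_ (le_order_subst ha φ)
  calc (n : ℕ∞) = 1 * n := (one_mul _).symm
    _ ≤ _ := mul_le_mul' (le_iInf fun i => by
      exact_mod_cast one_le_order_of_constantCoeff (ha0 i)) h

theorem le_order_sub {n : ℕ∞} {φ ψ : MvPowerSeries σ R} (h : n ≤ φ.order) (h' : n ≤ ψ.order) :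
    n ≤ (φ - ψ).order := by
  rw [sub_eq_add_neg]
  exact le_trans (le_min h (by rwa [order_neg])) min_order_le_add

theorem le_order_add {n : ℕ∞} {φ ψ : MvPowerSeries σ R} (h : n ≤ φ.order) (h' : n ≤ ψ.order) :
    n ≤ (φ + ψ).order :=
  le_trans (le_min h h') min_order_le_add

/-- The difference factors as a geometric sum times `φ - ψ`; since `q ≥ 2`, each summand has
vanishing constant term, which gains one degree. -/
theorem succ_le_order_pow_sub_pow {q n : ℕ} (hq : 2 ≤ q) {φ ψ : MvPowerSeries σ R}
    (hφ : constantCoeff φ = 0) (hψ : constantCoeff ψ = 0) (h : (n : ℕ∞) ≤ (φ - ψ).order) :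
    ((n + 1 : ℕ) : ℕ∞) ≤ (φ ^ q - ψ ^ q).order := by
  rw [← geom_sum₂_mul φ ψ q]
  refine le_trans ?_ le_order_mul
  rw [add_comm n 1, Nat.cast_add]
  refine add_le_add (one_le_order_of_constantCoeff ?_) h
  rw [map_sum]
  refine Finset.sum_eq_zero fun i hi => ?_
  rw [map_mul, map_pow, map_pow, hφ, hψ]
  rcases Nat.eq_zero_or_pos i with rfl | hi0
  · rw [zero_pow (by omega : q - 1 - 0 ≠ 0), mul_zero]
  · rw [zero_pow (by omega), zero_mul]

theorem C_dvd_iff {a : R} {φ : MvPowerSeries σ R} : C a ∣ φ ↔ ∀ d, a ∣ coeff d φ := by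
  constructor
  · rintro ⟨ψ, rfl⟩ d
    exact ⟨coeff d ψ, coeff_C_mul _ _ _⟩
  · intro h
    choose c hc using h
    let ψ : MvPowerSeries σ R := c
    refine ⟨ψ, ext fun d => ?_⟩
    rw [coeff_C_mul, hc d]
    rfl

theorem eq_of_natCast_le_order_sub {φ ψ : MvPowerSeries σ R}
    (h : ∀ n : ℕ, (n : ℕ∞) ≤ (φ - ψ).order) : φ = ψ := by
  ext d
  have := natCast_le_order_iff.mp (h (d.degree + 1)) d (Nat.lt_succ_self _)
  rwa [map_sub, sub_eq_zero] at this

end Order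

/-- The arithmetic of a uniformizer `π` with residue field of `q` elements which the construction
of Lubin-Tate series uses. -/
structure IsLubinTatePrime {R : Type*} [CommRing R] (π : R) (q : ℕ) : Prop where
  ne_zero : π ≠ 0
  two_le : 2 ≤ q
  isUnit_one_sub_pow : ∀ n, n ≠ 0 → IsUnit (1 - π ^ n)
  dvd_pow_sub_subst : ∀ (σ : Type) [Finite σ] (φ : MvPowerSeries σ R),
    C π ∣ φ ^ q - subst (fun i => X i ^ q : σ → MvPowerSeries σ R) φ

theorem _root_.Finsupp.exists_eq_single_one_of_degree {σ : Type*} {d : σ →₀ ℕ}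
    (h : d.degree = 1) : ∃ i, d = Finsupp.single i 1 := by
  classical
  obtain ⟨i, hi⟩ : ∃ i, d i ≠ 0 := by
    by_contra! h0
    have : d = 0 := Finsupp.ext h0
    simp [this] at h
  have h1 : Finsupp.single i 1 ≤ d := by
    rw [Finsupp.single_le_iff]
    omega
  have h2 : (Finsupp.single i 1 + (d - Finsupp.single i 1)).degree = 1 := by
    rwa [add_tsub_cancel_of_le h1]
  rw [map_add, Finsupp.degree_single] at h2
  have h3 : d - Finsupp.single i 1 = 0 := by
    rw [← Finsupp.degree_eq_zero_iff]
    omega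
  exact ⟨i, by rw [← add_tsub_cancel_of_le h1, h3, add_zero]⟩

section LubinTate

variable {R : Type*} [CommRing R] {σ τ : Type} [Finite σ] [Finite τ] {π : R} {q : ℕ}

/-- The series `π X_i + X_i ^ q`. -/
noncomputable def lubinTateVar (π : R) (q : ℕ) (i : σ) : MvPowerSeries σ R :=
  C π * X i + X i ^ q

omit [Finite σ] in
theorem constantCoeff_lubinTateVar (hq : q ≠ 0) (i : σ) :
    constantCoeff (lubinTateVar π q i) = 0 := by
  simp [lubinTateVar, hq]

theorem hasSubst_lubinTateVar (hq : q ≠ 0) : HasSubst (lubinTateVar π q : σ → MvPowerSeries σ R) :=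
  hasSubst_of_constantCoeff_zero (constantCoeff_lubinTateVar hq)

/-- The failure of `φ` to commute with `π X + X ^ q`. -/
noncomputable def lubinTateDefect (π : R) (q : ℕ) (φ : MvPowerSeries σ R) : MvPowerSeries σ R :=
  C π * φ + φ ^ q - subst (lubinTateVar π q) φ

omit [Finite σ] in
theorem prod_lubinTateVar_pow (hq : q ≠ 0) (d : σ →₀ ℕ) :
    (d.prod fun i k => lubinTateVar π q i ^ k) =
      monomial d 1 * d.prod fun i k => (C π + X i ^ (q - 1)) ^ k := by
  rw [monomial_one_eq, ← Finsupp.prod_mul]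
  refine Finsupp.prod_congr fun i _ => ?_
  rw [← mul_pow, lubinTateVar, mul_add, ← pow_succ', Nat.sub_add_cancel (Nat.pos_of_ne_zero hq),
    mul_comm (X i)]

/-- Because `π X + X ^ q = X (π + X ^ (q - 1))`, only the monomial `d` itself contributes to the
lowest degree, with factor `π ^ n`. -/
theorem coeff_subst_lubinTateVar (hq : 2 ≤ q) {n : ℕ} {φ : MvPowerSeries σ R}
    (h : (n : ℕ∞) ≤ φ.order) {d : σ →₀ ℕ} (hd : d.degree = n) :
    coeff d (subst (lubinTateVar π q) φ) = π ^ n * coeff d φ := by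
  classical
  rw [coeff_subst (hasSubst_lubinTateVar (by omega)), finsum_eq_single _ d]
  · rw [prod_lubinTateVar_pow (by omega), coeff_monomial_mul, if_pos le_rfl, tsub_self,
      coeff_zero_eq_constantCoeff_apply, map_finsuppProd, smul_eq_mul, one_mul, mul_comm]
    congr 1
    simp only [map_pow, map_add, constantCoeff_C, constantCoeff_X]
    rw [zero_pow (by omega), add_zero, Finsupp.prod, Finset.prod_pow_eq_pow_sum, ← hd,
      Finsupp.degree_apply]
  · intro e he
    rcases lt_or_ge e.degree n with h' | h'
    · rw [natCast_le_order_iff.mp h e h', zero_smul]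
    · rw [prod_lubinTateVar_pow (by omega), coeff_monomial_mul, if_neg, smul_zero]
      intro hle
      apply he
      have h1 : d = e + (d - e) := (add_tsub_cancel_of_le hle).symm
      have h2 : d.degree = e.degree + (d - e).degree := by
        conv_lhs => rw [h1]
        exact map_add _ _ _
      have h3 : d - e = 0 := by
        rw [← Finsupp.degree_eq_zero_iff]
        omega
      rw [h1, h3, add_zero]

/-- The `q`-th powers do not differ in degree `n`, and the substitution scales by `π ^ n`. The
resulting factor `π - π ^ n` drives both uniqueness (it is nonzero for `n ≥ 2`) and existence (it is
`π` times a unit). -/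
theorem coeff_lubinTateDefect_sub (hq : 2 ≤ q) {n : ℕ} {φ ψ : MvPowerSeries σ R}
    (hφ : constantCoeff φ = 0) (hψ : constantCoeff ψ = 0) (h : (n : ℕ∞) ≤ (φ - ψ).order)
    {d : σ →₀ ℕ} (hd : d.degree = n) :
    coeff d (lubinTateDefect π q φ - lubinTateDefect π q ψ) =
      (π - π ^ n) * coeff d (φ - ψ) := by
  have h1 : lubinTateDefect π q φ - lubinTateDefect π q ψ =
      C π * (φ - ψ) + (φ ^ q - ψ ^ q) - subst (lubinTateVar π q) (φ - ψ) := by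
    rw [subst_sub (hasSubst_lubinTateVar (by omega)), lubinTateDefect, lubinTateDefect]
    ring
  rw [h1, map_sub, map_add, coeff_subst_lubinTateVar hq h hd, coeff_C_mul,
    natCast_le_order_iff.mp (succ_le_order_pow_sub_pow hq hφ hψ h) d (by omega)]
  ring

theorem le_order_lubinTateDefect_sub (hq : 2 ≤ q) {n : ℕ} {φ ψ : MvPowerSeries σ R}
    (hφ : constantCoeff φ = 0) (hψ : constantCoeff ψ = 0) (h : (n : ℕ∞) ≤ (φ - ψ).order) :
    (n : ℕ∞) ≤ (lubinTateDefect π q φ - lubinTateDefect π q ψ).order := by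
  have h1 : lubinTateDefect π q φ - lubinTateDefect π q ψ =
      C π * (φ - ψ) + (φ ^ q - ψ ^ q) - subst (lubinTateVar π q) (φ - ψ) := by
    rw [subst_sub (hasSubst_lubinTateVar (by omega)), lubinTateDefect, lubinTateDefect]
    ring
  rw [h1]
  refine le_order_sub (le_order_add ?_ ?_) (natCast_le_order_subst
    (hasSubst_lubinTateVar (by omega)) (constantCoeff_lubinTateVar (by omega)) h)
  · rw [← smul_eq_C_mul]
    exact h.trans le_order_smul
  · exact le_trans (by exact_mod_cast Nat.le_succ n) (succ_le_order_pow_sub_pow hq hφ hψ h)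

namespace IsLubinTatePrime

variable (hπ : IsLubinTatePrime π q)
include hπ

theorem isRegular_sub_pow [IsDomain R] {n : ℕ} (hn : 2 ≤ n) : π - π ^ n ≠ 0 := by
  have : π - π ^ n = π * (1 - π ^ (n - 1)) := by
    rw [mul_sub, mul_one, ← pow_succ', Nat.sub_add_cancel (by omega)]
  rw [this]
  exact mul_ne_zero hπ.ne_zero (hπ.isUnit_one_sub_pow _ (by omega)).ne_zero

/-- Two series with the same linear terms which commute with `π X + X ^ q` up to degree `n`
agree up to degree `n`. -/
theorem le_order_sub_of_le_order_defect [IsDomain R] {n : ℕ} {φ ψ : MvPowerSeries σ R}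
    (hφ : constantCoeff φ = 0) (hψ : constantCoeff ψ = 0)
    (hlin : ∀ i, coeff (Finsupp.single i 1) φ = coeff (Finsupp.single i 1) ψ)
    (hφn : (n : ℕ∞) ≤ (lubinTateDefect π q φ).order)
    (hψn : (n : ℕ∞) ≤ (lubinTateDefect π q ψ).order) : (n : ℕ∞) ≤ (φ - ψ).order := by
  have h2 : ((2 : ℕ) : ℕ∞) ≤ (φ - ψ).order := by
    rw [natCast_le_order_iff]
    intro d hd
    rcases Nat.lt_or_ge d.degree 1 with h | h
    · have : d = 0 := by rwa [Nat.lt_one_iff, Finsupp.degree_eq_zero_iff] at h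
      rw [this, coeff_zero_eq_constantCoeff_apply, map_sub, hφ, hψ, sub_zero]
    · obtain ⟨i, rfl⟩ : ∃ i, d = Finsupp.single i 1 :=
        Finsupp.exists_eq_single_one_of_degree (by omega)
      rw [map_sub, hlin, sub_self]
  suffices ∀ m : ℕ, m + 2 ≤ n → ((m + 2 : ℕ) : ℕ∞) ≤ (φ - ψ).order by
    rcases Nat.lt_or_ge n 2 with h | h
    · exact le_trans (by exact_mod_cast h.le) h2
    · obtain ⟨m, rfl⟩ := Nat.exists_eq_add_of_le' h
      exact this m le_rfl
  intro m
  induction m with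
  | zero => exact fun _ => h2
  | succ m ih =>
    intro hm
    have ih' := ih (by omega)
    rw [natCast_le_order_iff]
    intro d hd
    rcases Nat.lt_or_ge d.degree (m + 2) with h | h
    · exact natCast_le_order_iff.mp ih' d h
    · have hd' : d.degree = m + 2 := by omega
      have h3 := coeff_lubinTateDefect_sub (π := π) hπ.two_le hφ hψ ih' hd'
      rw [natCast_le_order_iff.mp (le_order_sub hφn hψn) d (by omega)] at h3
      exact (mul_eq_zero.mp h3.symm).resolve_left (hπ.isRegular_sub_pow (by omega))

theorem eq_of_defect_eq_zero [IsDomain R] {φ ψ : MvPowerSeries σ R}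
    (hφ : constantCoeff φ = 0) (hψ : constantCoeff ψ = 0)
    (hlin : ∀ i, coeff (Finsupp.single i 1) φ = coeff (Finsupp.single i 1) ψ)
    (hφn : lubinTateDefect π q φ = 0) (hψn : lubinTateDefect π q ψ = 0) : φ = ψ :=
  eq_of_natCast_le_order_sub fun n => hπ.le_order_sub_of_le_order_defect hφ hψ hlin
    (by rw [hφn, order_zero]; exact le_top) (by rw [hψn, order_zero]; exact le_top)

/-- Modulo `π` the series `π X + X ^ q` becomes `X ^ q`, and `φ ^ q ≡ φ (X ^ q)` by the Frobenius.
This is the divisibility needed to solve for each new homogeneous part. -/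
theorem C_dvd_defect (φ : MvPowerSeries σ R) : C π ∣ lubinTateDefect π q φ := by
  have hq : q ≠ 0 := by have := hπ.two_le; omega
  have h1 : C π ∣ subst (lubinTateVar π q) φ -
      subst (fun i => X i ^ q : σ → MvPowerSeries σ R) φ := by
    let k := Ideal.Quotient.mk (Ideal.span {π})
    have hk : ∀ ψ : MvPowerSeries σ R, C π ∣ ψ ↔ map k ψ = 0 := by
      intro ψ
      rw [C_dvd_iff, MvPowerSeries.ext_iff]
      refine forall_congr' fun d => ?_
      rw [coeff_map, coeff_zero, Ideal.Quotient.eq_zero_iff_mem, Ideal.mem_span_singleton]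
    rw [hk, map_sub, map_subst (hasSubst_lubinTateVar hq), map_subst (HasSubst.X_pow hq),
      sub_eq_zero]
    congr 1
    funext i
    have : k π = 0 := by
      rw [Ideal.Quotient.eq_zero_iff_mem, Ideal.mem_span_singleton]
    simp [lubinTateVar, this]
  have h2 : lubinTateDefect π q φ =
      C π * φ + (φ ^ q - subst (fun i => X i ^ q : σ → MvPowerSeries σ R) φ) -
      (subst (lubinTateVar π q) φ - subst (fun i => X i ^ q : σ → MvPowerSeries σ R) φ) := by
    rw [lubinTateDefect]
    ring
  rw [h2]
  exact dvd_sub (dvd_add (dvd_mul_right _ _) (hπ.dvd_pow_sub_subst σ φ)) h1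

/-- The correction is homogeneous of degree `n`: the degree-`n` part of the defect divided by `-(π -
π ^ n) = -π (1 - π ^ (n - 1))`. -/
theorem exists_defect_order_succ {n : ℕ} (hn : 2 ≤ n) {φ : MvPowerSeries σ R}
    (hφ : constantCoeff φ = 0) (h : (n : ℕ∞) ≤ (lubinTateDefect π q φ).order) :
    ∃ ψ : MvPowerSeries σ R, constantCoeff ψ = 0 ∧ (n : ℕ∞) ≤ (ψ - φ).order ∧
      ((n + 1 : ℕ) : ℕ∞) ≤ (lubinTateDefect π q ψ).order := by
  classical
  obtain ⟨e, he⟩ := hπ.C_dvd_defect φ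
  obtain ⟨u, hu⟩ := hπ.isUnit_one_sub_pow (n - 1) (by omega)
  let c : MvPowerSeries σ R := fun d => if d.degree = n then - (u⁻¹ : Rˣ) * coeff d e else 0
  have hcd : ∀ d, coeff d c = if d.degree = n then - (u⁻¹ : Rˣ) * coeff d e else 0 := fun d => rfl
  have hc : (n : ℕ∞) ≤ (φ + c - φ).order := by
    rw [add_sub_cancel_left, natCast_le_order_iff]
    intro d hd
    rw [hcd, if_neg hd.ne]
  have hc0 : constantCoeff (φ + c) = 0 := by
    rw [map_add, hφ, zero_add, ← coeff_zero_eq_constantCoeff_apply, hcd, if_neg]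
    rw [map_zero]
    omega
  refine ⟨φ + c, hc0, hc, ?_⟩
  have hsum : lubinTateDefect π q (φ + c) = lubinTateDefect π q φ +
      (lubinTateDefect π q (φ + c) - lubinTateDefect π q φ) := by ring
  rw [natCast_le_order_iff]
  intro d hd
  rcases Nat.lt_or_ge d.degree n with h' | h'
  · rw [hsum, map_add, natCast_le_order_iff.mp h d h', natCast_le_order_iff.mp
      (le_order_lubinTateDefect_sub hπ.two_le hc0 hφ hc) d h', add_zero]
  · have hd' : d.degree = n := by omega
    rw [hsum, map_add, coeff_lubinTateDefect_sub hπ.two_le hc0 hφ hc hd', add_sub_cancel_left,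
      hcd, if_pos hd', he, coeff_C_mul]
    have : π - π ^ n = π * u := by
      rw [hu, mul_sub, mul_one, ← pow_succ', Nat.sub_add_cancel (by omega)]
    rw [this]
    linear_combination (-π * coeff d e) * u.mul_inv

/-- The Lubin-Tate lemma: there is a series with prescribed linear terms which commutes with
`π X + X ^ q`. -/
theorem exists_defect_eq_zero (a : σ → R) :
    ∃ φ : MvPowerSeries σ R, constantCoeff φ = 0 ∧
      (∀ i, coeff (Finsupp.single i 1) φ = a i) ∧ lubinTateDefect π q φ = 0 := by
  classical
  have := Fintype.ofFinite σ
  have hq2 := hπ.two_le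
  let P : ℕ → MvPowerSeries σ R → Prop := fun n φ =>
    constantCoeff φ = 0 ∧ ((n + 2 : ℕ) : ℕ∞) ≤ (lubinTateDefect π q φ).order
  let φ₀ : MvPowerSeries σ R := ∑ i, C (a i) * X i
  have hφ₀ : constantCoeff φ₀ = 0 := by simp [φ₀]
  -- The iteration can start in degree two for any linear form: in degree one the factor `π - π ^ 1`
  -- vanishes.
  have hP₀ : P 0 φ₀ := by
    refine ⟨hφ₀, ?_⟩
    rw [natCast_le_order_iff]
    intro d hd
    have hz : lubinTateDefect π q (0 : MvPowerSeries σ R) = 0 := by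
      rw [lubinTateDefect, ← coe_substAlgHom (hasSubst_lubinTateVar (by omega)), map_zero,
        zero_pow (by omega)]
      ring
    have h1 : ((1 : ℕ) : ℕ∞) ≤ (φ₀ - 0).order := by
      rw [sub_zero]
      exact one_le_order_of_constantCoeff hφ₀
    rcases Nat.lt_or_ge d.degree 1 with h | h
    · have := natCast_le_order_iff.mp
        (le_order_lubinTateDefect_sub (π := π) hq2 hφ₀ (map_zero _) h1) d h
      rwa [hz, sub_zero] at this
    · have := coeff_lubinTateDefect_sub (π := π) hq2 hφ₀ (map_zero _) h1
        (by omega : d.degree = 1)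
      rwa [hz, sub_zero, pow_one, sub_self, zero_mul] at this
  have step : ∀ n φ, P n φ → ∃ ψ, P (n + 1) ψ ∧ ((n + 2 : ℕ) : ℕ∞) ≤ (ψ - φ).order := by
    intro n φ hφ
    obtain ⟨ψ, h1, h2, h3⟩ := hπ.exists_defect_order_succ (by omega) hφ.1 hφ.2
    exact ⟨ψ, ⟨h1, h3⟩, h2⟩
  choose! next hnext using step
  let s : ℕ → MvPowerSeries σ R := fun n => Nat.rec φ₀ (fun n φ => next n φ) n
  have hs : ∀ n, P n (s n) := by
    intro n
    induction n with
    | zero => exact hP₀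
    | succ n ih => exact (hnext n _ ih).1
  have hsucc : ∀ n, ((n + 2 : ℕ) : ℕ∞) ≤ (s (n + 1) - s n).order := fun n => (hnext n _ (hs n)).2
  have hlt : ∀ n k, ((n + 2 : ℕ) : ℕ∞) ≤ (s (n + k) - s n).order := by
    intro n k
    induction k with
    | zero => simp
    | succ k ih =>
      have : s (n + (k + 1)) - s n = (s (n + k + 1) - s (n + k)) + (s (n + k) - s n) := by
        rw [← add_assoc]; ring
      rw [this]
      exact le_order_add (le_trans (by exact_mod_cast (by omega)) (hsucc (n + k))) ih
  -- The diagonal limit: `s n` is already final in degrees below `n + 2`, so coefficients of degree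
  -- `n` may be read off from it.
  let φ : MvPowerSeries σ R := fun d => coeff d (s d.degree)
  have hφc : ∀ d, coeff d φ = coeff d (s d.degree) := fun d => rfl
  have hφs : ∀ n, ((n + 2 : ℕ) : ℕ∞) ≤ (φ - s n).order := by
    intro n
    rw [natCast_le_order_iff]
    intro d hd
    rw [map_sub, hφc, sub_eq_zero]
    rcases le_total n d.degree with h | h
    · obtain ⟨k, hk⟩ := Nat.exists_eq_add_of_le h
      have := natCast_le_order_iff.mp (hlt n k) d hd
      rwa [map_sub, sub_eq_zero, ← hk] at this
    · obtain ⟨k, hk⟩ := Nat.exists_eq_add_of_le h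
      have := natCast_le_order_iff.mp (hlt d.degree k) d (by omega)
      rw [map_sub, sub_eq_zero, ← hk] at this
      exact this.symm
  have hφ0 : constantCoeff φ = 0 := by
    rw [← coeff_zero_eq_constantCoeff_apply, hφc, coeff_zero_eq_constantCoeff_apply]
    exact (hs (Finsupp.degree (0 : σ →₀ ℕ))).1
  refine ⟨φ, hφ0, fun i => ?_, ?_⟩
  · have := natCast_le_order_iff.mp (hφs 0) (Finsupp.single i 1) (by simp)
    rw [map_sub, sub_eq_zero] at this
    rw [this]
    change coeff _ φ₀ = _
    simp [φ₀, coeff_index_single_X]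
  · refine eq_of_natCast_le_order_sub fun n => ?_
    have h1 := le_order_lubinTateDefect_sub (π := π) hq2 hφ0 (hs n).1 (hφs n)
    have h2 := le_order_add h1 (hs n).2
    rw [sub_add_cancel] at h2
    rw [sub_zero]
    exact le_trans (by exact_mod_cast (by omega)) h2

end IsLubinTatePrime

end LubinTate

end MvPowerSeries

/-! ### Composition of series commuting with `π X + X ^ q`. -/

namespace MvPowerSeries

section LubinTate

variable {R : Type*} [CommRing R] {σ τ : Type} [Finite σ] [Finite τ] {π : R} {q : ℕ}

omit [Finite τ] in
/-- The linear terms of a composite. -/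
theorem coeff_single_subst [Fintype σ] {g : σ → MvPowerSeries τ R}
    (hg : ∀ i, constantCoeff (g i) = 0) (φ : MvPowerSeries σ R) (j : τ) :
    coeff (Finsupp.single j 1) (subst g φ) =
      ∑ i, coeff (Finsupp.single i 1) φ * coeff (Finsupp.single j 1) (g i) := by
  classical
  have hs := hasSubst_of_constantCoeff_zero hg
  let ψ : MvPowerSeries σ R := C (constantCoeff φ) + ∑ i, C (coeff (Finsupp.single i 1) φ) * X i
  -- Here `ψ` is the affine part of `φ`; substitution without constant terms preserves order two, so
  -- `ψ` alone determines the linear terms.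
  have h : ((2 : ℕ) : ℕ∞) ≤ (φ - ψ).order := by
    rw [natCast_le_order_iff]
    intro d hd
    rcases Nat.lt_or_ge d.degree 1 with h | h
    · have : d = 0 := by rwa [Nat.lt_one_iff, Finsupp.degree_eq_zero_iff] at h
      rw [this, coeff_zero_eq_constantCoeff_apply]
      simp [ψ]
    · obtain ⟨i, rfl⟩ := Finsupp.exists_eq_single_one_of_degree (d := d) (by omega)
      simp [ψ, coeff_index_single_X, coeff_C]
  have h1 := natCast_le_order_iff.mp (natCast_le_order_subst hs hg h) (Finsupp.single j 1)
    (by simp)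
  rw [subst_sub hs, map_sub, sub_eq_zero] at h1
  rw [h1, ← coe_substAlgHom hs]
  simp only [ψ, map_add, map_sum, ← smul_eq_C_mul, map_smul, substAlgHom_X]
  have h2 : substAlgHom hs (C (constantCoeff φ)) = C (constantCoeff φ) := by
    rw [coe_substAlgHom, subst_C]
  rw [h2]
  simp [coeff_C]

omit [Finite σ] [Finite τ] in
theorem subst_C_mul {g : σ → MvPowerSeries τ R} (hg : HasSubst g) (a : R)
    (φ : MvPowerSeries σ R) : subst g (C a * φ) = C a * subst g φ := by
  rw [subst_mul hg, subst_C]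

omit [Finite σ] [Finite τ] in
theorem subst_lubinTateVar {g : σ → MvPowerSeries τ R} (hg : HasSubst g) (i : σ) :
    subst g (lubinTateVar π q i) = C π * g i + g i ^ q := by
  rw [lubinTateVar, subst_add hg, subst_mul hg, subst_C, subst_pow hg, subst_X hg]

/-- Series which commute with `π X + X ^ q` are closed under composition. -/
theorem lubinTateDefect_subst (hq : q ≠ 0) {φ : MvPowerSeries σ R} (hφ : lubinTateDefect π q φ = 0)
    {g : σ → MvPowerSeries τ R} (hg0 : ∀ i, constantCoeff (g i) = 0)
    (hg : ∀ i, lubinTateDefect π q (g i) = 0) : lubinTateDefect π q (subst g φ) = 0 := by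
  have hs := hasSubst_of_constantCoeff_zero hg0
  rw [lubinTateDefect, sub_eq_zero] at hφ ⊢
  have h1 : ∀ i, subst g (lubinTateVar π q i) = subst (lubinTateVar π q) (g i) := by
    intro i
    have := hg i
    rw [lubinTateDefect, sub_eq_zero] at this
    rw [subst_lubinTateVar hs, this]
  rw [subst_comp_subst_apply hs (hasSubst_lubinTateVar hq), ← subst_C_mul hs, ← subst_pow hs,
    ← subst_add hs, hφ, subst_comp_subst_apply (hasSubst_lubinTateVar hq) hs]
  exact congrArg (fun b => subst b φ) (funext h1)

theorem lubinTateDefect_X (hq : q ≠ 0) (i : σ) :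
    lubinTateDefect π q (X i : MvPowerSeries σ R) = 0 := by
  rw [lubinTateDefect, subst_X (hasSubst_lubinTateVar hq), lubinTateVar, sub_self]

theorem lubinTateDefect_zero (hq : q ≠ 0) :
    lubinTateDefect π q (0 : MvPowerSeries σ R) = 0 := by
  rw [lubinTateDefect, ← coe_substAlgHom (hasSubst_lubinTateVar hq), map_zero, zero_pow hq]
  ring

end LubinTate

end MvPowerSeries

/-! ### Existence and formal properties of Lubin-Tate laws and endomorphisms. -/

namespace ColemanTrace

open MvPowerSeries (lubinTateVar lubinTateDefect IsLubinTatePrime constantCoeff_lubinTateVar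
  hasSubst_lubinTateVar lubinTateDefect_subst lubinTateDefect_X lubinTateDefect_zero
  coeff_single_subst natCast_le_order_iff)

variable {R : Type*} [CommRing R] {π : R}

theorem basicSeries_eq (π : R) : basicSeries π = lubinTateVar π (residueCard π) () := by
  rw [basicSeries, basicPoly, lubinTateVar]
  simp only [Polynomial.coe_add, Polynomial.coe_mul, Polynomial.coe_C, Polynomial.coe_X,
    Polynomial.coe_pow]
  rfl

theorem subst_basicSeries {τ : Type*} {g : MvPowerSeries τ R} (hg : PowerSeries.HasSubst g) :
    PowerSeries.subst g (basicSeries π) = MvPowerSeries.C π * g + g ^ residueCard π := by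
  rw [basicSeries, PowerSeries.subst_coe hg, basicPoly]
  simp only [map_add, map_mul, map_pow, Polynomial.aeval_X, Polynomial.aeval_C]
  rfl

theorem isLubinTateLaw_iff (F : FormalGroup R) :
    IsLubinTateLaw (basicSeries π) F ↔ lubinTateDefect π (residueCard π) F.toPowerSeries = 0 := by
  rw [IsLubinTateLaw, lubinTateDefect, sub_eq_zero,
    subst_basicSeries (PowerSeries.HasSubst.of_constantCoeff_zero F.zero_constantCoeff)]
  have : (fun i : Fin 2 => PowerSeries.subst (MvPowerSeries.X i : MvPowerSeries (Fin 2) R)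
      (basicSeries π)) = lubinTateVar π (residueCard π) := by
    funext i
    rw [subst_basicSeries (PowerSeries.HasSubst.X i), lubinTateVar]
  rw [this]

theorem isLubinTateEndo_iff (a : R) (φ : R⟦X⟧) :
    IsLubinTateEndo (basicSeries π) a φ ↔ MvPowerSeries.constantCoeff φ = 0 ∧
      MvPowerSeries.coeff (Finsupp.single () 1) φ = a ∧
      lubinTateDefect (σ := Unit) π (residueCard π) φ = 0 := by
  rw [IsLubinTateEndo, PowerSeries.coeff_zero_eq_constantCoeff]
  refine and_congr_right fun h0 => and_congr_right fun _ => ?_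
  rw [subst_basicSeries (PowerSeries.HasSubst.of_constantCoeff_zero' h0), lubinTateDefect,
    sub_eq_zero, basicSeries_eq]
  rfl

variable [IsDomain R] (hπ : IsLubinTatePrime π (residueCard π))
include hπ

/-- The candidate is the series with linear part `X + Y`. Both sides of associativity have linear
part `X + Y + Z` and commute with the basic polynomial, so uniqueness identifies them. The same
pattern gives the remaining formal identities below. -/
theorem exists_isLubinTateLaw : ∃ F, IsLubinTateLaw (basicSeries π) F := by
  have hq : residueCard π ≠ 0 := by have := hπ.two_le; omega
  obtain ⟨F, h0, h1, h2⟩ := hπ.exists_defect_eq_zero (σ := Fin 2) (fun _ => 1)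
  have hX : ∀ i j : Fin 3, ∀ k : Fin 2, MvPowerSeries.constantCoeff
      (![MvPowerSeries.X i, MvPowerSeries.X j] k : MvPowerSeries (Fin 3) R) = 0 := by
    intro i j k; fin_cases k <;> simp
  have hXd : ∀ i j : Fin 3, ∀ k : Fin 2, lubinTateDefect π (residueCard π)
      (![MvPowerSeries.X i, MvPowerSeries.X j] k : MvPowerSeries (Fin 3) R) = 0 := by
    intro i j k; fin_cases k <;> exact lubinTateDefect_X hq _
  have hF0 : ∀ i j : Fin 3, MvPowerSeries.constantCoeff
      (MvPowerSeries.subst ![MvPowerSeries.X i, MvPowerSeries.X j] F : MvPowerSeries (Fin 3) R)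
      = 0 := fun i j => MvPowerSeries.constantCoeff_subst_eq_zero
        (MvPowerSeries.hasSubst_of_constantCoeff_zero (hX i j)) (hX i j) h0
  have hFd : ∀ i j : Fin 3, lubinTateDefect π (residueCard π)
      (MvPowerSeries.subst ![MvPowerSeries.X i, MvPowerSeries.X j] F : MvPowerSeries (Fin 3) R)
      = 0 := fun i j => lubinTateDefect_subst hq h2 (hX i j) (hXd i j)
  have hL : ∀ k : Fin 2, MvPowerSeries.constantCoeff
      (![MvPowerSeries.subst ![MvPowerSeries.X 0, MvPowerSeries.X 1] F, MvPowerSeries.X 2] k :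
        MvPowerSeries (Fin 3) R) = 0 := by
    intro k; fin_cases k
    · exact hF0 0 1
    · simp
  have hR : ∀ k : Fin 2, MvPowerSeries.constantCoeff
      (![MvPowerSeries.X 0, MvPowerSeries.subst ![MvPowerSeries.X 1, MvPowerSeries.X 2] F] k :
        MvPowerSeries (Fin 3) R) = 0 := by
    intro k; fin_cases k
    · simp
    · exact hF0 1 2
  refine ⟨⟨F, h0, h1 0, h1 1, ?_⟩, ?_⟩
  · refine hπ.eq_of_defect_eq_zero
      (MvPowerSeries.constantCoeff_subst_eq_zero
        (MvPowerSeries.hasSubst_of_constantCoeff_zero hL) hL h0)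
      (MvPowerSeries.constantCoeff_subst_eq_zero
        (MvPowerSeries.hasSubst_of_constantCoeff_zero hR) hR h0) ?_
      (lubinTateDefect_subst hq h2 hL ?_) (lubinTateDefect_subst hq h2 hR ?_)
    · intro i
      rw [coeff_single_subst hL, coeff_single_subst hR]
      simp only [Fin.sum_univ_two, h1, one_mul, Matrix.cons_val_zero, Matrix.cons_val_one]
      rw [coeff_single_subst (hX 0 1), coeff_single_subst (hX 1 2)]
      simp only [Fin.sum_univ_two, h1, one_mul, Matrix.cons_val_zero, Matrix.cons_val_one, add_assoc]
    · intro k; fin_cases k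
      · exact hFd 0 1
      · exact lubinTateDefect_X hq _
    · intro k; fin_cases k
      · exact lubinTateDefect_X hq _
      · exact hFd 1 2
  · rw [isLubinTateLaw_iff]
    exact h2

theorem isLubinTateLaw_lubinTateLaw :
    IsLubinTateLaw (basicSeries π) (lubinTateLaw (basicSeries π)) := by
  have h := exists_isLubinTateLaw hπ
  rw [lubinTateLaw, dif_pos h]
  exact h.choose_spec

theorem lubinTateDefect_law :
    lubinTateDefect π (residueCard π) (lubinTateLaw (basicSeries π)).toPowerSeries = 0 :=
  (isLubinTateLaw_iff _).mp (isLubinTateLaw_lubinTateLaw hπ)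

omit [IsDomain R] in
theorem isLubinTateEndo_lubinTateEndo (a : R) :
    IsLubinTateEndo (basicSeries π) a (lubinTateEndo (basicSeries π) a) := by
  have h : ∃ φ, IsLubinTateEndo (basicSeries π) a φ := by
    obtain ⟨φ, h0, h1, h2⟩ := hπ.exists_defect_eq_zero (σ := Unit) (fun _ => a)
    exact ⟨φ, (isLubinTateEndo_iff a φ).mpr ⟨h0, h1 (), h2⟩⟩
  rw [lubinTateEndo, dif_pos h]
  exact h.choose_spec

theorem IsLubinTateEndo.eq {a : R} {φ ψ : R⟦X⟧} (hφ : IsLubinTateEndo (basicSeries π) a φ)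
    (hψ : IsLubinTateEndo (basicSeries π) a ψ) : φ = ψ := by
  rw [isLubinTateEndo_iff] at hφ hψ
  exact hπ.eq_of_defect_eq_zero (σ := Unit) hφ.1 hψ.1 (fun _ => by rw [hφ.2.1, hψ.2.1]) hφ.2.2 hψ.2.2

theorem lubinTateEndo_self : lubinTateEndo (basicSeries π) π = basicSeries π := by
  have hq := hπ.two_le
  refine IsLubinTateEndo.eq hπ (isLubinTateEndo_lubinTateEndo hπ π) ?_
  rw [isLubinTateEndo_iff, basicSeries_eq]
  refine ⟨constantCoeff_lubinTateVar (by omega) _, ?_, ?_⟩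
  · rw [lubinTateVar, map_add, MvPowerSeries.coeff_C_mul, MvPowerSeries.coeff_index_single_self_X,
      MvPowerSeries.coeff_X_pow, if_neg, mul_one, add_zero]
    intro h
    have := DFunLike.congr_fun h ()
    simp at this
    omega
  · rw [lubinTateDefect, MvPowerSeries.subst_lubinTateVar (hasSubst_lubinTateVar (by omega)),
      sub_self]

/-- `[a b] = [a] ∘ f` if `f` is the endomorphism `[b]` with `b = π`. -/
theorem lubinTateEndo_mul_self (a : R) : lubinTateEndo (basicSeries π) (a * π) =
    PowerSeries.subst (basicSeries π) (lubinTateEndo (basicSeries π) a) := by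
  have hq := hπ.two_le
  refine IsLubinTateEndo.eq hπ (isLubinTateEndo_lubinTateEndo hπ _) ?_
  have h1 := (isLubinTateEndo_iff _ _).mp (isLubinTateEndo_lubinTateEndo hπ a)
  have h2 := (isLubinTateEndo_iff _ _).mp (isLubinTateEndo_lubinTateEndo hπ π)
  rw [lubinTateEndo_self hπ] at h2
  rw [isLubinTateEndo_iff, PowerSeries.subst]
  refine ⟨MvPowerSeries.constantCoeff_subst_eq_zero
    (MvPowerSeries.hasSubst_of_constantCoeff_zero fun _ => h2.1) (fun _ => h2.1) h1.1, ?_,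
    lubinTateDefect_subst (by omega) h1.2.2 (fun _ => h2.1) fun _ => h2.2.2⟩
  rw [coeff_single_subst (fun _ => h2.1)]
  simp [h1.2.1, h2.2.1]

theorem isComm_lubinTateLaw : (lubinTateLaw (basicSeries π)).IsComm := by
  have hq := hπ.two_le
  set F := lubinTateLaw (basicSeries π)
  have hX : ∀ k : Fin 2, MvPowerSeries.constantCoeff
      (![MvPowerSeries.X 1, MvPowerSeries.X 0] k : MvPowerSeries (Fin 2) R) = 0 := by
    intro k; fin_cases k <;> simp
  refine ⟨hπ.eq_of_defect_eq_zero F.zero_constantCoeff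
    (MvPowerSeries.constantCoeff_subst_eq_zero
      (MvPowerSeries.hasSubst_of_constantCoeff_zero hX) hX F.zero_constantCoeff) ?_
    (lubinTateDefect_law hπ) (lubinTateDefect_subst (by omega) (lubinTateDefect_law hπ) hX ?_)⟩
  · intro i
    rw [coeff_single_subst hX]
    fin_cases i <;> simp [MvPowerSeries.coeff_index_single_X, F.lin_coeff_X, F.lin_coeff_Y]
  · intro k; fin_cases k <;> exact lubinTateDefect_X (by omega) _

/-- The defect of `X + Y` is `(X + Y) ^ q - X ^ q - Y ^ q`, of order at least `q`; approximate
uniqueness then compares it with the law up to degree `q`. -/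
theorem le_order_lubinTateLaw : (residueCard π : ℕ∞) ≤ ((lubinTateLaw (basicSeries π)).toPowerSeries
    - (MvPowerSeries.X 0 + MvPowerSeries.X 1)).order := by
  have hq := hπ.two_le
  refine hπ.le_order_sub_of_le_order_defect (FormalGroup.zero_constantCoeff _) (by simp) ?_ ?_ ?_
  · intro i
    fin_cases i <;> simp [MvPowerSeries.coeff_index_single_X, FormalGroup.lin_coeff_X,
      FormalGroup.lin_coeff_Y]
  · rw [lubinTateDefect_law hπ, MvPowerSeries.order_zero]
    exact le_top
  · have hs := hasSubst_lubinTateVar (σ := Fin 2) (π := π) (q := residueCard π) (by omega)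
    have hpow : ∀ φ : MvPowerSeries (Fin 2) R, MvPowerSeries.constantCoeff φ = 0 →
        (residueCard π : ℕ∞) ≤ (φ ^ residueCard π).order := fun φ h =>
      MvPowerSeries.le_order_pow_of_constantCoeff_eq_zero _ h
    have : lubinTateDefect π (residueCard π)
        (MvPowerSeries.X 0 + MvPowerSeries.X 1 : MvPowerSeries (Fin 2) R) =
        (MvPowerSeries.X 0 + MvPowerSeries.X 1) ^ residueCard π -
        (MvPowerSeries.X 0 ^ residueCard π + MvPowerSeries.X 1 ^ residueCard π) := by
      rw [lubinTateDefect, MvPowerSeries.subst_add hs, MvPowerSeries.subst_X hs,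
        MvPowerSeries.subst_X hs, lubinTateVar, lubinTateVar]
      ring
    rw [this]
    exact MvPowerSeries.le_order_sub (hpow _ (by simp))
      (MvPowerSeries.le_order_add (hpow _ (by simp)) (hpow _ (by simp)))

/-- The inverse is the series with linear term `-X` that commutes with the basic polynomial, that
is, `[-1]`. -/
theorem exists_inverse_lubinTateLaw : ∃ ι : R⟦X⟧, MvPowerSeries.constantCoeff ι = 0 ∧
    MvPowerSeries.subst ![PowerSeries.X, ι] (lubinTateLaw (basicSeries π)).toPowerSeries = 0 := by
  have hq := hπ.two_le
  obtain ⟨ι, h0, h1, h2⟩ := hπ.exists_defect_eq_zero (σ := Unit) (fun _ => -1)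
  have hX : ∀ k : Fin 2, MvPowerSeries.constantCoeff
      (![PowerSeries.X, ι] k : MvPowerSeries Unit R) = 0 := by
    intro k; fin_cases k
    · exact MvPowerSeries.constantCoeff_X ()
    · exact h0
  refine ⟨ι, h0, hπ.eq_of_defect_eq_zero (σ := Unit) (MvPowerSeries.constantCoeff_subst_eq_zero
      (MvPowerSeries.hasSubst_of_constantCoeff_zero hX) hX (FormalGroup.zero_constantCoeff _))
      (map_zero _) ?_
      (lubinTateDefect_subst (by omega) (lubinTateDefect_law hπ) hX ?_)
      (lubinTateDefect_zero (by omega))⟩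
  · intro i
    rw [coeff_single_subst hX]
    simp [FormalGroup.lin_coeff_X, FormalGroup.lin_coeff_Y, h1, PowerSeries.X]
  · intro k; fin_cases k
    · exact lubinTateDefect_X (by omega) ()
    · exact h2

/-- `[a]` is an endomorphism of the formal group law. -/
theorem subst_lubinTateEndo (a : R) :
    PowerSeries.subst (lubinTateLaw (basicSeries π)).toPowerSeries
      (lubinTateEndo (basicSeries π) a) =
    MvPowerSeries.subst (fun i : Fin 2 => PowerSeries.subst
      (MvPowerSeries.X i : MvPowerSeries (Fin 2) R) (lubinTateEndo (basicSeries π) a))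
      (lubinTateLaw (basicSeries π)).toPowerSeries := by
  have hq := hπ.two_le
  set F := lubinTateLaw (basicSeries π) with hF
  obtain ⟨h0, h1, h2⟩ := (isLubinTateEndo_iff _ _).mp (isLubinTateEndo_lubinTateEndo hπ a)
  have hX : ∀ i : Fin 2, MvPowerSeries.constantCoeff (PowerSeries.subst
      (MvPowerSeries.X i : MvPowerSeries (Fin 2) R) (lubinTateEndo (basicSeries π) a)) = 0 :=
    fun i => PowerSeries.constantCoeff_subst_eq_zero (MvPowerSeries.constantCoeff_X i) _ h0
  refine hπ.eq_of_defect_eq_zero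
    (PowerSeries.constantCoeff_subst_eq_zero F.zero_constantCoeff _ h0)
    (MvPowerSeries.constantCoeff_subst_eq_zero
      (MvPowerSeries.hasSubst_of_constantCoeff_zero hX) hX F.zero_constantCoeff) ?_
    (lubinTateDefect_subst (by omega) h2 (fun _ => F.zero_constantCoeff)
      fun _ => lubinTateDefect_law hπ)
    (lubinTateDefect_subst (by omega) (lubinTateDefect_law hπ) hX fun i =>
      lubinTateDefect_subst (by omega) h2 (fun _ => MvPowerSeries.constantCoeff_X i)
        fun _ => lubinTateDefect_X (by omega) i)
  intro i
  rw [coeff_single_subst hX, PowerSeries.subst, coeff_single_subst fun _ => F.zero_constantCoeff]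
  simp only [PowerSeries.subst]
  simp only [coeff_single_subst (fun _ => MvPowerSeries.constantCoeff_X _), h1]
  fin_cases i <;> simp [F.lin_coeff_X, F.lin_coeff_Y, MvPowerSeries.coeff_index_single_X]

end ColemanTrace

/-! ### Continuous evaluation of power series at topologically nilpotent points. -/

namespace MvPowerSeries

open scoped WithPiTopology
open Filter Topology

section Coefficients

variable {A : Type*} [CommRing A] {τ : Type*}

/-- The power series with coefficients in a subring. -/
def coeffSubring (τ : Type*) (O : Subring A) : Subring (MvPowerSeries τ A) where
  carrier := {f | ∀ d, coeff d f ∈ O}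
  mul_mem' {f f'} hf hf' d := by
    classical
    rw [coeff_mul]
    exact O.sum_mem fun p _ => O.mul_mem (hf _) (hf' _)
  one_mem' d := by
    classical
    rw [coeff_one]
    split_ifs
    exacts [O.one_mem, O.zero_mem]
  add_mem' {f f'} hf hf' d := by
    rw [map_add]
    exact O.add_mem (hf d) (hf' d)
  zero_mem' d := by
    rw [coeff_zero]
    exact O.zero_mem
  neg_mem' {f} hf d := by
    rw [map_neg]
    exact O.neg_mem (hf d)

theorem mem_coeffSubring {O : Subring A} {f : MvPowerSeries τ A} :
    f ∈ coeffSubring τ O ↔ ∀ d, coeff d f ∈ O := Iff.rfl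

theorem C_mem_coeffSubring {O : Subring A} {a : A} (ha : a ∈ O) :
    (C a : MvPowerSeries τ A) ∈ coeffSubring τ O := by
  classical
  intro d
  rw [coeff_C]
  split_ifs
  exacts [ha, O.zero_mem]

theorem X_mem_coeffSubring {O : Subring A} (i : τ) :
    (X i : MvPowerSeries τ A) ∈ coeffSubring τ O := by
  classical
  intro d
  rw [coeff_X]
  split_ifs
  exacts [O.one_mem, O.zero_mem]

variable [TopologicalSpace A]

theorem isClosed_coeffSubring {O : Subring A} (hO : IsClosed (O : Set A)) :
    IsClosed (coeffSubring τ O : Set (MvPowerSeries τ A)) := by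
  have : (coeffSubring τ O : Set (MvPowerSeries τ A)) =
      ⋂ d, coeff d ⁻¹' (O : Set A) := by
    ext f
    simp [mem_coeffSubring]
  rw [this]
  exact isClosed_iInter fun d => hO.preimage (WithPiTopology.continuous_coeff A d)

theorem isCompact_coeffSubring {O : Subring A} (hO : IsCompact (O : Set A)) :
    IsCompact (coeffSubring τ O : Set (MvPowerSeries τ A)) := by
  have h := isCompact_univ_pi (ι := τ →₀ ℕ) (s := fun _ => (O : Set A)) fun _ => hO
  have : (coeffSubring τ O : Set (MvPowerSeries τ A)) =
      Set.pi Set.univ fun _ : τ →₀ ℕ => (O : Set A) :=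
    Set.ext fun _ => ⟨fun h d _ => h d, fun h d => h d trivial⟩
  rw [this]
  exact h

theorem isClosed_C_dvd {a : A} (ha : IsClosed (Ideal.span {a} : Set A)) :
    IsClosed {f : MvPowerSeries τ A | C a ∣ f} := by
  have : {f : MvPowerSeries τ A | C a ∣ f} = ⋂ d, coeff d ⁻¹' (Ideal.span {a} : Set A) := by
    ext f
    simp [C_dvd_iff, Ideal.mem_span_singleton]
  rw [this]
  exact isClosed_iInter fun d => ha.preimage (WithPiTopology.continuous_coeff A d)

end Coefficients

section Eval

variable {A : Type*} [CommRing A] [UniformSpace A]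
variable {σ τ υ : Type*}

/-- The value of the power series `h` at the family `g` of power series. -/
noncomputable def evalAt (g : σ → MvPowerSeries τ A) (h : MvPowerSeries σ A) : MvPowerSeries τ A :=
  eval₂ (algebraMap A (MvPowerSeries τ A)) g h

/-- Power series which can be substituted: those with topologically nilpotent constant
coefficient. -/
def IsSmall (g : MvPowerSeries τ A) : Prop := IsTopologicallyNilpotent (constantCoeff g)

theorem isSmall_of_constantCoeff_eq_zero {g : MvPowerSeries τ A} (h : constantCoeff g = 0) :
    IsSmall g := by
  rw [IsSmall, h]
  exact IsTopologicallyNilpotent.zero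

theorem isSmall_X (i : τ) : IsSmall (X i : MvPowerSeries τ A) :=
  isSmall_of_constantCoeff_eq_zero (constantCoeff_X i)

theorem isSmall_C {a : A} (ha : IsTopologicallyNilpotent a) : IsSmall (C a : MvPowerSeries τ A) := by
  rwa [IsSmall, constantCoeff_C]

variable {g : σ → MvPowerSeries τ A}

theorem evalAt_C (a : A) : evalAt g (C a) = C a := by
  rw [evalAt, eval₂_C]
  rfl

theorem evalAt_X (i : σ) : evalAt g (X i) = g i := by
  rw [evalAt, eval₂_X]

theorem evalAt_coe (P : MvPolynomial σ A) : evalAt g (P : MvPowerSeries σ A) =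
    MvPolynomial.aeval g P := by
  rw [evalAt, eval₂_coe, MvPolynomial.aeval_def]

variable [IsUniformAddGroup A] [IsTopologicalRing A] [CompleteSpace A] [T2Space A]
  [IsLinearTopology A A]

omit [IsUniformAddGroup A] [IsTopologicalRing A] [CompleteSpace A] [T2Space A] in
theorem isSmall_iff {g : MvPowerSeries τ A} : IsSmall g ↔ IsTopologicallyNilpotent g :=
  (LinearTopology.isTopologicallyNilpotent_iff_constantCoeff g).symm

variable [Finite σ]

omit [IsUniformAddGroup A] [IsTopologicalRing A] [CompleteSpace A] [T2Space A] in
theorem hasEval_of_isSmall {g : σ → MvPowerSeries τ A} (hg : ∀ i, IsSmall (g i)) : HasEval g where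
  hpow i := isSmall_iff.mp (hg i)
  tendsto_zero := by
    rw [Filter.cofinite_eq_bot]
    exact Filter.tendsto_bot

variable (hg : ∀ i, IsSmall (g i))
include hg

theorem evalAt_eq_aeval : evalAt g = aeval (hasEval_of_isSmall hg) := by
  rw [coe_aeval]
  rfl

theorem continuous_evalAt : Continuous (evalAt g) := by
  rw [evalAt_eq_aeval hg]
  exact continuous_aeval _

theorem evalAt_add (h k : MvPowerSeries σ A) : evalAt g (h + k) = evalAt g h + evalAt g k := by
  rw [evalAt_eq_aeval hg, map_add]

theorem evalAt_sub (h k : MvPowerSeries σ A) : evalAt g (h - k) = evalAt g h - evalAt g k := by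
  rw [evalAt_eq_aeval hg, map_sub]

theorem evalAt_mul (h k : MvPowerSeries σ A) : evalAt g (h * k) = evalAt g h * evalAt g k := by
  rw [evalAt_eq_aeval hg, map_mul]

theorem evalAt_pow (h : MvPowerSeries σ A) (n : ℕ) : evalAt g (h ^ n) = evalAt g h ^ n := by
  rw [evalAt_eq_aeval hg, map_pow]

theorem evalAt_zero : evalAt g 0 = 0 := by
  rw [evalAt_eq_aeval hg, map_zero]

theorem hasSum_evalAt (h : MvPowerSeries σ A) :
    HasSum (fun d : σ →₀ ℕ => C (coeff d h) * d.prod fun i k => g i ^ k) (evalAt g h) := by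
  rw [evalAt_eq_aeval hg]
  have := hasSum_aeval (hasEval_of_isSmall hg) h
  simp only [smul_eq_C_mul] at this
  exact this

theorem IsSmall.evalAt {h : MvPowerSeries σ A} (hh : IsSmall h) : IsSmall (evalAt g h) := by
  rw [isSmall_iff] at hh ⊢
  rw [evalAt_eq_aeval hg]
  exact hh.map (continuous_aeval (hasEval_of_isSmall hg))

theorem evalAt_evalAt [Finite τ] {b : τ → MvPowerSeries υ A} (hb : ∀ i, IsSmall (b i))
    (h : MvPowerSeries σ A) : MvPowerSeries.evalAt b (MvPowerSeries.evalAt g h) =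
      MvPowerSeries.evalAt (fun i => MvPowerSeries.evalAt b (g i)) h := by
  have h1 := comp_aeval (R := A) (hasEval_of_isSmall hg)
    (ε := aeval (hasEval_of_isSmall hb)) (continuous_aeval (hasEval_of_isSmall hb))
  rw [evalAt_eq_aeval hb, evalAt_eq_aeval hg,
    evalAt_eq_aeval fun i => by rw [← evalAt_eq_aeval hb]; exact IsSmall.evalAt hb (hg i)]
  exact DFunLike.congr_fun h1 h

omit hg in
-- Formal substitution has finite coefficient sums, and these are also the limits of the convergent
-- series.
theorem subst_eq_evalAt {a : σ → MvPowerSeries τ A} (ha : HasSubst a)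
    (h : MvPowerSeries σ A) : subst a h = evalAt a h := by
  have hsmall : ∀ i, IsSmall (a i) := fun i => by
    obtain ⟨n, hn⟩ := ha.const_coeff i
    refine tendsto_atTop_of_eventually_const (i₀ := n) fun m hm => ?_
    exact pow_eq_zero_of_le hm hn
  have h1 := hasSum_evalAt hsmall h
  refine HasSum.unique ?_ h1
  rw [WithPiTopology.hasSum_iff_hasSum_coeff]
  intro e
  rw [coeff_subst ha]
  have hf := coeff_subst_finite ha h e
  simp only [smul_eq_mul] at hf ⊢
  simp only [coeff_C_mul]
  have hf' : (Function.support fun d : σ →₀ ℕ =>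
    coeff d h * coeff e (d.prod fun s k => a s ^ k)).Finite := hf
  rw [finsum_eq_sum_of_support_subset _ (s := hf'.toFinset) (by rw [Set.Finite.coe_toFinset])]
  exact hasSum_sum_of_ne_finset_zero fun d hd => by
    rwa [Set.Finite.mem_toFinset, Function.notMem_support] at hd

/-- The value of a power series depends continuously on the point: congruences modulo a closed
ideal are preserved. -/
theorem evalAt_sub_evalAt_mem {g' : σ → MvPowerSeries τ A} (hg' : ∀ i, IsSmall (g' i))
    {I : Ideal (MvPowerSeries τ A)} (hI : IsClosed (I : Set (MvPowerSeries τ A)))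
    (hgg' : ∀ i, g i - g' i ∈ I) (h : MvPowerSeries σ A) : evalAt g h - evalAt g' h ∈ I := by
  refine hI.mem_of_tendsto ((hasSum_evalAt hg h).sub (hasSum_evalAt hg' h))
    (Eventually.of_forall fun s => I.sum_mem fun d _ => ?_)
  rw [← mul_sub]
  refine I.mul_mem_left _ ?_
  rw [← Ideal.Quotient.eq_zero_iff_mem, map_sub, sub_eq_zero, map_finsuppProd, map_finsuppProd]
  refine Finsupp.prod_congr fun i _ => ?_
  rw [map_pow, map_pow]
  congr 1
  exact Ideal.Quotient.eq.mpr (hgg' i)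

/-- Only monomials of degree at least `k` occur, each a product of at least `k` multiples of `a ^
n`; closedness passes this to the limit. -/
theorem C_pow_dvd_evalAt {a : A} {n k : ℕ}
    (hclosed : IsClosed {f : MvPowerSeries τ A | C (a ^ (n * k)) ∣ f})
    (hdvd : ∀ i, C (a ^ n) ∣ g i) {h : MvPowerSeries σ A} (hh : (k : ℕ∞) ≤ h.order) :
    C (a ^ (n * k)) ∣ evalAt g h := by
  refine hclosed.mem_of_tendsto (hasSum_evalAt hg h)
    (Eventually.of_forall fun s => Finset.dvd_sum fun d _ => ?_)
  rcases Nat.lt_or_ge d.degree k with hd | hd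
  · rw [natCast_le_order_iff.mp hh d hd, map_zero, zero_mul]
    exact dvd_zero _
  · refine Dvd.dvd.mul_left ?_ _
    have h1 : (C (a ^ n) : MvPowerSeries τ A) ^ d.degree ∣ d.prod fun i k => g i ^ k := by
      rw [Finsupp.degree_apply, ← Finset.prod_pow_eq_pow_sum]
      exact Finset.prod_dvd_prod_of_dvd _ _ fun i _ => pow_dvd_pow_of_dvd (hdvd i) _
    refine dvd_trans ?_ h1
    rw [pow_mul, map_pow C (a ^ n) k]
    exact pow_dvd_pow _ hd

theorem C_dvd_evalAt {a : A} (hclosed : IsClosed {f : MvPowerSeries τ A | C a ∣ f})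
    (hdvd : ∀ i, C a ∣ g i) {h : MvPowerSeries σ A} (hh : constantCoeff h = 0) :
    C a ∣ evalAt g h := by
  have := C_pow_dvd_evalAt (n := 1) (k := 1) (a := a) hg (by simpa using hclosed)
    (by simpa using hdvd) (one_le_order_of_constantCoeff hh)
  simpa using this

theorem evalAt_mem_coeffSubring {O : Subring A} (hO : IsClosed (O : Set A))
    (hgO : ∀ i, g i ∈ coeffSubring τ O) {h : MvPowerSeries σ A} (hh : h ∈ coeffSubring σ O) :
    evalAt g h ∈ coeffSubring τ O := by
  refine (isClosed_coeffSubring hO).mem_of_tendsto (hasSum_evalAt hg h)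
    (Eventually.of_forall fun s => Subring.sum_mem _ fun d _ => ?_)
  exact Subring.mul_mem _ (C_mem_coeffSubring (hh d))
    (Subring.prod_mem _ fun i _ => Subring.pow_mem _ (hgO i) _)

end Eval

end MvPowerSeries

/-! ### The group of points of a formal group law. -/

namespace FormalGroup

open MvPowerSeries (evalAt IsSmall)
open scoped MvPowerSeries.WithPiTopology

/-- The formal group law `F` has a formal inverse. -/
class HasInverse {R : Type*} [CommRing R] (F : FormalGroup R) : Prop where
  exists_inverse : ∃ ι : R⟦X⟧, MvPowerSeries.constantCoeff ι = 0 ∧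
    MvPowerSeries.subst ![PowerSeries.X, ι] F.toPowerSeries = 0

variable {A : Type*} [CommRing A] [UniformSpace A] {τ υ : Type*}

/-- The points of the formal group law `F` in the power series whose constant coefficient is
topologically nilpotent. -/
@[ext]
structure SmallPoint (F : FormalGroup A) (τ : Type*) where
  /-- The underlying power series. -/
  val : MvPowerSeries τ A
  isSmall : IsSmall val

namespace SmallPoint

variable {F : FormalGroup A}

theorem isSmall_cons {a b : MvPowerSeries τ A} (ha : IsSmall a) (hb : IsSmall b) (i : Fin 2) :
    IsSmall (![a, b] i) := by
  fin_cases i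
  exacts [ha, hb]

variable [IsUniformAddGroup A] [IsTopologicalRing A] [CompleteSpace A] [T2Space A]
  [IsLinearTopology A A]

theorem isSmall_evalAt_cons {a b : MvPowerSeries τ A} (ha : IsSmall a) (hb : IsSmall b) :
    IsSmall (evalAt ![a, b] F.toPowerSeries) :=
  MvPowerSeries.IsSmall.evalAt (isSmall_cons ha hb)
    (MvPowerSeries.isSmall_of_constantCoeff_eq_zero F.zero_constantCoeff)

theorem evalAt_cons_evalAt {a b : MvPowerSeries τ A} (ha : IsSmall a) (hb : IsSmall b) [Finite τ]
    {g : τ → MvPowerSeries υ A} (hg : ∀ i, IsSmall (g i)) (h : MvPowerSeries (Fin 2) A) :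
    evalAt g (evalAt ![a, b] h) = evalAt ![evalAt g a, evalAt g b] h := by
  rw [MvPowerSeries.evalAt_evalAt (isSmall_cons ha hb) hg]
  congr 1
  funext i
  fin_cases i <;> rfl

noncomputable instance : Add (F.SmallPoint τ) where
  add a b := ⟨evalAt ![a.1, b.1] F.toPowerSeries, isSmall_evalAt_cons a.2 b.2⟩

instance : Zero (F.SmallPoint τ) where
  zero := ⟨0, MvPowerSeries.isSmall_of_constantCoeff_eq_zero (map_zero _)⟩

omit [IsUniformAddGroup A] [IsTopologicalRing A] [CompleteSpace A] [T2Space A]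
  [IsLinearTopology A A] in
theorem coe_zero : (0 : F.SmallPoint τ).1 = 0 := rfl

/-- The bridge from formal identities to points: evaluating both sides of an axiom of `F` at a
family of small series gives the corresponding group identity. -/
theorem evalAt_subst {σ : Type*} [Finite σ] [Finite τ] {a : σ → MvPowerSeries τ A}
    (ha : ∀ i, MvPowerSeries.constantCoeff (a i) = 0)
    {g : τ → MvPowerSeries υ A} (hg : ∀ i, IsSmall (g i)) (h : MvPowerSeries σ A) :
    evalAt g (MvPowerSeries.subst a h) = evalAt (fun i => evalAt g (a i)) h := by
  rw [MvPowerSeries.subst_eq_evalAt (MvPowerSeries.hasSubst_of_constantCoeff_zero ha),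
    MvPowerSeries.evalAt_evalAt
      (fun i => MvPowerSeries.isSmall_of_constantCoeff_eq_zero (ha i)) hg]

theorem evalAt_subst_cons [Finite τ] {a b : MvPowerSeries τ A}
    (ha : MvPowerSeries.constantCoeff a = 0) (hb : MvPowerSeries.constantCoeff b = 0)
    {g : τ → MvPowerSeries υ A} (hg : ∀ i, IsSmall (g i)) (h : MvPowerSeries (Fin 2) A) :
    evalAt g (MvPowerSeries.subst ![a, b] h) = evalAt ![evalAt g a, evalAt g b] h := by
  have h0 : ∀ i : Fin 2, MvPowerSeries.constantCoeff (![a, b] i) = 0 := by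
    intro i
    fin_cases i
    exacts [ha, hb]
  rw [evalAt_subst h0 hg]
  congr 1
  funext i
  fin_cases i <;> rfl

theorem evalAt_cons_zero {a : MvPowerSeries τ A} (ha : IsSmall a) :
    evalAt ![a, 0] F.toPowerSeries = a := by
  have h := congrArg (evalAt fun _ : Unit => a) F.Xzero_eq_X
  rw [Xzero, PowerSeries.X, evalAt_subst_cons (MvPowerSeries.constantCoeff_X ()) (map_zero _) fun _ => ha,
    MvPowerSeries.evalAt_zero (fun _ => ha), MvPowerSeries.evalAt_X] at h
  exact h

theorem evalAt_zero_cons {a : MvPowerSeries τ A} (ha : IsSmall a) :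
    evalAt ![0, a] F.toPowerSeries = a := by
  have h := congrArg (evalAt fun _ : Unit => a) F.zeroX_eq_X
  rw [zeroX, PowerSeries.X, evalAt_subst_cons (map_zero _) (MvPowerSeries.constantCoeff_X ()) fun _ => ha,
    MvPowerSeries.evalAt_zero (fun _ => ha), MvPowerSeries.evalAt_X] at h
  exact h

theorem evalAt_cons_assoc {a b c : MvPowerSeries τ A} (ha : IsSmall a) (hb : IsSmall b)
    (hc : IsSmall c) :
    evalAt ![evalAt ![a, b] F.toPowerSeries, c] F.toPowerSeries =
      evalAt ![a, evalAt ![b, c] F.toPowerSeries] F.toPowerSeries := by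
  have hg : ∀ i : Fin 3, IsSmall (![a, b, c] i) := by
    intro i
    fin_cases i
    exacts [ha, hb, hc]
  have hX : ∀ i : Fin 3, MvPowerSeries.constantCoeff
      (MvPowerSeries.X i : MvPowerSeries (Fin 3) A) = 0 := MvPowerSeries.constantCoeff_X
  have hX2 : ∀ i j : Fin 3, ∀ k : Fin 2, MvPowerSeries.constantCoeff
      (![MvPowerSeries.X i, MvPowerSeries.X j] k : MvPowerSeries (Fin 3) A) = 0 := by
    intro i j k
    fin_cases k <;> simp
  have hF : ∀ i j : Fin 3, MvPowerSeries.constantCoeff (MvPowerSeries.subst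
      ![MvPowerSeries.X i, MvPowerSeries.X j] F.toPowerSeries : MvPowerSeries (Fin 3) A) = 0 :=
    fun i j => MvPowerSeries.constantCoeff_subst_eq_zero
      (MvPowerSeries.hasSubst_of_constantCoeff_zero (hX2 i j)) (hX2 i j) F.zero_constantCoeff
  have h := congrArg (evalAt ![a, b, c]) F.assoc
  rw [evalAt_subst_cons (hF 0 1) (hX 2) hg, evalAt_subst_cons (hX 0) (hF 1 2) hg,
    evalAt_subst_cons (hX 0) (hX 1) hg, evalAt_subst_cons (hX 1) (hX 2) hg] at h
  simp only [MvPowerSeries.evalAt_X] at h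
  exact h

theorem evalAt_cons_comm [F.IsComm] {a b : MvPowerSeries τ A} (ha : IsSmall a) (hb : IsSmall b) :
    evalAt ![a, b] F.toPowerSeries = evalAt ![b, a] F.toPowerSeries := by
  have h := congrArg (evalAt ![a, b]) (IsComm.comm (F := F))
  rw [evalAt_subst_cons (MvPowerSeries.constantCoeff_X _) (MvPowerSeries.constantCoeff_X _)
    (isSmall_cons ha hb), MvPowerSeries.evalAt_X, MvPowerSeries.evalAt_X] at h
  exact h

theorem evalAt_cons_inverse {ι : A⟦X⟧} (hι0 : MvPowerSeries.constantCoeff ι = 0)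
    (hι : MvPowerSeries.subst ![PowerSeries.X, ι] F.toPowerSeries = 0)
    {a : MvPowerSeries τ A} (ha : IsSmall a) :
    evalAt ![a, evalAt (fun _ => a) ι] F.toPowerSeries = 0 := by
  have h := congrArg (evalAt fun _ : Unit => a) hι
  rw [PowerSeries.X, evalAt_subst_cons (MvPowerSeries.constantCoeff_X _) hι0 fun _ => ha,
    MvPowerSeries.evalAt_X, MvPowerSeries.evalAt_zero fun _ => ha] at h
  exact h

variable [F.IsComm] [F.HasInverse]

noncomputable instance : Neg (F.SmallPoint τ) where
  neg a := ⟨evalAt (fun _ => a.1) (HasInverse.exists_inverse (F := F)).choose,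
    MvPowerSeries.IsSmall.evalAt (fun _ => a.2) (MvPowerSeries.isSmall_of_constantCoeff_eq_zero
      (HasInverse.exists_inverse (F := F)).choose_spec.1)⟩

noncomputable instance : AddCommGroup (F.SmallPoint τ) where
  add_assoc a b c := SmallPoint.ext (evalAt_cons_assoc a.2 b.2 c.2)
  zero_add a := SmallPoint.ext (evalAt_zero_cons a.2)
  add_zero a := SmallPoint.ext (evalAt_cons_zero a.2)
  nsmul := nsmulRec
  zsmul := zsmulRec
  add_comm a b := SmallPoint.ext (evalAt_cons_comm a.2 b.2)
  neg_add_cancel a := SmallPoint.ext <| by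
    have h := HasInverse.exists_inverse (F := F)
    exact (evalAt_cons_comm (IsSmall.evalAt (fun _ => a.2)
      (MvPowerSeries.isSmall_of_constantCoeff_eq_zero h.choose_spec.1)) a.2).trans
        (evalAt_cons_inverse h.choose_spec.1 h.choose_spec.2 a.2)

/-- Negation is defined by a chosen inverse series. Uniqueness of inverses in a group allows any
other one, in particular one with controlled coefficients. -/
theorem coe_neg {ι : A⟦X⟧} (hι0 : MvPowerSeries.constantCoeff ι = 0)
    (hι : MvPowerSeries.subst ![PowerSeries.X, ι] F.toPowerSeries = 0) (a : F.SmallPoint τ) :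
    (-a).1 = evalAt (fun _ => a.1) ι := by
  have : a + ⟨evalAt (fun _ => a.1) ι, IsSmall.evalAt (fun _ => a.2)
      (MvPowerSeries.isSmall_of_constantCoeff_eq_zero hι0)⟩ = 0 :=
    SmallPoint.ext (evalAt_cons_inverse hι0 hι a.2)
  rw [← eq_neg_of_add_eq_zero_right this]

/-- Evaluation of points at a family of power series. -/
noncomputable def evalHom (F : FormalGroup A) [F.IsComm] [F.HasInverse] [Finite τ]
    {g : τ → MvPowerSeries υ A} (hg : ∀ i, IsSmall (g i)) :
    F.SmallPoint τ →+ F.SmallPoint υ where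
  toFun a := ⟨evalAt g a.1, IsSmall.evalAt hg a.2⟩
  map_zero' := SmallPoint.ext (MvPowerSeries.evalAt_zero hg)
  map_add' a b := SmallPoint.ext (evalAt_cons_evalAt a.2 b.2 hg _)

theorem coe_evalHom [Finite τ] {g : τ → MvPowerSeries υ A} (hg : ∀ i, IsSmall (g i))
    (a : F.SmallPoint τ) : (evalHom F hg a).1 = evalAt g a.1 := rfl

/-- The endomorphism of the points which a power series `φ` with `φ (F (X, Y)) = F (φ X, φ Y)`
defines. -/
noncomputable def endoHom (F : FormalGroup A) [F.IsComm] [F.HasInverse] {φ : A⟦X⟧}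
    (h0 : MvPowerSeries.constantCoeff φ = 0)
    (hφ : PowerSeries.subst F.toPowerSeries φ = MvPowerSeries.subst (fun i : Fin 2 =>
      PowerSeries.subst (MvPowerSeries.X i : MvPowerSeries (Fin 2) A) φ) F.toPowerSeries) :
    F.SmallPoint τ →+ F.SmallPoint τ where
  toFun a := ⟨evalAt (fun _ => a.1) φ,
    IsSmall.evalAt (fun _ => a.2) (MvPowerSeries.isSmall_of_constantCoeff_eq_zero h0)⟩
  map_zero' := SmallPoint.ext <| by
    -- Divisibility by `a = 0` is vanishing.
    have h := MvPowerSeries.C_dvd_evalAt (A := A) (a := 0) (g := fun _ : Unit => (0 : MvPowerSeries τ A))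
      (fun _ => MvPowerSeries.isSmall_of_constantCoeff_eq_zero (map_zero _))
      (MvPowerSeries.isClosed_C_dvd (by simp)) (by simp) h0
    simp only [map_zero, zero_dvd_iff] at h
    exact h
  map_add' a b := SmallPoint.ext <| by
    have hab := isSmall_cons a.2 b.2
    have h := congrArg (evalAt ![a.1, b.1]) hφ
    rw [PowerSeries.subst, evalAt_subst (fun _ => F.zero_constantCoeff) hab, evalAt_subst
      (fun i => PowerSeries.constantCoeff_subst_eq_zero (MvPowerSeries.constantCoeff_X i) _ h0)
      hab] at h
    refine h.trans ?_
    refine congrArg (fun g => evalAt g F.toPowerSeries) ?_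
    funext i
    rw [PowerSeries.subst, evalAt_subst (fun _ => MvPowerSeries.constantCoeff_X i) hab]
    simp only [MvPowerSeries.evalAt_X]
    fin_cases i <;> rfl

end SmallPoint

end FormalGroup

/-! ### Symmetric functions of the roots of `T ^ q + a T - y`. -/

section Trinomial

variable {M ι : Type*} [CommRing M] [IsDomain M] [Fintype ι] {x : ι → M} {q : ℕ} {a y : M}

/-- A trinomial `T ^ q + a T - y` with `q` distinct roots splits. -/
theorem prod_X_sub_C_eq_trinomial (hq : 2 ≤ q) (hcard : Fintype.card ι = q)
    (hinj : Function.Injective x) (hx : ∀ i, x i ^ q + a * x i = y) :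
    (((Finset.univ : Finset ι).val.map x).map fun r => (Polynomial.X - Polynomial.C r)).prod =
      Polynomial.X ^ q + (Polynomial.C a * Polynomial.X - Polynomial.C y) := by
  classical
  set P : Polynomial M := Polynomial.X ^ q + (Polynomial.C a * Polynomial.X - Polynomial.C y)
  have hdeg : (Polynomial.C a * Polynomial.X - Polynomial.C y).degree < (q : WithBot ℕ) := by
    refine lt_of_le_of_lt (Polynomial.degree_sub_le _ _) (max_lt ?_ ?_)
    · exact lt_of_le_of_lt (Polynomial.degree_C_mul_X_le a) (by exact_mod_cast hq)
    · exact lt_of_le_of_lt Polynomial.degree_C_le (by exact_mod_cast (by omega))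
  have hmonic : P.Monic := Polynomial.monic_X_pow_add hdeg
  have hnat : P.natDegree = q := by
    refine Polynomial.natDegree_eq_of_degree_eq_some ?_
    rw [Polynomial.degree_add_eq_left_of_degree_lt (by rwa [Polynomial.degree_X_pow]),
      Polynomial.degree_X_pow]
  have hle : (Finset.univ : Finset ι).val.map x ≤ P.roots := by
    rw [Multiset.le_iff_subset ((Multiset.nodup_map_iff_of_injective hinj).mpr Finset.univ.nodup)]
    intro r hr
    obtain ⟨i, -, rfl⟩ := Multiset.mem_map.mp hr
    rw [Polynomial.mem_roots hmonic.ne_zero, Polynomial.IsRoot.def]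
    simp only [P, Polynomial.eval_add, Polynomial.eval_sub, Polynomial.eval_mul,
      Polynomial.eval_pow, Polynomial.eval_X, Polynomial.eval_C]
    rw [← hx i]
    ring
  have hroots : (Finset.univ : Finset ι).val.map x = P.roots := by
    refine Multiset.eq_of_le_of_card_le hle ?_
    rw [Multiset.card_map, Finset.card_val, Finset.card_univ, hcard, ← hnat]
    exact Polynomial.card_roots' P
  rw [hroots]
  refine Polynomial.prod_multiset_X_sub_C_of_monic_of_roots_card_eq hmonic ?_
  rw [← hroots, Multiset.card_map, Finset.card_val, Finset.card_univ, hcard, hnat]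

theorem aeval_esymm_trinomial {R : Type*} [CommRing R] [Algebra R M] (hq : 2 ≤ q)
    (hcard : Fintype.card ι = q)
    (hinj : Function.Injective x) (hx : ∀ i, x i ^ q + a * x i = y) {k : ℕ} (hk : k ≤ q) :
    MvPolynomial.aeval x (MvPolynomial.esymm ι R k) = (-1) ^ k *
      (Polynomial.X ^ q + (Polynomial.C a * Polynomial.X - Polynomial.C y)).coeff (q - k) := by
  have hc : Multiset.card ((Finset.univ : Finset ι).val.map x) = q := by
    rw [Multiset.card_map, Finset.card_val, Finset.card_univ, hcard]
  have h := Multiset.prod_X_sub_C_coeff ((Finset.univ : Finset ι).val.map x) (k := q - k)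
    (by rw [hc]; omega)
  rw [prod_X_sub_C_eq_trinomial hq hcard hinj hx, hc, Nat.sub_sub_self hk] at h
  rw [MvPolynomial.aeval_esymm_eq_multiset_esymm, h, ← mul_assoc, ← pow_add, ← two_mul,
    pow_mul, neg_one_sq, one_pow, one_mul]

theorem aeval_esymm_trinomial_eq_zero {R : Type*} [CommRing R] [Algebra R M] (hq : 2 ≤ q)
    (hcard : Fintype.card ι = q) (hinj : Function.Injective x)
    (hx : ∀ i, x i ^ q + a * x i = y) {k : ℕ} (h0 : 0 < k) (hk : k < q - 1) :
    MvPolynomial.aeval x (MvPolynomial.esymm ι R k) = 0 := by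
  rw [aeval_esymm_trinomial hq hcard hinj hx (by omega)]
  simp only [Polynomial.coeff_add, Polynomial.coeff_sub, Polynomial.coeff_X_pow,
    Polynomial.coeff_C_mul, Polynomial.coeff_X, Polynomial.coeff_C]
  rw [if_neg (by omega), if_neg (by omega), if_neg (by omega)]
  ring

theorem aeval_esymm_trinomial_pred {R : Type*} [CommRing R] [Algebra R M] (hq : 2 ≤ q)
    (hcard : Fintype.card ι = q) (hinj : Function.Injective x)
    (hx : ∀ i, x i ^ q + a * x i = y) :
    MvPolynomial.aeval x (MvPolynomial.esymm ι R (q - 1)) = (-1) ^ (q - 1) * a := by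
  rw [aeval_esymm_trinomial hq hcard hinj hx (by omega)]
  simp only [Polynomial.coeff_add, Polynomial.coeff_sub, Polynomial.coeff_X_pow,
    Polynomial.coeff_C_mul, Polynomial.coeff_X, Polynomial.coeff_C]
  rw [if_neg (by omega), if_pos (by omega), if_neg (by omega)]
  ring

theorem aeval_esymm_trinomial_self {R : Type*} [CommRing R] [Algebra R M] (hq : 2 ≤ q)
    (hcard : Fintype.card ι = q) (hinj : Function.Injective x)
    (hx : ∀ i, x i ^ q + a * x i = y) :
    MvPolynomial.aeval x (MvPolynomial.esymm ι R q) = (-1) ^ q * -y := by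
  rw [aeval_esymm_trinomial hq hcard hinj hx le_rfl]
  simp only [Polynomial.coeff_add, Polynomial.coeff_sub, Polynomial.coeff_X_pow,
    Polynomial.coeff_C_mul, Polynomial.coeff_X, Polynomial.coeff_C]
  rw [if_neg (by omega), if_neg (by omega), if_pos (by omega)]
  ring

/-- In Newton's identity every mixed term contains an elementary symmetric function of index
strictly between `0` and `k ≤ q - 1`, and these vanish for a trinomial. -/
theorem sum_pow_trinomial (hq : 2 ≤ q) (hcard : Fintype.card ι = q) (hinj : Function.Injective x)
    (hx : ∀ i, x i ^ q + a * x i = y) {k : ℕ} (h0 : 0 < k) (hk : k < q) :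
    ∑ i, x i ^ k = (-1) ^ (k + 1) * k * MvPolynomial.aeval x (MvPolynomial.esymm ι M k) := by
  have h := congrArg (MvPolynomial.aeval x) (MvPolynomial.psum_eq_mul_esymm_sub_sum ι M k h0)
  rw [map_sub, map_sum, Finset.sum_eq_zero, sub_zero] at h
  · simpa [MvPolynomial.psum] using h
  · intro b hb
    rw [Finset.mem_filter, Finset.HasAntidiagonal.mem_antidiagonal] at hb
    obtain ⟨h1, h2, h3⟩ := hb
    rw [map_mul, map_mul, aeval_esymm_trinomial_eq_zero hq hcard hinj hx h2 (by omega)]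
    ring

theorem sum_pow_pred_trinomial (hq : 2 ≤ q) (hcard : Fintype.card ι = q)
    (hinj : Function.Injective x) (hx : ∀ i, x i ^ q + a * x i = y) :
    ∑ i, x i ^ (q - 1) = (1 - q) * a := by
  rw [sum_pow_trinomial hq hcard hinj hx (by omega) (by omega),
    aeval_esymm_trinomial_pred hq hcard hinj hx, Nat.sub_add_cancel (by omega),
    Nat.cast_sub (by omega)]
  obtain ⟨n, rfl⟩ := Nat.exists_eq_add_of_le' (show 1 ≤ q by omega)
  rw [Nat.add_sub_cancel, pow_succ]
  have : ((-1 : M) ^ n) * (-1) ^ n = 1 := by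
    rw [← pow_add, ← two_mul, pow_mul, neg_one_sq, one_pow]
  push_cast
  linear_combination (-(n : M) * a) * this

/-- Exponent `0` gives `q`, exponents up to `q - 1` give `0` or `(1 - q) a`, and beyond that the
equation yields the recursion `x ^ (n + q) = y x ^ n - a x ^ (n + 1)`. -/
theorem dvd_sum_pow_trinomial (hq : 2 ≤ q) (hcard : Fintype.card ι = q)
    (hinj : Function.Injective x) (hx : ∀ i, x i ^ q + a * x i = y) (hdvd : a ∣ q) (k : ℕ) :
    a ∣ ∑ i, x i ^ k := by
  induction k using Nat.strong_induction_on with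
  | _ k ih =>
    rcases Nat.eq_zero_or_pos k with rfl | h0
    · simpa [hcard] using hdvd
    rcases Nat.lt_or_ge k q with hk | hk
    · rcases Nat.lt_or_ge k (q - 1) with hk' | hk'
      · rw [sum_pow_trinomial hq hcard hinj hx h0 hk,
          aeval_esymm_trinomial_eq_zero hq hcard hinj hx h0 hk', mul_zero]
        exact dvd_zero _
      · obtain rfl : k = q - 1 := by omega
        rw [sum_pow_pred_trinomial hq hcard hinj hx]
        exact dvd_mul_left _ _
    · obtain ⟨n, rfl⟩ := Nat.exists_eq_add_of_le' hk
      have : ∑ i, x i ^ (n + q) = y * ∑ i, x i ^ n - a * ∑ i, x i ^ (n + 1) := by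
        rw [Finset.mul_sum, Finset.mul_sum, ← Finset.sum_sub_distrib]
        refine Finset.sum_congr rfl fun i _ => ?_
        rw [← hx i]
        ring
      rw [this]
      exact dvd_sub (Dvd.dvd.mul_left (ih n (by omega)) _) (dvd_mul_right _ _)

end Trinomial

/-! ### Symmetric power series. -/

namespace MvPowerSeries

open scoped WithPiTopology
open Filter Topology

section Symmetric

variable {A : Type*} [CommRing A] [UniformSpace A]
  [IsUniformAddGroup A] [IsTopologicalRing A] [CompleteSpace A] [T2Space A] [IsLinearTopology A A]
  {ι τ : Type*} [Fintype ι]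

omit [IsUniformAddGroup A] [IsTopologicalRing A] [CompleteSpace A] [T2Space A]
  [IsLinearTopology A A] in
theorem tendsto_truncTotal (φ : MvPowerSeries ι A) :
    Tendsto (fun n => (truncTotal n φ : MvPowerSeries ι A)) atTop (𝓝 φ) := by
  rw [WithPiTopology.tendsto_iff_coeff_tendsto]
  intro d
  refine tendsto_atTop_of_eventually_const (i₀ := d.degree + 1) fun n hn => ?_
  rw [MvPolynomial.coeff_coe, coeff_truncTotal _ (by omega)]

/-- The value of a symmetric power series at a point lies in every closed subring which contains
its coefficients and the elementary symmetric functions of the point. -/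
theorem evalAt_mem_of_symmetric {x : ι → MvPowerSeries τ A} (hx : ∀ i, IsSmall (x i))
    {O : Subring A} {S : Subring (MvPowerSeries τ A)} (hS : IsClosed (S : Set (MvPowerSeries τ A)))
    (hOS : ∀ a ∈ O, C a ∈ S)
    (hesymm : ∀ k, k < Fintype.card ι → MvPolynomial.aeval x (MvPolynomial.esymm ι A (k + 1)) ∈ S)
    {φ : MvPowerSeries ι A} (hφ : φ ∈ coeffSubring ι O)
    (hsymm : ∀ e : Equiv.Perm ι, evalAt (fun i => X (e i)) φ = φ) : evalAt x φ ∈ S := by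
  classical
  -- Truncation by total degree preserves symmetry and converges to `φ`, so polynomials suffice.
  refine hS.mem_of_tendsto (((continuous_evalAt hx).tendsto φ).comp (tendsto_truncTotal φ))
    (Eventually.of_forall fun n => ?_)
  rw [Function.comp_apply, evalAt_coe]
  have hsub : (truncTotal n φ).IsSymmetric := by
    intro e
    have h1 : rename e φ = φ := by
      conv_rhs => rw [← hsymm e, ← subst_eq_evalAt (hasSubst_of_constantCoeff_zero
        fun i => constantCoeff_X (e i))]
      exact rename_eq_subst (f := e) (p := φ)
    ext d
    have h2 : d = (d.mapDomain e.symm).mapDomain e := by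
      rw [← Finsupp.mapDomain_comp, Equiv.self_comp_symm, Finsupp.mapDomain_id]
    have h3 : (d.mapDomain e.symm).degree = d.degree := Finsupp.degree_mapDomain _ _
    rw [h2, MvPolynomial.coeff_rename_mapDomain _ e.injective, ← h2, coeff_truncTotal_eq_ite,
      coeff_truncTotal_eq_ite, h3]
    congr 1
    conv_rhs => rw [h2, ← h1]
    have h4 := coeff_embDomain_rename (R := A) e.toEmbedding φ (d.mapDomain e.symm)
    rw [Finsupp.embDomain_eq_mapDomain] at h4
    exact h4.symm
  obtain ⟨P, hP⟩ : ∃ P, MvPolynomial.map O.subtype P = truncTotal n φ := by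
    have : truncTotal n φ ∈ Set.range (MvPolynomial.map (σ := ι) O.subtype) := by
      rw [MvPolynomial.mem_range_map_iff_coeffs_subset]
      intro c hc
      obtain ⟨d, rfl⟩ := MvPolynomial.mem_coeffs_iff.mp hc |>.imp fun d hd => hd.2.symm
      rw [coeff_truncTotal_eq_ite]
      split_ifs
      · exact ⟨⟨_, hφ d⟩, rfl⟩
      · exact ⟨0, rfl⟩
    exact this
  have hPsymm : P.IsSymmetric := by
    intro e
    apply MvPolynomial.map_injective O.subtype Subtype.val_injective
    rw [MvPolynomial.map_rename, hP]
    exact hsub e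
  -- The fundamental theorem is applied over `O`, not over `A`, so that the polynomial in the
  -- elementary symmetric functions keeps coefficients in `O`.
  obtain ⟨Q, hQ⟩ := (MvPolynomial.esymmAlgEquiv (n := Fintype.card ι) ι (R := O) rfl).surjective
    ⟨P, hPsymm⟩
  have hQ' : P = MvPolynomial.aeval
      (fun i : Fin (Fintype.card ι) => MvPolynomial.esymm ι O (i + 1)) Q := by
    rw [← MvPolynomial.esymmAlgHom_apply]
    exact (congrArg Subtype.val hQ).symm
  rw [← hP, hQ']
  clear hQ hQ'
  induction Q using MvPolynomial.induction_on with
  | C a =>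
    rw [MvPolynomial.aeval_C, MvPolynomial.algebraMap_eq, MvPolynomial.map_C, MvPolynomial.aeval_C]
    exact hOS _ a.2
  | add Q₁ Q₂ h₁ h₂ =>
    rw [map_add, map_add, map_add]
    exact S.add_mem h₁ h₂
  | mul_X Q i h =>
    rw [map_mul, map_mul, map_mul, MvPolynomial.aeval_X, MvPolynomial.map_esymm]
    exact S.mul_mem h (hesymm i i.2)

end Symmetric

end MvPowerSeries

/-! ### The trace over the torsion field, axiomatically. -/

namespace ColemanTrace

open FormalGroup FormalGroup.SmallPoint
open MvPowerSeries (evalAt IsSmall coeffSubring mem_coeffSubring lubinTateVar lubinTateDefect)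
open scoped MvPowerSeries.WithPiTopology
open Filter Topology

/-- The situation over the ring of integers `A` of the torsion field: `O` is the ring of integers
of `K` with its uniformizer `π` and residue field of `q` elements, `T` the set of all roots of
`π x + x ^ q`, and `φ` the endomorphism `[α]` of `FL`, divisible by `[ϖ] = ϖ x + x ^ qL`. -/
structure TraceSetting (A : Type*) [CommRing A] [UniformSpace A] where
  (O : Subring A)
  isCompact_O : IsCompact (O : Set A)
  (π : A)
  π_mem : π ∈ O
  π_ne_zero : π ≠ 0
  isTopologicallyNilpotent_π : IsTopologicallyNilpotent π
  isClosed_span : ∀ n, IsClosed (Ideal.span {π ^ n} : Set A)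
  mem_of_mul_mem : ∀ a, π * a ∈ O → a ∈ O
  (q : ℕ)
  two_le_q : 2 ≤ q
  π_dvd_q : π ∣ q
  (u : A)
  u_mem : u ∈ O
  u_mul : u * (1 - q) = 1
  (T : Finset A)
  card_T : T.card = q
  root_T : ∀ z ∈ T, π * z + z ^ q = 0
  (FK : FormalGroup A)
  defect_FK : lubinTateDefect π q FK.toPowerSeries = 0
  (FL : FormalGroup A)
  isComm : FL.IsComm
  FL_mem : FL.toPowerSeries ∈ coeffSubring (Fin 2) O
  order_FL : ((3 : ℕ) : ℕ∞) ≤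
    (FL.toPowerSeries - (MvPowerSeries.X 0 + MvPowerSeries.X 1)).order
  (inv : A⟦X⟧)
  inv_mem : inv ∈ coeffSubring Unit O
  inv_zero : MvPowerSeries.constantCoeff inv = 0
  subst_inv : MvPowerSeries.subst ![PowerSeries.X, inv] FL.toPowerSeries = 0
  (φ : A⟦X⟧)
  φ_mem : φ ∈ coeffSubring Unit O
  φ_zero : MvPowerSeries.constantCoeff φ = 0
  subst_φ : PowerSeries.subst FL.toPowerSeries φ = MvPowerSeries.subst (fun i : Fin 2 =>
      PowerSeries.subst (MvPowerSeries.X i : MvPowerSeries (Fin 2) A) φ) FL.toPowerSeries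
  (ψ : A⟦X⟧)
  ψ_zero : MvPowerSeries.constantCoeff ψ = 0
  (qL : ℕ)
  three_le_qL : 3 ≤ qL
  (ϖ : A)
  π_sq_dvd : π ^ 2 ∣ ϖ
  φ_eq : φ = MvPowerSeries.subst (fun _ : Unit => lubinTateVar ϖ qL ()) ψ

namespace TraceSetting

variable {A : Type*} [CommRing A] [UniformSpace A] (S : TraceSetting A)

omit [UniformSpace A] in
theorem isTopologicallyNilpotent_of_pow [TopologicalSpace A] [IsLinearTopology A A] {z : A}
    {n : ℕ} (h : IsTopologicallyNilpotent (z ^ n)) : IsTopologicallyNilpotent z := by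
  rw [IsTopologicallyNilpotent, IsLinearTopology.hasBasis_ideal.tendsto_right_iff]
    at h ⊢
  intro I hI
  obtain ⟨N, hN⟩ := eventually_atTop.mp (h I hI)
  refine eventually_atTop.mpr ⟨n * N, fun m hm => ?_⟩
  have h1 := hN N le_rfl
  rw [← pow_mul] at h1
  rw [← Nat.sub_add_cancel hm, pow_add]
  exact I.mul_mem_left _ h1

instance : S.FL.IsComm := S.isComm

instance : S.FL.HasInverse := ⟨S.inv, S.inv_zero, S.subst_inv⟩

/-- The points of the formal group law `FL` in the power series in `τ` variables. -/
abbrev Pt (τ : Type*) := S.FL.SmallPoint τ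

/-- The series `π X + X ^ q`. -/
noncomputable abbrev y : MvPowerSeries Unit A := lubinTateVar S.π S.q ()

theorem constantCoeff_y : MvPowerSeries.constantCoeff S.y = 0 :=
  MvPowerSeries.constantCoeff_lubinTateVar (by have := S.two_le_q; omega) _

theorem isSmall_y (_ : Unit) : IsSmall S.y :=
  MvPowerSeries.isSmall_of_constantCoeff_eq_zero S.constantCoeff_y

variable [IsUniformAddGroup A] [IsTopologicalRing A] [CompleteSpace A] [T2Space A]
  [IsLinearTopology A A] {τ υ : Type*}

/-! ### The filtration by powers of `π`. -/

section Level

omit [IsUniformAddGroup A] [IsTopologicalRing A] [CompleteSpace A] [IsLinearTopology A A] in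
theorem isClosed_O : IsClosed (S.O : Set A) := S.isCompact_O.isClosed

omit [IsUniformAddGroup A] [IsTopologicalRing A] [CompleteSpace A] [T2Space A]
  [IsLinearTopology A A] in
theorem isClosed_dvd (n : ℕ) :
    IsClosed {f : MvPowerSeries τ A | MvPowerSeries.C (S.π ^ n) ∣ f} :=
  MvPowerSeries.isClosed_C_dvd (S.isClosed_span n)

omit [IsUniformAddGroup A] [IsTopologicalRing A] [CompleteSpace A] [T2Space A]
  [IsLinearTopology A A] in
theorem dvd_of_le {m n : ℕ} (h : m ≤ n) {f : MvPowerSeries τ A}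
    (hf : MvPowerSeries.C (S.π ^ n) ∣ f) : MvPowerSeries.C (S.π ^ m) ∣ f :=
  (map_dvd MvPowerSeries.C (pow_dvd_pow S.π h)).trans hf

theorem evalAt_congr {σ : Type*} [Finite σ] {n : ℕ} {g g' : σ → MvPowerSeries τ A}
    (hg : ∀ i, IsSmall (g i))
    (hg' : ∀ i, IsSmall (g' i)) (h : ∀ i, MvPowerSeries.C (S.π ^ n) ∣ g i - g' i)
    (f : MvPowerSeries σ A) : MvPowerSeries.C (S.π ^ n) ∣ evalAt g f - evalAt g' f := by
  have hI : ∀ f : MvPowerSeries τ A, f ∈ Ideal.span {MvPowerSeries.C (S.π ^ n)} ↔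
      MvPowerSeries.C (S.π ^ n) ∣ f := fun f => Ideal.mem_span_singleton
  rw [← hI]
  refine MvPowerSeries.evalAt_sub_evalAt_mem hg hg' ?_ (fun i => (hI _).mpr (h i)) f
  convert S.isClosed_dvd (τ := τ) n using 1
  ext f
  exact hI f

/-- The points which are divisible by `π ^ n`. -/
def level (τ : Type*) (n : ℕ) : AddSubgroup (S.Pt τ) where
  carrier := {a | MvPowerSeries.C (S.π ^ n) ∣ a.1}
  zero_mem' := by
    change _ ∣ (0 : S.Pt τ).1
    rw [SmallPoint.coe_zero]
    exact dvd_zero _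
  add_mem' {a b} ha hb := MvPowerSeries.C_dvd_evalAt (isSmall_cons a.2 b.2) (S.isClosed_dvd n)
    (fun i => by fin_cases i; exacts [ha, hb]) S.FL.zero_constantCoeff
  neg_mem' {a} ha := by
    change _ ∣ (-a).1
    rw [coe_neg S.inv_zero S.subst_inv]
    exact MvPowerSeries.C_dvd_evalAt (fun _ => a.2) (S.isClosed_dvd n) (fun _ => ha) S.inv_zero

theorem mem_level {n : ℕ} {a : S.Pt τ} :
    a ∈ S.level τ n ↔ MvPowerSeries.C (S.π ^ n) ∣ a.1 := Iff.rfl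

theorem level_anti {m n : ℕ} (h : m ≤ n) : S.level τ n ≤ S.level τ m :=
  fun _ ha => S.dvd_of_le h ha

/-- Translation by a point preserves congruences modulo `π ^ n`, so `F_L`-differences and ordinary
differences define the same congruence. -/
theorem sub_mem_level {n : ℕ} {a b : S.Pt τ} :
    a - b ∈ S.level τ n ↔ MvPowerSeries.C (S.π ^ n) ∣ a.1 - b.1 := by
  constructor
  · intro h
    have h1 := S.evalAt_congr (n := n) (isSmall_cons (a - b).2 b.2)
      (isSmall_cons (0 : S.Pt τ).2 b.2) (fun i => by
        fin_cases i
        · change _ ∣ (a - b).1 - (0 : S.Pt τ).1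
          rw [SmallPoint.coe_zero, sub_zero]
          exact h
        · simp) S.FL.toPowerSeries
    have h2 : (a - b + b).1 - (0 + b).1 = a.1 - b.1 := by rw [sub_add_cancel, _root_.zero_add]
    rw [← h2]
    exact h1
  · intro h
    have h1 := S.evalAt_congr (n := n) (isSmall_cons a.2 (-b).2) (isSmall_cons b.2 (-b).2)
      (fun i => by
        fin_cases i
        · exact h
        · simp) S.FL.toPowerSeries
    have h2 : (a + -b).1 - (b + -b).1 = (a - b).1 := by
      rw [add_neg_cancel, SmallPoint.coe_zero, sub_zero, sub_eq_add_neg]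
    rw [mem_level, ← h2]
    exact h1

/-- The points with coefficients in `O`. -/
def integral (τ : Type*) : AddSubgroup (S.Pt τ) where
  carrier := {a | a.1 ∈ coeffSubring τ S.O}
  zero_mem' := (coeffSubring τ S.O).zero_mem
  add_mem' {a b} ha hb := MvPowerSeries.evalAt_mem_coeffSubring (isSmall_cons a.2 b.2)
    S.isClosed_O (fun i => by fin_cases i; exacts [ha, hb]) S.FL_mem
  neg_mem' {a} ha := by
    change (-a).1 ∈ coeffSubring τ S.O
    rw [coe_neg S.inv_zero S.subst_inv]
    exact MvPowerSeries.evalAt_mem_coeffSubring (fun _ => a.2) S.isClosed_O (fun _ => ha) S.inv_mem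

/-- `F_L - X - Y` starts in degree three, hence the error term is cubic in multiples of `π ^ n`. -/
theorem dvd_coe_add_sub {n : ℕ} {a b : S.Pt τ} (ha : a ∈ S.level τ n) (hb : b ∈ S.level τ n) :
    MvPowerSeries.C (S.π ^ (n * 3)) ∣ (a + b).1 - (a.1 + b.1) := by
  have hs := isSmall_cons a.2 b.2
  have h := MvPowerSeries.C_pow_dvd_evalAt hs (S.isClosed_dvd (n * 3))
    (fun i => by fin_cases i; exacts [ha, hb]) S.order_FL
  rw [MvPowerSeries.evalAt_sub hs, MvPowerSeries.evalAt_add hs, MvPowerSeries.evalAt_X,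
    MvPowerSeries.evalAt_X] at h
  exact h

theorem dvd_coe_sum_sub {ι : Type*} {n : ℕ} (s : Finset ι) {a : ι → S.Pt τ}
    (ha : ∀ i, a i ∈ S.level τ n) :
    MvPowerSeries.C (S.π ^ (n * 3)) ∣ (∑ i ∈ s, a i).1 - ∑ i ∈ s, (a i).1 := by
  classical
  induction s using Finset.induction_on with
  | empty =>
    rw [Finset.sum_empty, Finset.sum_empty, SmallPoint.coe_zero, sub_zero]
    exact dvd_zero _
  | insert i s hi ih =>
    rw [Finset.sum_insert hi, Finset.sum_insert hi]
    have h1 := S.dvd_coe_add_sub (ha i) ((S.level τ n).sum_mem fun j (_ : j ∈ s) => ha j)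
    have h2 := dvd_add h1 ih
    convert h2 using 1
    ring

theorem evalHom_mem_level [Finite τ] {n : ℕ} {g : τ → MvPowerSeries υ A} (hg : ∀ i, IsSmall (g i))
    {a : S.Pt τ} (ha : a ∈ S.level τ n) : evalHom S.FL hg a ∈ S.level υ n := by
  obtain ⟨b, hb⟩ := ha
  rw [mem_level, coe_evalHom, hb, MvPowerSeries.evalAt_mul hg, MvPowerSeries.evalAt_C]
  exact dvd_mul_right _ _

theorem evalHom_mem_integral [Finite τ] {g : τ → MvPowerSeries υ A} (hg : ∀ i, IsSmall (g i))
    (hgO : ∀ i, g i ∈ coeffSubring υ S.O) {a : S.Pt τ} (ha : a ∈ S.integral τ) :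
    evalHom S.FL hg a ∈ S.integral υ :=
  MvPowerSeries.evalAt_mem_coeffSubring hg S.isClosed_O hgO ha

omit [IsUniformAddGroup A] [IsTopologicalRing A] [CompleteSpace A] [T2Space A] in
theorem isSmall_of_sub {f g : MvPowerSeries τ A} (hg : IsSmall g)
    (h : MvPowerSeries.C S.π ∣ f - g) : IsSmall f := by
  obtain ⟨k, hk⟩ := h
  have h1 : MvPowerSeries.constantCoeff f =
      MvPowerSeries.constantCoeff g + S.π * MvPowerSeries.constantCoeff k := by
    rw [← sub_add_cancel f g, hk, map_add, map_mul, MvPowerSeries.constantCoeff_C]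
    ring
  rw [IsSmall, h1]
  exact IsTopologicallyNilpotent.add hg (S.isTopologicallyNilpotent_π.mul_right _)

omit [IsUniformAddGroup A] [IsTopologicalRing A] [CompleteSpace A] in
theorem eq_zero_of_forall_pow_dvd {f : MvPowerSeries τ A}
    (h : ∀ n, MvPowerSeries.C (S.π ^ n) ∣ f) : f = 0 := by
  ext d
  choose c hc using fun n => MvPowerSeries.C_dvd_iff.mp (h n) d
  have h1 : Tendsto (fun n => S.π ^ n * c n) atTop (𝓝 0) :=
    IsLinearTopology.tendsto_mul_zero_of_left _ _ S.isTopologicallyNilpotent_π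
  simp only [← hc] at h1
  exact tendsto_nhds_unique tendsto_const_nhds h1

end Level

/-! ### The translates `X ⊕ z` as roots of a trinomial. -/

section Translates

/-- The translates `X ⊕ z` of the variable. -/
noncomputable def x (z : S.T) : MvPowerSeries Unit A :=
  evalAt ![PowerSeries.X, MvPowerSeries.C z.1] S.FK.toPowerSeries

omit [IsUniformAddGroup A] [IsTopologicalRing A] [CompleteSpace A] [T2Space A] in
theorem isTopologicallyNilpotent_of_mem_T {z : A} (hz : z ∈ S.T) : IsTopologicallyNilpotent z := by
  have h1 : z ^ S.q = S.π * -z := by linear_combination S.root_T z hz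
  have h2 : IsTopologicallyNilpotent (z ^ S.q) := by
    rw [h1]
    exact S.isTopologicallyNilpotent_π.mul_right _
  exact isTopologicallyNilpotent_of_pow h2

omit [IsUniformAddGroup A] [IsTopologicalRing A] [CompleteSpace A] [T2Space A] in
theorem isSmall_pair (z : S.T) (i : Fin 2) :
    IsSmall (![(PowerSeries.X : A⟦X⟧), MvPowerSeries.C z.1] i : MvPowerSeries Unit A) :=
  isSmall_cons (MvPowerSeries.isSmall_X ())
    (MvPowerSeries.isSmall_C (S.isTopologicallyNilpotent_of_mem_T z.2)) i

theorem isSmall_x (z : S.T) : IsSmall (S.x z) :=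
  IsSmall.evalAt (S.isSmall_pair z)
    (MvPowerSeries.isSmall_of_constantCoeff_eq_zero S.FK.zero_constantCoeff)

/-- Modulo the closed kernel of the constant coefficient, `X ⊕ z` is `0 ⊕ z = z`. This is what
separates the translates. -/
theorem constantCoeff_x (z : S.T) : MvPowerSeries.constantCoeff (S.x z) = z.1 := by
  have hclosed : IsClosed ((RingHom.ker (MvPowerSeries.constantCoeff (σ := Unit) (R := A)) :
      Ideal (MvPowerSeries Unit A)) : Set (MvPowerSeries Unit A)) :=
    isClosed_singleton.preimage (MvPowerSeries.WithPiTopology.continuous_constantCoeff A)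
  have hC := MvPowerSeries.isSmall_C (τ := Unit) (S.isTopologicallyNilpotent_of_mem_T z.2)
  have h := MvPowerSeries.evalAt_sub_evalAt_mem (S.isSmall_pair z)
    (isSmall_cons (MvPowerSeries.isSmall_of_constantCoeff_eq_zero (map_zero _)) hC)
    (g' := ![0, MvPowerSeries.C z.1]) hclosed (fun i => by
      rw [RingHom.mem_ker, map_sub]
      fin_cases i
      · change MvPowerSeries.constantCoeff (MvPowerSeries.X ()) - MvPowerSeries.constantCoeff 0 = 0
        rw [MvPowerSeries.constantCoeff_X, map_zero, sub_zero]
      · exact sub_self _) S.FK.toPowerSeries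
  rw [evalAt_zero_cons hC, RingHom.mem_ker, map_sub, MvPowerSeries.constantCoeff_C, sub_eq_zero] at h
  exact h

theorem x_injective : Function.Injective S.x := fun z z' h =>
  Subtype.ext (by rw [← S.constantCoeff_x z, ← S.constantCoeff_x z', h])

/-- The basic polynomial is an endomorphism of `FK` and kills `z`, so it sends `X ⊕ z` to `y ⊕ 0`.
-/
theorem root_x (z : S.T) : S.x z ^ S.q + MvPowerSeries.C S.π * S.x z = S.y := by
  have hq : S.q ≠ 0 := by have := S.two_le_q; omega
  have hs := S.isSmall_pair z
  have h := S.defect_FK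
  rw [lubinTateDefect, sub_eq_zero] at h
  have h1 := congrArg (evalAt ![(PowerSeries.X : A⟦X⟧), MvPowerSeries.C z.1]) h
  rw [MvPowerSeries.evalAt_add hs, MvPowerSeries.evalAt_mul hs, MvPowerSeries.evalAt_C,
    MvPowerSeries.evalAt_pow hs, evalAt_subst (MvPowerSeries.constantCoeff_lubinTateVar hq) hs] at h1
  have h2 : (fun i => evalAt ![(PowerSeries.X : A⟦X⟧), MvPowerSeries.C z.1]
      (lubinTateVar S.π S.q i)) = ![S.y, 0] := by
    funext i
    rw [lubinTateVar, MvPowerSeries.evalAt_add hs, MvPowerSeries.evalAt_mul hs,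
      MvPowerSeries.evalAt_C, MvPowerSeries.evalAt_pow hs, MvPowerSeries.evalAt_X]
    fin_cases i
    · rfl
    · change MvPowerSeries.C S.π * MvPowerSeries.C z.1 + MvPowerSeries.C z.1 ^ S.q = 0
      rw [← map_mul, ← map_pow, ← map_add, S.root_T z.1 z.2, map_zero]
  rw [h2, evalAt_cons_zero (S.isSmall_y ())] at h1
  rw [← h1, x]
  ring

theorem evalAt_x_y (z : S.T) : evalAt (fun _ => S.x z) S.y = S.y := by
  conv_rhs => rw [← S.root_x z]
  rw [y, lubinTateVar, MvPowerSeries.evalAt_add fun _ => S.isSmall_x z,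
    MvPowerSeries.evalAt_mul fun _ => S.isSmall_x z, MvPowerSeries.evalAt_C,
    MvPowerSeries.evalAt_pow fun _ => S.isSmall_x z, MvPowerSeries.evalAt_X]
  ring

omit [IsUniformAddGroup A] [IsTopologicalRing A] [CompleteSpace A] [T2Space A] [IsLinearTopology A A] in
theorem card_T_eq : Fintype.card S.T = S.q := by rw [Fintype.card_coe, S.card_T]

variable [IsDomain A]

/-- Summing monomial by monomial leaves power sums of the roots, each divisible by `π`. -/
theorem dvd_sum_evalAt (g : MvPowerSeries Unit A) :
    MvPowerSeries.C S.π ∣ ∑ z, evalAt (fun _ => S.x z) g := by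
  have hclosed := S.isClosed_dvd (τ := Unit) 1
  rw [pow_one] at hclosed
  have h := hasSum_sum (s := Finset.univ) fun (z : S.T) _ =>
    MvPowerSeries.hasSum_evalAt (fun _ => S.isSmall_x z) g
  refine hclosed.mem_of_tendsto h (Eventually.of_forall fun s => Finset.dvd_sum fun d _ => ?_)
  rw [← Finset.mul_sum]
  refine Dvd.dvd.mul_left ?_ _
  have h1 : ∀ z : S.T, (d.prod fun _ k => S.x z ^ k) = S.x z ^ d () := fun z => by
    rw [Finsupp.prod_fintype _ _ fun _ => pow_zero _]
    simp
  simp only [h1]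
  refine dvd_sum_pow_trinomial S.two_le_q S.card_T_eq S.x_injective S.root_x ?_ _
  have := map_dvd (MvPowerSeries.C (σ := Unit) (R := A)) S.π_dvd_q
  rwa [map_natCast] at this

end Translates

/-! ### Estimates for the trace and its factorization through `y`. -/

section Trace

/-- The sum of the translates of a point. -/
noncomputable def trace : S.Pt Unit →+ S.Pt Unit :=
  ∑ z : S.T, evalHom S.FL (fun _ => S.isSmall_x z)

/-- The endomorphism `s ↦ [α] (s (π X + X ^ q))`. -/
noncomputable def endo : S.Pt Unit →+ S.Pt Unit :=
  (endoHom S.FL S.φ_zero S.subst_φ).comp (evalHom S.FL S.isSmall_y)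

theorem trace_apply (a : S.Pt Unit) :
    S.trace a = ∑ z : S.T, evalHom S.FL (fun _ => S.isSmall_x z) a := by
  rw [trace, AddMonoidHom.finsetSum_apply]

theorem coe_endo (a : S.Pt Unit) :
    (S.endo a).1 = evalAt (fun _ => evalAt (fun _ => S.y) a.1) S.φ := rfl

theorem trace_mem_level {n : ℕ} {a : S.Pt Unit} (ha : a ∈ S.level Unit n) :
    S.trace a ∈ S.level Unit n := by
  rw [trace_apply]
  exact (S.level Unit n).sum_mem fun z _ => S.evalHom_mem_level _ ha

theorem endo_mem_level {n : ℕ} {a : S.Pt Unit} (ha : a ∈ S.level Unit n) :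
    S.endo a ∈ S.level Unit n :=
  MvPowerSeries.C_dvd_evalAt (fun _ => (evalHom S.FL S.isSmall_y a).2) (S.isClosed_dvd n)
    (fun _ => S.evalHom_mem_level S.isSmall_y ha) S.φ_zero

/-- For `w` divisible by `π ^ n`, `ϖ w` gains `π ^ 2`, and `w ^ qL` is divisible by `π ^ (n qL)`
with `n qL ≥ 3 n ≥ n + 2`; applying `ψ` loses nothing. -/
theorem endo_mem_level_add_two {n : ℕ} (hn : 1 ≤ n) {a : S.Pt Unit} (ha : a ∈ S.level Unit n) :
    S.endo a ∈ S.level Unit (n + 2) := by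
  have hqL := S.three_le_qL
  have hb := S.evalHom_mem_level S.isSmall_y ha
  set b := evalHom S.FL S.isSmall_y a with hbdef
  have hw0 : ∀ _ : Unit, MvPowerSeries.constantCoeff
      (lubinTateVar S.ϖ S.qL () : MvPowerSeries Unit A) = 0 := fun _ =>
    MvPowerSeries.constantCoeff_lubinTateVar (by omega) ()
  have h1 : (S.endo a).1 = evalAt (fun _ => evalAt (fun _ => b.1)
      (lubinTateVar S.ϖ S.qL () : MvPowerSeries Unit A)) S.ψ := by
    have : (S.endo a).1 = evalAt (fun _ => b.1) S.φ := rfl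
    rw [this, S.φ_eq, evalAt_subst hw0 fun _ => b.2]
  rw [mem_level, h1]
  refine MvPowerSeries.C_dvd_evalAt (fun _ => IsSmall.evalAt (fun _ => b.2)
    (MvPowerSeries.isSmall_of_constantCoeff_eq_zero (hw0 ()))) (S.isClosed_dvd _) (fun _ => ?_)
    S.ψ_zero
  rw [lubinTateVar, MvPowerSeries.evalAt_add fun _ => b.2, MvPowerSeries.evalAt_mul fun _ => b.2,
    MvPowerSeries.evalAt_C, MvPowerSeries.evalAt_pow fun _ => b.2, MvPowerSeries.evalAt_X]
  refine dvd_add ?_ ?_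
  · rw [add_comm n 2, pow_add, map_mul]
    exact mul_dvd_mul (map_dvd _ S.π_sq_dvd) hb
  · have h2 := pow_dvd_pow_of_dvd hb S.qL
    rw [← map_pow, ← pow_mul] at h2
    refine S.dvd_of_le ?_ h2
    nlinarith

theorem dvd_trace_sub {n : ℕ} {a : S.Pt Unit} (ha : a ∈ S.level Unit n) :
    MvPowerSeries.C (S.π ^ (n * 3)) ∣ (S.trace a).1 - ∑ z, evalAt (fun _ => S.x z) a.1 := by
  rw [trace_apply]
  exact S.dvd_coe_sum_sub Finset.univ fun z => S.evalHom_mem_level (fun _ => S.isSmall_x z) ha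

variable [IsDomain A]

/-- For `a = π g` the ordinary trace is `π` times a sum divisible by `π`, and the `F_L`-trace
differs from it only modulo `π ^ 3`. -/
theorem trace_mem_level_two {a : S.Pt Unit} (ha : a ∈ S.level Unit 1) :
    S.trace a ∈ S.level Unit 2 := by
  have h1 := S.dvd_of_le (by omega : 2 ≤ 1 * 3) (S.dvd_trace_sub ha)
  obtain ⟨g, hg⟩ := ha
  have h2 : MvPowerSeries.C (S.π ^ 2) ∣ ∑ z, evalAt (fun _ => S.x z) a.1 := by
    have : ∀ z : S.T, evalAt (fun _ => S.x z) a.1 =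
        MvPowerSeries.C S.π * evalAt (fun _ => S.x z) g := fun z => by
      rw [hg, MvPowerSeries.evalAt_mul fun _ => S.isSmall_x z, MvPowerSeries.evalAt_C, pow_one]
    simp only [this]
    rw [← Finset.mul_sum, pow_two, map_mul]
    exact mul_dvd_mul_left _ (S.dvd_sum_evalAt g)
  rw [mem_level]
  have := dvd_add h1 h2
  rwa [sub_add_cancel] at this

omit [IsDomain A] in
theorem constantCoeff_evalAt_y (f : MvPowerSeries Unit A) :
    MvPowerSeries.constantCoeff (evalAt (fun _ => S.y) f) = MvPowerSeries.constantCoeff f := by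
  have hs := MvPowerSeries.hasSubst_of_constantCoeff_zero (σ := Unit) fun _ => S.constantCoeff_y
  have h := MvPowerSeries.constantCoeff_subst_eq_zero hs (fun _ => S.constantCoeff_y)
    (f := f - MvPowerSeries.C (MvPowerSeries.constantCoeff f)) (by simp)
  rw [MvPowerSeries.subst_eq_evalAt hs, MvPowerSeries.evalAt_sub S.isSmall_y,
    MvPowerSeries.evalAt_C, map_sub, MvPowerSeries.constantCoeff_C, sub_eq_zero] at h
  exact h

/-- The power series in `π X + X ^ q` with coefficients in `O`. -/
noncomputable def yRange : Subring (MvPowerSeries Unit A) :=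
  (coeffSubring Unit S.O).map
    (MvPowerSeries.aeval (R := A) (MvPowerSeries.hasEval_of_isSmall S.isSmall_y)).toRingHom

omit [IsDomain A] in
theorem mem_yRange {f : MvPowerSeries Unit A} :
    f ∈ S.yRange ↔ ∃ D ∈ coeffSubring Unit S.O, evalAt (fun _ => S.y) D = f := by
  rw [MvPowerSeries.evalAt_eq_aeval S.isSmall_y]
  exact Subring.mem_map

omit [IsDomain A] in
-- It is the continuous image of a compact set; closedness lets limits of polynomials in `y` remain
-- series in `y`.
theorem isClosed_yRange : IsClosed (S.yRange : Set (MvPowerSeries Unit A)) := by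
  have : (S.yRange : Set (MvPowerSeries Unit A)) =
      evalAt (fun _ => S.y) '' (coeffSubring Unit S.O : Set (MvPowerSeries Unit A)) := by
    ext f
    exact S.mem_yRange
  rw [this]
  exact ((MvPowerSeries.isCompact_coeffSubring S.isCompact_O).image
    (MvPowerSeries.continuous_evalAt S.isSmall_y)).isClosed

omit [IsDomain A] in
theorem C_mem_yRange {a : A} (ha : a ∈ S.O) : MvPowerSeries.C a ∈ S.yRange :=
  S.mem_yRange.mpr ⟨MvPowerSeries.C a, MvPowerSeries.C_mem_coeffSubring ha,
    MvPowerSeries.evalAt_C _⟩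

omit [IsDomain A] in
theorem y_mem_yRange : S.y ∈ S.yRange :=
  S.mem_yRange.mpr ⟨MvPowerSeries.X (), MvPowerSeries.X_mem_coeffSubring (),
    MvPowerSeries.evalAt_X _⟩

theorem aeval_esymm_x_mem_yRange {k : ℕ} (hk : k < Fintype.card S.T) :
    MvPolynomial.aeval S.x (MvPolynomial.esymm S.T A (k + 1)) ∈ S.yRange := by
  have hq := S.two_le_q
  have hneg : ∀ n : ℕ, (-1 : MvPowerSeries Unit A) ^ n ∈ S.yRange := fun n =>
    S.yRange.pow_mem (S.yRange.neg_mem S.yRange.one_mem) n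
  rw [S.card_T_eq] at hk
  rcases lt_trichotomy (k + 1) (S.q - 1) with h | h | h
  · rw [aeval_esymm_trinomial_eq_zero hq S.card_T_eq S.x_injective S.root_x (by omega) h]
    exact S.yRange.zero_mem
  · rw [h, aeval_esymm_trinomial_pred hq S.card_T_eq S.x_injective S.root_x]
    exact S.yRange.mul_mem (hneg _) (S.C_mem_yRange S.π_mem)
  · have h' : k + 1 = S.q := by omega
    rw [h', aeval_esymm_trinomial_self hq S.card_T_eq S.x_injective S.root_x]
    exact S.yRange.mul_mem (hneg _) (S.yRange.neg_mem S.y_mem_yRange)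

/-- The sum of the values of a point at the variables indexed by `T`. -/
noncomputable def symmetrization : S.Pt Unit →+ S.Pt S.T :=
  ∑ z : S.T, evalHom S.FL (fun _ => MvPowerSeries.isSmall_X z)

omit [IsDomain A] in
theorem symmetrization_mem {s : S.Pt Unit} (hs : s ∈ S.integral Unit) :
    S.symmetrization s ∈ S.integral S.T := by
  rw [symmetrization, AddMonoidHom.finsetSum_apply]
  exact (S.integral S.T).sum_mem fun z _ =>
    S.evalHom_mem_integral _ (fun _ => MvPowerSeries.X_mem_coeffSubring z) hs

omit [IsDomain A] in
theorem evalHom_symmetrization {g : S.T → MvPowerSeries υ A} (hg : ∀ z, IsSmall (g z))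
    (s : S.Pt Unit) :
    evalHom S.FL hg (S.symmetrization s) = ∑ z : S.T, evalHom S.FL (fun _ => hg z) s := by
  rw [symmetrization, AddMonoidHom.finsetSum_apply, map_sum]
  refine Finset.sum_congr rfl fun z _ => SmallPoint.ext ?_
  rw [coe_evalHom, coe_evalHom, coe_evalHom,
    MvPowerSeries.evalAt_evalAt (fun _ => MvPowerSeries.isSmall_X z) hg]
  simp only [MvPowerSeries.evalAt_X]

omit [IsDomain A] in
theorem evalAt_symmetrization_perm (s : S.Pt Unit) (e : Equiv.Perm S.T) :
    evalAt (fun z => MvPowerSeries.X (e z)) (S.symmetrization s).1 = (S.symmetrization s).1 := by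
  have h := S.evalHom_symmetrization (g := fun z => MvPowerSeries.X (e z))
    (fun z => MvPowerSeries.isSmall_X (e z)) s
  have h' := Equiv.sum_comp e fun z : S.T =>
    evalHom S.FL (fun _ : Unit => MvPowerSeries.isSmall_X z) s
  have h2 := h.trans h'
  have h3 : S.symmetrization s = ∑ z : S.T,
      evalHom S.FL (fun _ : Unit => MvPowerSeries.isSmall_X z) s := by
    rw [symmetrization, AddMonoidHom.finsetSum_apply]
  rw [← h3] at h2
  exact congrArg SmallPoint.val h2

/-- The trace is the value at the translates of the `F_L`-sum of `s` in independent variables. That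
sum is a symmetric series because the law is commutative. -/
theorem coe_trace_mem_yRange {s : S.Pt Unit} (hs : s ∈ S.integral Unit) :
    (S.trace s).1 ∈ S.yRange := by
  have h : (S.trace s).1 = evalAt S.x (S.symmetrization s).1 := by
    rw [trace_apply, ← S.evalHom_symmetrization S.isSmall_x, coe_evalHom]
  rw [h]
  exact MvPowerSeries.evalAt_mem_of_symmetric (O := S.O) S.isSmall_x S.isClosed_yRange
    (fun a ha => S.C_mem_yRange ha) (fun k hk => S.aeval_esymm_x_mem_yRange hk)
    (S.symmetrization_mem hs) (S.evalAt_symmetrization_perm s)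

/-- The trace of an integral point is a power series in `π X + X ^ q`. -/
theorem exists_trace_eq {s : S.Pt Unit} (hs : s ∈ S.integral Unit) :
    ∃ D ∈ S.integral Unit, evalHom S.FL S.isSmall_y D = S.trace s := by
  obtain ⟨D, hD, hDeq⟩ := S.mem_yRange.mp (S.coe_trace_mem_yRange hs)
  have hDsmall : IsSmall D := by
    rw [IsSmall, ← S.constantCoeff_evalAt_y, hDeq]
    exact (S.trace s).2
  exact ⟨⟨D, hDsmall⟩, hD, SmallPoint.ext hDeq⟩

omit [IsDomain A] in
-- Modulo `π` one has `y = X ^ q`, and `D (X ^ q) = 0` forces every coefficient of `D` to vanish.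
theorem dvd_of_dvd_evalAt_y {D : MvPowerSeries Unit A}
    (h : MvPowerSeries.C S.π ∣ evalAt (fun _ => S.y) D) : MvPowerSeries.C S.π ∣ D := by
  have hq : S.q ≠ 0 := by have := S.two_le_q; omega
  have hs := MvPowerSeries.hasSubst_of_constantCoeff_zero (σ := Unit) fun _ => S.constantCoeff_y
  rw [← MvPowerSeries.subst_eq_evalAt hs] at h
  let k := Ideal.Quotient.mk (Ideal.span {S.π})
  have hk : ∀ f : MvPowerSeries Unit A,
      MvPowerSeries.C S.π ∣ f ↔ MvPowerSeries.map k f = 0 := by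
    intro f
    rw [MvPowerSeries.C_dvd_iff, MvPowerSeries.ext_iff]
    refine forall_congr' fun d => ?_
    rw [MvPowerSeries.coeff_map, MvPowerSeries.coeff_zero, Ideal.Quotient.eq_zero_iff_mem,
      Ideal.mem_span_singleton]
  have hkπ : k S.π = 0 := by
    rw [Ideal.Quotient.eq_zero_iff_mem, Ideal.mem_span_singleton]
  rw [hk, MvPowerSeries.map_subst hs] at h
  have hy : (fun _ : Unit => MvPowerSeries.map k S.y) =
      fun _ => (PowerSeries.X ^ S.q : (A ⧸ Ideal.span {S.π})⟦X⟧) := by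
    funext _
    rw [y, lubinTateVar, map_add, map_mul, MvPowerSeries.map_C, hkπ, map_zero, zero_mul,
      _root_.zero_add, map_pow, MvPowerSeries.map_X]
    rfl
  rw [hy] at h
  rw [hk]
  refine PowerSeries.ext fun n => ?_
  have h1 := PowerSeries.coeff_subst_X_pow (S := A ⧸ Ideal.span {S.π}) hq
    (MvPowerSeries.map k D : (A ⧸ Ideal.span {S.π})⟦X⟧) (S.q * n)
  rw [if_pos (dvd_mul_right _ _), Nat.mul_div_cancel_left _ (Nat.pos_of_ne_zero hq)] at h1
  rw [map_zero]
  refine Eq.trans ?_ (h1.symm.trans ?_)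
  · rfl
  · rw [PowerSeries.subst, h, map_zero]

theorem pow_dvd_of_dvd_evalAt_y (n : ℕ) {D : MvPowerSeries Unit A}
    (h : MvPowerSeries.C (S.π ^ n) ∣ evalAt (fun _ => S.y) D) :
    MvPowerSeries.C (S.π ^ n) ∣ D := by
  induction n generalizing D with
  | zero => simp
  | succ n ih =>
    obtain ⟨E, hE⟩ := S.dvd_of_dvd_evalAt_y
      (by simpa using S.dvd_of_le (by omega : 1 ≤ n + 1) h)
    have hC : MvPowerSeries.C (σ := Unit) S.π ≠ 0 := fun h0 => S.π_ne_zero (by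
      rw [← MvPowerSeries.constantCoeff_C (σ := Unit) S.π, h0, map_zero])
    rw [hE, MvPowerSeries.evalAt_mul S.isSmall_y, MvPowerSeries.evalAt_C, pow_succ', map_mul] at h
    rw [hE, pow_succ', map_mul]
    exact mul_dvd_mul_left _ (ih ((mul_dvd_mul_iff_left hC).mp h))

end Trace

end TraceSetting

end ColemanTrace

/-! ### Successive approximation. -/

namespace ColemanTrace.TraceSetting

open FormalGroup FormalGroup.SmallPoint
open MvPowerSeries (evalAt IsSmall coeffSubring)
open scoped MvPowerSeries.WithPiTopology

variable {A : Type*} [CommRing A] [UniformSpace A] (S : TraceSetting A)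
  [IsUniformAddGroup A] [IsTopologicalRing A] [CompleteSpace A] [T2Space A]
  [IsLinearTopology A A]

/-- The difference of the trace and of the endomorphism `endo`. -/
noncomputable def defect : S.Pt Unit →+ S.Pt Unit := S.trace - S.endo

theorem defect_apply (a : S.Pt Unit) : S.defect a = S.trace a - S.endo a := rfl

theorem defect_mem_level {n : ℕ} {a : S.Pt Unit} (ha : a ∈ S.level Unit n) :
    S.defect a ∈ S.level Unit n :=
  (S.level Unit n).sub_mem (S.trace_mem_level ha) (S.endo_mem_level ha)

theorem endoHom_mem_integral {τ : Type*} {a : S.Pt τ} (ha : a ∈ S.integral τ) :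
    endoHom S.FL S.φ_zero S.subst_φ a ∈ S.integral τ :=
  MvPowerSeries.evalAt_mem_coeffSubring (fun _ => a.2) S.isClosed_O (fun _ => ha) S.φ_mem

theorem endo_eq (a : S.Pt Unit) :
    S.endo a = evalHom S.FL S.isSmall_y (endoHom S.FL S.φ_zero S.subst_φ a) :=
  SmallPoint.ext (MvPowerSeries.evalAt_evalAt (fun _ => a.2) S.isSmall_y S.φ).symm

variable [IsDomain A]

theorem exists_defect_eq {s : S.Pt Unit} (hs : s ∈ S.integral Unit) :
    ∃ D ∈ S.integral Unit, evalHom S.FL S.isSmall_y D = S.defect s := by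
  obtain ⟨D, hD, hDs⟩ := S.exists_trace_eq hs
  refine ⟨D - endoHom S.FL S.φ_zero S.subst_φ s,
    (S.integral Unit).sub_mem hD (S.endoHom_mem_integral hs), ?_⟩
  rw [map_sub, hDs, ← endo_eq, defect_apply]

omit [IsUniformAddGroup A] [IsTopologicalRing A] [CompleteSpace A] [T2Space A]
  [IsLinearTopology A A] [IsDomain A] in
theorem mem_of_pow_mul_mem {n : ℕ} {a : A} (h : S.π ^ n * a ∈ S.O) : a ∈ S.O := by
  induction n with
  | zero => simpa using h
  | succ n ih =>
    rw [pow_succ', mul_assoc] at h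
    exact ih (S.mem_of_mul_mem _ h)

/-- `E (y)` is invariant under translation and leaves the sum; the rest is the `(q - 1)`-st power
sum `(1 - q) π`, and `u` inverts `1 - q`. -/
theorem sum_pow_mul_evalAt_y (E : MvPowerSeries Unit A) :
    ∑ z, evalAt (fun _ => S.x z) (-MvPowerSeries.C S.u * MvPowerSeries.X () ^ (S.q - 1) *
      evalAt (fun _ => S.y) E) = -evalAt (fun _ => S.y) (MvPowerSeries.C S.π * E) := by
  have hz : ∀ z : S.T, evalAt (fun _ => S.x z) (-MvPowerSeries.C S.u *
      MvPowerSeries.X () ^ (S.q - 1) * evalAt (fun _ => S.y) E) =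
      -MvPowerSeries.C S.u * evalAt (fun _ => S.y) E * S.x z ^ (S.q - 1) := by
    intro z
    have hg : ∀ _ : Unit, IsSmall (S.x z) := fun _ => S.isSmall_x z
    rw [MvPowerSeries.evalAt_mul hg, MvPowerSeries.evalAt_mul hg, MvPowerSeries.evalAt_pow hg,
      MvPowerSeries.evalAt_X, ← map_neg, MvPowerSeries.evalAt_C,
      MvPowerSeries.evalAt_evalAt S.isSmall_y hg, S.evalAt_x_y]
    ring
  have hu := congrArg (MvPowerSeries.C (σ := Unit)) S.u_mul
  rw [map_mul, map_sub, map_one, map_natCast] at hu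
  rw [Finset.sum_congr rfl fun z _ => hz z, ← Finset.mul_sum,
    sum_pow_pred_trinomial S.two_le_q S.card_T_eq S.x_injective S.root_x,
    MvPowerSeries.evalAt_mul S.isSmall_y, MvPowerSeries.evalAt_C]
  linear_combination (-(MvPowerSeries.C S.π * evalAt (fun _ => S.y) E)) * hu

/-- An approximate solution of `trace s = endo s` can be improved. -/
theorem exists_defect_add_mem_level {n : ℕ} {s : S.Pt Unit} (hs : s ∈ S.integral Unit)
    (h : S.defect s ∈ S.level Unit (n + 2)) :
    ∃ t ∈ S.integral Unit, t ∈ S.level Unit (n + 1) ∧ S.defect (s + t) ∈ S.level Unit (n + 3) := by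
  obtain ⟨D, hD, hDs⟩ := S.exists_defect_eq hs
  have hDy : evalAt (fun _ => S.y) D.1 = (S.defect s).1 := by rw [← hDs, coe_evalHom]
  obtain ⟨D', hD'⟩ := S.pow_dvd_of_dvd_evalAt_y (n + 2) (D := D.1) (by rw [hDy]; exact h)
  have hD'O : D' ∈ coeffSubring Unit S.O := fun d => by
    refine S.mem_of_pow_mul_mem (n := n + 2) ?_
    rw [← MvPowerSeries.coeff_C_mul, ← hD']
    exact hD d
  -- One factor `π` is held back, because the ordinary trace of `t` below reproduces it.
  set E := MvPowerSeries.C (S.π ^ (n + 1)) * D' with hE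
  have hEO : E ∈ coeffSubring Unit S.O :=
    (coeffSubring Unit S.O).mul_mem (MvPowerSeries.C_mem_coeffSubring (S.O.pow_mem S.π_mem _)) hD'O
  have hCE : MvPowerSeries.C S.π * E = D.1 := by
    rw [hD', hE, ← mul_assoc, ← map_mul, ← pow_succ']
  set t := -MvPowerSeries.C S.u * MvPowerSeries.X () ^ (S.q - 1) * evalAt (fun _ => S.y) E with ht
  have htl : MvPowerSeries.C (S.π ^ (n + 1)) ∣ t := by
    rw [ht, hE, MvPowerSeries.evalAt_mul S.isSmall_y, MvPowerSeries.evalAt_C]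
    exact Dvd.dvd.mul_left (dvd_mul_right _ _) _
  have hts : IsSmall t := S.isSmall_of_sub
    (MvPowerSeries.isSmall_of_constantCoeff_eq_zero (map_zero _)) (by
      rw [sub_zero]
      simpa using S.dvd_of_le (by omega : 1 ≤ n + 1) htl)
  have hyO : S.y ∈ coeffSubring Unit S.O :=
    (coeffSubring Unit S.O).add_mem ((coeffSubring Unit S.O).mul_mem
      (MvPowerSeries.C_mem_coeffSubring S.π_mem) (MvPowerSeries.X_mem_coeffSubring ()))
      ((coeffSubring Unit S.O).pow_mem (MvPowerSeries.X_mem_coeffSubring ()) _)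
  have htO : t ∈ coeffSubring Unit S.O :=
    (coeffSubring Unit S.O).mul_mem ((coeffSubring Unit S.O).mul_mem
      ((coeffSubring Unit S.O).neg_mem (MvPowerSeries.C_mem_coeffSubring S.u_mem))
      ((coeffSubring Unit S.O).pow_mem (MvPowerSeries.X_mem_coeffSubring ()) _))
      (MvPowerSeries.evalAt_mem_coeffSubring S.isSmall_y S.isClosed_O (fun _ => hyO) hEO)
  refine ⟨⟨t, hts⟩, htO, htl, ?_⟩
  set a : S.Pt Unit := ⟨t, hts⟩
  have hal : a ∈ S.level Unit (n + 1) := htl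
  have h1 := S.dvd_trace_sub hal
  have h1' : ∑ z, evalAt (fun _ => S.x z) a.1 = -(S.defect s).1 := by
    refine (S.sum_pow_mul_evalAt_y E).trans ?_
    rw [hCE, hDy]
  rw [h1'] at h1
  -- Both the passage from `F_L`-addition to ordinary addition and the comparison of traces cost an
  -- error modulo `π ^ (3 (n + 1))`, and `3 (n + 1) ≥ n + 3`. The main terms cancel.
  have h2 := S.dvd_coe_add_sub (S.level_anti (by omega : n + 1 ≤ n + 2) h) (S.trace_mem_level hal)
  have h3 : S.defect s + S.trace a ∈ S.level Unit (n + 3) := by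
    refine S.dvd_of_le (by omega : n + 3 ≤ (n + 1) * 3) ?_
    have := dvd_add h2 h1
    rwa [show ∀ x y w : MvPowerSeries Unit A, x - (y + w) + (w - -y) = x by intros; ring] at this
  have h4 := S.endo_mem_level_add_two (by omega) hal
  rw [map_add, S.defect_apply a, ← add_sub_assoc]
  exact (S.level Unit (n + 3)).sub_mem h3 h4

/-- Every approximate solution of `trace s = endo s` modulo `π ^ 2` is congruent to a solution. -/
theorem exists_defect_eq_zero {s : S.Pt Unit} (hs : s ∈ S.integral Unit)
    (h : S.defect s ∈ S.level Unit 2) :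
    ∃ r ∈ S.integral Unit, S.defect r = 0 ∧ MvPowerSeries.C S.π ∣ r.1 - s.1 := by
  choose f hfi hfl hfd using fun (n : ℕ)
    (a : {a // a ∈ S.integral Unit ∧ S.defect a ∈ S.level Unit (n + 2)}) =>
    S.exists_defect_add_mem_level a.2.1 a.2.2
  let r : ∀ n : ℕ, {a // a ∈ S.integral Unit ∧ S.defect a ∈ S.level Unit (n + 2)} := fun n =>
    Nat.rec ⟨s, hs, h⟩
      (fun n a => ⟨a.1 + f n a, (S.integral Unit).add_mem a.2.1 (hfi n a), hfd n a⟩) n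
  have hr : ∀ n, (r (n + 1)).1 - (r n).1 ∈ S.level Unit (n + 1) := fun n => by
    change (r n).1 + f n (r n) - (r n).1 ∈ _
    rw [add_sub_cancel_left]
    exact hfl n (r n)
  -- These are nested nonempty closed subsets of a compact space; a common point serves as the limit
  -- of the approximations.
  let t : ℕ → Set (MvPowerSeries Unit A) := fun n =>
    {g | g ∈ coeffSubring Unit S.O ∧ MvPowerSeries.C (S.π ^ (n + 1)) ∣ g - (r n).1.1}
  have htc : ∀ n, IsClosed (t n) := fun n =>
    (MvPowerSeries.isClosed_coeffSubring S.isClosed_O).inter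
      ((S.isClosed_dvd (n + 1)).preimage (continuous_id.sub continuous_const))
  obtain ⟨g, hg⟩ := IsCompact.nonempty_iInter_of_sequence_nonempty_isCompact_isClosed t
    (fun n g hg => by
      refine ⟨hg.1, ?_⟩
      have h1 := S.dvd_of_le (by omega : n + 1 ≤ n + 1 + 1) hg.2
      have h2 := dvd_add h1 (S.sub_mem_level.mp (hr n))
      rwa [sub_add_sub_cancel] at h2)
    (fun n => ⟨(r n).1.1, (r n).2.1, by simp⟩)
    ((MvPowerSeries.isCompact_coeffSubring S.isCompact_O).of_isClosed_subset (htc 0)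
      fun g hg => hg.1) htc
  have hgn : ∀ n, g ∈ t n := Set.mem_iInter.mp hg
  have hg0 : MvPowerSeries.C S.π ∣ g - s.1 := by
    have := (hgn 0).2
    rw [_root_.zero_add, pow_one] at this
    exact this
  refine ⟨⟨g, S.isSmall_of_sub s.2 hg0⟩, (hgn 0).1, ?_, hg0⟩
  refine SmallPoint.ext (S.eq_zero_of_forall_pow_dvd fun n => ?_)
  refine S.dvd_of_le (by omega : n ≤ n + 1) ?_
  have h1 := S.defect_mem_level (S.sub_mem_level.mpr (hgn n).2 :
    (⟨g, S.isSmall_of_sub s.2 hg0⟩ : S.Pt Unit) - (r n).1 ∈ S.level Unit (n + 1))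
  have h2 := (S.level Unit (n + 1)).add_mem h1
    (S.level_anti (by omega : n + 1 ≤ n + 2) (r n).2.2)
  rwa [map_sub, sub_add_cancel] at h2

theorem exists_trace_eq_endo_iff {s : S.Pt Unit} (hs : s ∈ S.integral Unit) :
    (∃ r ∈ S.integral Unit, S.trace r = S.endo r ∧ MvPowerSeries.C S.π ∣ r.1 - s.1) ↔
      MvPowerSeries.C (S.π ^ 2) ∣ (S.trace s).1 - (S.endo s).1 := by
  rw [← sub_mem_level, ← defect_apply]
  constructor
  · rintro ⟨r, -, hr, hrs⟩
    -- Additivity reduces necessity to `r - s`, whose defect lies in level two.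
    have hl : r - s ∈ S.level Unit 1 := S.sub_mem_level.mpr (by rwa [pow_one])
    have h1 : S.defect (r - s) ∈ S.level Unit 2 := (S.level Unit 2).sub_mem
      (S.trace_mem_level_two hl)
      (S.level_anti (by omega : 2 ≤ 1 + 2) (S.endo_mem_level_add_two le_rfl hl))
    rw [map_sub, S.defect_apply r, hr, sub_self, zero_sub] at h1
    exact neg_mem_iff.mp h1
  · intro h
    obtain ⟨r, hri, hr, hrs⟩ := S.exists_defect_eq_zero hs h
    exact ⟨r, hri, sub_eq_zero.mp hr, hrs⟩

end ColemanTrace.TraceSetting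

/-! ### Rings of integers of finite extensions of `ℚ_p` as discrete valuation rings. -/

namespace ColemanTrace

open Filter Topology

theorem charZero_of_padic (p : ℕ) [Fact p.Prime] (F : Type*) [Field F] [Algebra ℚ_[p] F] :
    CharZero F :=
  charZero_of_injective_algebraMap (algebraMap ℚ_[p] F).injective

section Integers

variable (p : ℕ) [Fact p.Prime]

instance : IsDiscreteValuationRing (PadicInt.subring p) :=
  inferInstanceAs (IsDiscreteValuationRing ℤ_[p])

instance : IsFractionRing (PadicInt.subring p) ℚ_[p] :=
  inferInstanceAs (IsFractionRing ℤ_[p] ℚ_[p])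

variable (F : Type*) [Field F] [Algebra ℚ_[p] F]

variable {F} in
-- The spectral norm is at most one exactly when the minimal polynomial has coefficients in `ℤ_p`,
-- which is integrality because `ℤ_p` is integrally closed.
theorem mem_integers_iff [FiniteDimensional ℚ_[p] F] (x : F) :
    x ∈ Integers p F ↔ spectralNorm ℚ_[p] F x ≤ 1 := by
  have hx : IsIntegral ℚ_[p] x := Algebra.IsIntegral.isIntegral x
  rw [spectralNorm, spectralValue_le_one_iff (minpoly.monic hx)]
  constructor
  · intro h n
    have h1 := minpoly.isIntegrallyClosed_eq_field_fractions ℚ_[p] F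
      (R := PadicInt.subring p) (S := F) (s := x) h
    rw [Algebra.algebraMap_self, RingHom.id_apply] at h1
    rw [h1, Polynomial.coeff_map]
    exact ((minpoly (PadicInt.subring p) x).coeff n).2
  · intro h
    have hl : minpoly ℚ_[p] x ∈ Polynomial.lifts (algebraMap (PadicInt.subring p) ℚ_[p]) := by
      rw [Polynomial.lifts_iff_coeff_lifts]
      exact fun n => ⟨⟨_, h n⟩, rfl⟩
    obtain ⟨P, hP, -, hPm⟩ := Polynomial.lifts_and_natDegree_eq_and_monic hl (minpoly.monic hx)
    refine ⟨P, hPm, ?_⟩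
    have h2 := minpoly.aeval ℚ_[p] x
    rw [← hP, Polynomial.aeval_map_algebraMap] at h2
    exact h2

variable [FiniteDimensional ℚ_[p] F]

instance : Module.Finite (PadicInt.subring p) (Integers p F) :=
  IsIntegralClosure.finite (PadicInt.subring p) ℚ_[p] F (Integers p F)

instance : IsDedekindDomain (Integers p F) :=
  integralClosure.isDedekindDomain (PadicInt.subring p) ℚ_[p] F

variable {F} in
theorem spectralNorm_mul_eq (x y : F) :
    spectralNorm ℚ_[p] F (x * y) = spectralNorm ℚ_[p] F x * spectralNorm ℚ_[p] F y :=
  spectralAlgNorm_mul x y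

variable {F} in
theorem isUnit_integers_iff (x : Integers p F) :
    IsUnit x ↔ spectralNorm ℚ_[p] F x.1 = 1 := by
  constructor
  · rintro ⟨u, rfl⟩
    have h := spectralNorm_mul_eq p (u : Integers p F).1 (↑u⁻¹ : Integers p F).1
    have h1 : (u : Integers p F).1 * (↑u⁻¹ : Integers p F).1 = 1 := by
      rw [← Subalgebra.coe_mul, Units.mul_inv, Subalgebra.coe_one]
    rw [h1, spectralNorm_one] at h
    have h2 := (mem_integers_iff p _).mp (u : Integers p F).2
    have h3 := (mem_integers_iff p _).mp (↑u⁻¹ : Integers p F).2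
    nlinarith [spectralNorm_nonneg (K := ℚ_[p]) (u : Integers p F).1,
      spectralNorm_nonneg (K := ℚ_[p]) (↑u⁻¹ : Integers p F).1]
  · intro h
    have h0 : x.1 ≠ 0 := by
      intro h0
      rw [h0, spectralNorm_zero] at h
      exact zero_ne_one h
    have h1 := spectralNorm_mul_eq p x.1 x.1⁻¹
    rw [mul_inv_cancel₀ h0, spectralNorm_one, h, one_mul] at h1
    exact IsUnit.of_mul_eq_one ⟨x.1⁻¹, (mem_integers_iff p _).mpr h1.symm.le⟩
      (Subtype.ext (mul_inv_cancel₀ h0))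

instance : IsLocalRing (Integers p F) := by
  refine IsLocalRing.of_nonunits_add fun a b ha hb => ?_
  rw [mem_nonunits_iff, isUnit_integers_iff] at ha hb ⊢
  have ha' := lt_of_le_of_ne ((mem_integers_iff p _).mp a.2) ha
  have hb' := lt_of_le_of_ne ((mem_integers_iff p _).mp b.2) hb
  refine ne_of_lt (lt_of_le_of_lt ?_ (max_lt ha' hb'))
  exact isNonarchimedean_spectralNorm a.1 b.1

theorem not_isUnit_natCast : ¬IsUnit (p : Integers p F) := by
  rw [isUnit_integers_iff]
  have h : ((p : Integers p F) : F) = algebraMap ℚ_[p] F p := by simp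
  rw [h, spectralNorm_extends]
  exact Padic.norm_p_lt_one.ne

omit [FiniteDimensional ℚ_[p] F] in
theorem natCast_integers_ne_zero : (p : Integers p F) ≠ 0 := fun h => by
  have := charZero_of_padic p F
  have h1 := congrArg Subtype.val h
  rw [Subalgebra.coe_zero, SubringClass.coe_natCast] at h1
  exact (Fact.out : p.Prime).ne_zero (Nat.cast_eq_zero.mp h1)

instance : IsDiscreteValuationRing (Integers p F) := by
  have hf : ¬IsField (Integers p F) := fun h => by
    obtain ⟨b, hb⟩ := h.mul_inv_cancel (natCast_integers_ne_zero p F)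
    exact not_isUnit_natCast p F (IsUnit.of_mul_eq_one b hb)
  exact ((IsDiscreteValuationRing.TFAE (Integers p F) hf).out 0 2).mpr
    (inferInstance : IsDedekindDomain (Integers p F))

end Integers

/-! ### The `p`-adic topology on the integers. -/

section Topology

variable (p : ℕ) [Fact p.Prime] (F : Type*) [Field F] [Algebra ℚ_[p] F]

/-- The `p`-adic uniform structure on the ring of integers. -/
noncomputable instance : UniformSpace (Integers p F) :=
  letI : TopologicalSpace (Integers p F) := (Ideal.span {(p : Integers p F)}).adicTopology
  haveI : IsTopologicalRing (Integers p F) :=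
    (Ideal.span {(p : Integers p F)}).ringFilterBasis.isTopologicalRing
  IsTopologicalAddGroup.rightUniformSpace (Integers p F)

theorem isAdic_integers : IsAdic (Ideal.span {(p : Integers p F)}) := rfl

theorem hasBasis_nhds_zero_integers : (𝓝 (0 : Integers p F)).HasBasis (fun _ : ℕ => True)
    fun n => {x | (p : Integers p F) ^ n ∣ x} := by
  convert (Ideal.span {(p : Integers p F)}).hasBasis_nhds_zero_adic using 2 with n
  ext x
  rw [Ideal.span_singleton_pow, SetLike.mem_coe, Ideal.mem_span_singleton]
  rfl

instance : IsTopologicalRing (Integers p F) :=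
  (Ideal.span {(p : Integers p F)}).ringFilterBasis.isTopologicalRing

instance : IsUniformAddGroup (Integers p F) :=
  letI : TopologicalSpace (Integers p F) := (Ideal.span {(p : Integers p F)}).adicTopology
  isUniformAddGroup_of_addCommGroup

instance : IsLinearTopology (Integers p F) (Integers p F) :=
  (Ideal.span {(p : Integers p F)}).isLinearTopology

instance [FiniteDimensional ℚ_[p] F] : T2Space (Integers p F) := by
  rw [← (isAdic_integers p F).isHausdorff_iff]
  refine IsHausdorff.of_isDomain _ ?_
  rw [Ne, Ideal.span_singleton_eq_top]
  exact not_isUnit_natCast p F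

/-- The multiples of an integer `b`. -/
noncomputable def smulInteger (b : Integers p F) : ℤ_[p] →+ Integers p F :=
  (LinearMap.toSpanSingleton (PadicInt.subring p) (Integers p F) b).toAddMonoidHom

theorem continuous_smulInteger (b : Integers p F) : Continuous (smulInteger p F b) := by
  refine continuous_of_continuousAt_zero (smulInteger p F b) ?_
  rw [ContinuousAt, map_zero, (hasBasis_nhds_zero_integers p F).tendsto_right_iff]
  intro n _
  have h : {c : ℤ_[p] | ‖c‖ ≤ (p : ℝ) ^ (-n : ℤ)} ∈ 𝓝 (0 : ℤ_[p]) := by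
    have := Metric.closedBall_mem_nhds (0 : ℤ_[p]) (ε := (p : ℝ) ^ (-n : ℤ))
      (zpow_pos (by exact_mod_cast (Fact.out : p.Prime).pos) _)
    convert this using 1
    ext c
    simp
  filter_upwards [h] with c hc
  rw [PadicInt.norm_le_pow_iff_mem_span_pow, Ideal.mem_span_singleton] at hc
  obtain ⟨d, rfl⟩ := hc
  refine ⟨smulInteger p F b d, ?_⟩
  have h1 : ((p : ℤ_[p]) ^ n * d) = p ^ n • d := by rw [nsmul_eq_mul, Nat.cast_pow]
  rw [h1, map_nsmul, nsmul_eq_mul, Nat.cast_pow]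

/-- The integers are a finite `ℤ_p`-module, hence a continuous image of some `ℤ_p ^ n`. Completeness
follows from this as well. -/
instance [FiniteDimensional ℚ_[p] F] : CompactSpace (Integers p F) := by
  obtain ⟨n, s, hs⟩ := Module.Finite.exists_fin (R := PadicInt.subring p) (M := Integers p F)
  have hc : Continuous fun c : Fin n → ℤ_[p] => ∑ i, smulInteger p F (s i) (c i) :=
    continuous_finsetSum _ fun i _ =>
      (continuous_smulInteger p F (s i)).comp (continuous_apply i)
  rw [← isCompact_univ_iff]
  convert isCompact_range hc
  symm
  rw [Set.eq_univ_iff_forall]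
  intro x
  have hx : x ∈ Submodule.span (PadicInt.subring p) (Set.range s) := by rw [hs]; trivial
  obtain ⟨c, hc⟩ := (Submodule.mem_span_range_iff_exists_fun _).mp hx
  exact ⟨c, hc⟩

end Topology

end ColemanTrace

/-! ### Uniformizers and residue fields. -/

namespace ColemanTrace

open Filter Topology

section Uniformizer

variable {p : ℕ} [Fact p.Prime] {F : Type*} [Field F] [Algebra ℚ_[p] F]

theorem isOpen_of_natCast_pow_mem {I : Ideal (Integers p F)} {n : ℕ}
    (h : (p : Integers p F) ^ n ∈ I) : IsOpen (I : Set (Integers p F)) := by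
  refine I.toAddSubgroup.isOpen_of_mem_nhds (g := 0) ?_
  refine mem_of_superset ((hasBasis_nhds_zero_integers p F).mem_of_mem (i := n) trivial) ?_
  exact fun x hx => I.mem_of_dvd hx h

theorem isClosed_of_natCast_pow_mem {I : Ideal (Integers p F)} {n : ℕ}
    (h : (p : Integers p F) ^ n ∈ I) : IsClosed (I : Set (Integers p F)) :=
  I.toAddSubgroup.isClosed_of_isOpen (isOpen_of_natCast_pow_mem h)

theorem isTopologicallyNilpotent_of_pow_dvd {a : Integers p F} {n : ℕ}
    (h : (p : Integers p F) ∣ a ^ n) : IsTopologicallyNilpotent a := by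
  refine TraceSetting.isTopologicallyNilpotent_of_pow (n := n) ?_
  rw [IsTopologicallyNilpotent, (hasBasis_nhds_zero_integers p F).tendsto_right_iff]
  exact fun k _ => eventually_atTop.mpr ⟨k, fun m hm =>
    (pow_dvd_pow _ hm).trans (pow_dvd_pow_of_dvd h m)⟩

variable [FiniteDimensional ℚ_[p] F] {π : Integers p F} (hπ : Irreducible π)

include hπ

theorem dvd_of_not_isUnit {a : Integers p F} (ha : ¬IsUnit a) : π ∣ a := by
  have h := (IsLocalRing.mem_maximalIdeal a).mpr ha
  rwa [hπ.maximalIdeal_eq, Ideal.mem_span_singleton] at h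

theorem uniformizer_dvd_natCast : π ∣ (p : Integers p F) :=
  dvd_of_not_isUnit hπ (not_isUnit_natCast p F)

theorem exists_natCast_dvd_uniformizer_pow : ∃ n, (p : Integers p F) ∣ π ^ n := by
  obtain ⟨n, hn⟩ := IsDiscreteValuationRing.associated_pow_irreducible
    (natCast_integers_ne_zero p F) hπ
  exact ⟨n, hn.dvd⟩

theorem finite_residue : Finite (Integers p F ⧸ Ideal.span {π}) := by
  have h : (p : Integers p F) ^ 1 ∈ Ideal.span {π} := by
    rw [pow_one, Ideal.mem_span_singleton]
    exact uniformizer_dvd_natCast hπ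
  exact (Ideal.span {π}).toAddSubgroup.quotient_finite_of_isOpen (isOpen_of_natCast_pow_mem h)

theorem isMaximal_span_uniformizer : (Ideal.span {π}).IsMaximal := by
  rw [← hπ.maximalIdeal_eq]
  infer_instance

theorem exists_residueCard_eq_pow : ∃ n, n ≠ 0 ∧ residueCard π = p ^ n ∧
    CharP (Integers p F ⧸ Ideal.span {π}) p := by
  have := finite_residue hπ
  have := isMaximal_span_uniformizer hπ
  let := Fintype.ofFinite (Integers p F ⧸ Ideal.span {π})
  let := Ideal.Quotient.field (Ideal.span {π})
  have hchar : CharP (Integers p F ⧸ Ideal.span {π}) p := by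
    refine (CharP.charP_iff_prime_eq_zero Fact.out).mpr ?_
    rw [← map_natCast (Ideal.Quotient.mk (Ideal.span {π})), Ideal.Quotient.eq_zero_iff_mem,
      Ideal.mem_span_singleton]
    exact uniformizer_dvd_natCast hπ
  obtain ⟨n, -, hn⟩ := FiniteField.card (Integers p F ⧸ Ideal.span {π}) p
  exact ⟨n, n.ne_zero, by rw [residueCard, Nat.card_eq_fintype_card, hn], hchar⟩

theorem isLubinTatePrime_residueCard :
    MvPowerSeries.IsLubinTatePrime π (residueCard π) where
  ne_zero := hπ.ne_zero
  two_le := by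
    obtain ⟨n, hn, h, -⟩ := exists_residueCard_eq_pow hπ
    rw [h]
    exact (Fact.out : p.Prime).two_le.trans (Nat.le_self_pow hn p)
  isUnit_one_sub_pow n hn := by
    by_contra h
    have h1 := dvd_add (dvd_of_not_isUnit hπ h) (dvd_pow_self π hn)
    rw [sub_add_cancel] at h1
    exact hπ.not_isUnit (isUnit_of_dvd_one h1)
  dvd_pow_sub_subst σ _ φ := by
    obtain ⟨n, hn, h, hchar⟩ := exists_residueCard_eq_pow hπ
    have hp : p ≠ 0 := (Fact.out : p.Prime).ne_zero
    have := finite_residue hπ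
    have := isMaximal_span_uniformizer hπ
    let := Fintype.ofFinite (Integers p F ⧸ Ideal.span {π})
    let := Ideal.Quotient.field (Ideal.span {π})
    have : ExpChar (Integers p F ⧸ Ideal.span {π}) p := ExpChar.prime Fact.out
    have hcard : Fintype.card (Integers p F ⧸ Ideal.span {π}) = p ^ n := by
      rw [← h, residueCard, Nat.card_eq_fintype_card]
    let k := Ideal.Quotient.mk (Ideal.span {π})
    have hk : ∀ f : MvPowerSeries σ (Integers p F),
        MvPowerSeries.map k f = 0 → MvPowerSeries.C π ∣ f := by
      intro f hf
      rw [MvPowerSeries.C_dvd_iff]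
      intro d
      rw [← Ideal.mem_span_singleton, ← Ideal.Quotient.eq_zero_iff_mem]
      exact (MvPowerSeries.coeff_map k d f).symm.trans (by rw [hf, map_zero])
    apply hk
    -- On a field with `q = p ^ n` elements the `q`-power map is the identity, so raising a series
    -- over it to the `q`-th power only replaces each `X_i` by `X_i ^ q`.
    have hF : iterateFrobenius (Integers p F ⧸ Ideal.span {π}) p n = RingHom.id _ := by
      refine RingHom.ext fun x => ?_
      rw [iterateFrobenius_def, ← hcard, FiniteField.pow_card]
      rfl
    have h1 := MvPowerSeries.map_iterateFrobenius_expand p hp (MvPowerSeries.map k φ) n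
    rw [hF, MvPowerSeries.map_id, RingHom.id_apply, ← MvPowerSeries.map_expand] at h1
    rw [map_sub, map_pow, sub_eq_zero, h, ← h1, MvPowerSeries.expand,
      MvPowerSeries.coe_substAlgHom]

theorem uniformizer_dvd_residueCard : π ∣ (residueCard π : Integers p F) := by
  obtain ⟨n, hn, h, -⟩ := exists_residueCard_eq_pow hπ
  rw [h, Nat.cast_pow]
  exact (uniformizer_dvd_natCast hπ).trans (dvd_pow_self _ hn)

theorem exists_mul_one_sub_residueCard : ∃ u : Integers p F, u * (1 - residueCard π) = 1 := by
  have h : IsUnit (1 - residueCard π : Integers p F) := by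
    by_contra h
    have h1 := dvd_add (dvd_of_not_isUnit hπ h) (uniformizer_dvd_residueCard hπ)
    rw [sub_add_cancel] at h1
    exact hπ.not_isUnit (isUnit_of_dvd_one h1)
  exact h.exists_left_inv

end Uniformizer

/-! ### Inclusions of rings of integers. -/

section Extension

variable {p : ℕ} [Fact p.Prime] {E F : Type*} [Field E] [Field F] [Algebra ℚ_[p] E]
  [Algebra ℚ_[p] F] [Algebra E F] [IsScalarTower ℚ_[p] E F]

theorem coe_integersMap (a : Integers p E) : (integersMap p E F a : F) = algebraMap E F a := rfl

theorem integersMap_injective : Function.Injective (integersMap p E F) := fun _ _ h =>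
  Subtype.ext ((algebraMap E F).injective (congrArg Subtype.val h))

theorem continuous_integersMap : Continuous (integersMap p E F) := by
  refine continuous_of_continuousAt_zero (integersMap p E F) ?_
  rw [ContinuousAt, map_zero, (hasBasis_nhds_zero_integers p F).tendsto_right_iff]
  intro n _
  refine mem_of_superset ((hasBasis_nhds_zero_integers p E).mem_of_mem (i := n) trivial) ?_
  intro x hx
  have h := map_dvd (integersMap p E F) hx
  rwa [map_pow, map_natCast] at h

/-- The quotient already exists in `E`, and it is integral because its image in `F` is. Divisibility
by `π_K` therefore descends. -/
theorem mem_range_integersMap_of_mul_mem {b : Integers p E} (hb : b ≠ 0) {a : Integers p F}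
    (h : integersMap p E F b * a ∈ (integersMap p E F).range) :
    a ∈ (integersMap p E F).range := by
  obtain ⟨c, hc⟩ := h
  have hb' : (b : E) ≠ 0 := fun h => hb (Subtype.ext h)
  have h1 : algebraMap E F (c / b : E) = a := by
    have h2 := congrArg Subtype.val hc
    rw [coe_integersMap, Subalgebra.coe_mul, coe_integersMap] at h2
    rw [map_div₀, h2, mul_div_cancel_left₀]
    exact (_root_.map_ne_zero _).mpr hb'
  have h3 : IsIntegral (PadicInt.subring p) (c / b : E) := by
    have h4 : IsIntegral (PadicInt.subring p) (algebraMap E F (c / b : E)) := by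
      rw [h1]
      exact a.2
    exact (isIntegral_algHom_iff ((IsScalarTower.toAlgHom ℚ_[p] E F).restrictScalars
      (PadicInt.subring p)) (algebraMap E F).injective).mp h4
  exact ⟨⟨_, h3⟩, Subtype.ext h1⟩

end Extension

/-! ### The roots of `π x + x ^ q`. -/

section Torsion

variable {p : ℕ} [Fact p.Prime] {K : Type*} [Field K] [Algebra ℚ_[p] K]
  [FiniteDimensional ℚ_[p] K] {π : Integers p K} (hπ : Irreducible π)

instance : FiniteDimensional ℚ_[p] (TorsionField p π) :=
  Module.Finite.trans K (TorsionField p π)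

theorem isRoot_map_basicPoly {R M : Type*} [CommRing R] [CommRing M] (g : R →+* M) (π : R) (z : M) :
    ((basicPoly π).map g).IsRoot z ↔ g π * z + z ^ residueCard π = 0 := by
  simp [basicPoly]

omit [FiniteDimensional ℚ_[p] K] in
theorem mem_torsionPoints (z : TorsionIntegers p π) (hq : 2 ≤ residueCard π) :
    z ∈ torsionPoints p π ↔ inclK p π π * z + z ^ residueCard π = 0 := by
  classical
  have hm : ((basicPoly π).map (inclK p π)).Monic := by
    refine Polynomial.Monic.map _ ?_
    rw [basicPoly, add_comm]
    refine Polynomial.monic_X_pow_add (lt_of_le_of_lt (Polynomial.degree_C_mul_X_le π) ?_)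
    exact_mod_cast hq
  rw [torsionPoints, Multiset.mem_toFinset, Polynomial.mem_roots hm.ne_zero, isRoot_map_basicPoly]

/-- The trinomial `a X + X ^ n` is separable in characteristic zero. -/
theorem separable_trinomial {k : Type*} [Field k] [CharZero k] {a : k} (ha : a ≠ 0) {n : ℕ}
    (hn : 2 ≤ n) : (Polynomial.C a * Polynomial.X + Polynomial.X ^ n).Separable := by
  obtain ⟨m, rfl⟩ := Nat.exists_eq_add_of_le' hn
  have hm : ((m : k) + 1) ≠ 0 := by exact_mod_cast m.succ_ne_zero
  have h1 : (Polynomial.C a⁻¹ * Polynomial.C a : k[X]) = 1 := by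
    rw [← Polynomial.C_mul, inv_mul_cancel₀ ha, Polynomial.C_1]
  have h2 : (Polynomial.C ((m : k) + 1)⁻¹ * ((m : k[X]) + 1) : k[X]) = 1 := by
    have : (Polynomial.C ((m : k) + 1) : k[X]) = (m : k[X]) + 1 := by simp
    rw [← this, ← Polynomial.C_mul, inv_mul_cancel₀ hm, Polynomial.C_1]
  set b : k[X] := Polynomial.C a⁻¹
  set c : k[X] := Polynomial.C ((m : k) + 1)⁻¹
  -- With `f = a X + X ^ (m + 2)`, one has `(m + 2) f - X f' = (m + 1) a X`. Substituting this for
  -- `X` in `a = f' - (m + 2) X ^ (m + 1)` gives the Bézout coefficients.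
  refine ⟨-(b * b * c * ((m : k[X]) + 2) ^ 2 * Polynomial.X ^ m),
    b + b * b * c * ((m : k[X]) + 2) * Polynomial.X ^ (m + 1), ?_⟩
  have hd : Polynomial.derivative (Polynomial.C a * Polynomial.X + Polynomial.X ^ (m + 2) : k[X]) =
      Polynomial.C a + ((m : k[X]) + 2) * Polynomial.X ^ (m + 1) := by
    simp
    ring
  rw [hd]
  linear_combination h1 - b * c * (m + 1) * (m + 2) * Polynomial.X ^ (m + 1) * h1 -
    b * (m + 2) * Polynomial.X ^ (m + 1) * h2

include hπ

theorem card_torsionPoints : (torsionPoints p π).card = residueCard π := by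
  classical
  have := charZero_of_padic p K
  have hq := (isLubinTatePrime_residueCard hπ).two_le
  have hπ0 : (π : K) ≠ 0 := fun h => hπ.ne_zero (Subtype.ext h)
  have hP : (basicPoly π).map (algebraMap (Integers p K) K) =
      Polynomial.C (π : K) * Polynomial.X + Polynomial.X ^ residueCard π := by
    rw [basicPoly, Polynomial.map_add, Polynomial.map_mul, Polynomial.map_C, Polynomial.map_X,
      Polynomial.map_pow, Polynomial.map_X]
    rfl
  have hdeg : ((basicPoly π).map (algebraMap (Integers p K) K)).natDegree = residueCard π := by
    rw [hP, add_comm]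
    refine Polynomial.natDegree_eq_of_degree_eq_some ?_
    have h1 : (Polynomial.C (π : K) * Polynomial.X).degree <
        (Polynomial.X ^ residueCard π : K[X]).degree := by
      rw [Polynomial.degree_X_pow]
      refine lt_of_le_of_lt (Polynomial.degree_C_mul_X_le _) ?_
      exact_mod_cast hq
    rw [Polynomial.degree_add_eq_left_of_degree_lt h1, Polynomial.degree_X_pow]
  have hne : (basicPoly π).map (algebraMap (Integers p K) K) ≠ 0 := fun h => by
    rw [h, Polynomial.natDegree_zero] at hdeg
    omega
  have hsep : ((basicPoly π).map (algebraMap (Integers p K) K)).Separable := by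
    rw [hP]
    exact separable_trinomial hπ0 hq
  have hcard := Polynomial.card_rootSet_eq_natDegree hsep
    (Polynomial.SplittingField.splits ((basicPoly π).map (algebraMap (Integers p K) K)))
  rw [hdeg] at hcard
  rw [← hcard, ← Set.toFinset_card, ← Finset.card_map (Function.Embedding.subtype _)]
  have haev : ∀ z : TorsionField p π,
      Polynomial.aeval z ((basicPoly π).map (algebraMap (Integers p K) K)) =
        algebraMap K (TorsionField p π) π * z + z ^ residueCard π := fun z =>
    (congrArg (Polynomial.aeval z) hP).trans (by simp)
  congr 1
  ext z
  rw [Set.mem_toFinset, Polynomial.mem_rootSet, Finset.mem_map, haev]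
  constructor
  · rintro ⟨a, ha, rfl⟩
    rw [mem_torsionPoints a hq] at ha
    exact ⟨hne, congrArg Subtype.val ha⟩
  · rintro ⟨-, hz⟩
    have hint : IsIntegral (PadicInt.subring p) z := by
      rcases eq_or_ne z 0 with rfl | hz0
      · exact isIntegral_zero
      -- All roots in the splitting field are integral: a nonzero one has `(q - 1)`-st power `-π`.
      · have h1 : z ^ (residueCard π - 1) = -(inclK p π π : TorsionField p π) := by
          refine mul_left_cancel₀ hz0 ?_
          rw [mul_pow_sub_one (by omega)]
          have h2 : (inclK p π π : TorsionField p π) = algebraMap K _ (π : K) := rfl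
          rw [h2]
          linear_combination hz
        refine IsIntegral.of_pow (n := residueCard π - 1) (by omega) ?_
        rw [h1]
        exact (inclK p π π).2.neg
    exact ⟨⟨z, hint⟩, (mem_torsionPoints _ hq).mpr (Subtype.ext hz), rfl⟩

end Torsion

end ColemanTrace

/-! ### Base change of series and formal group laws. -/

namespace MvPowerSeries

variable {R M : Type*} [CommRing R] [CommRing M] (g : R →+* M) {σ τ : Type*}

theorem map_lubinTateVar {σ : Type} (π : R) (q : ℕ) (i : σ) :
    map g (lubinTateVar π q i) = lubinTateVar (g π) q i := by
  rw [lubinTateVar, map_add, map_mul, map_C, map_pow, map_X, lubinTateVar]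

theorem map_lubinTateDefect {σ : Type} [Finite σ] {q : ℕ} (hq : q ≠ 0) (π : R) (φ : MvPowerSeries σ R) :
    map g (lubinTateDefect π q φ) = lubinTateDefect (g π) q (map g φ) := by
  rw [lubinTateDefect, map_sub, map_add, map_mul, map_C, map_pow,
    map_subst (hasSubst_lubinTateVar hq), lubinTateDefect]
  simp only [map_lubinTateVar]

theorem natCast_le_order_map {n : ℕ} {φ : MvPowerSeries σ R} (h : (n : ℕ∞) ≤ φ.order) :
    (n : ℕ∞) ≤ (map g φ).order := by
  rw [natCast_le_order_iff] at h ⊢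
  intro d hd
  rw [coeff_map, h d hd, map_zero]

theorem constantCoeff_map_eq_zero {φ : MvPowerSeries σ R} (h : constantCoeff φ = 0) :
    constantCoeff (map g φ) = 0 := by
  rw [constantCoeff_map, h, map_zero]

theorem map_subst_cons {a b : MvPowerSeries τ R} (ha : constantCoeff a = 0)
    (hb : constantCoeff b = 0) (F : MvPowerSeries (Fin 2) R) :
    map g (subst ![a, b] F) = subst ![map g a, map g b] (map g F) := by
  have h : ∀ i : Fin 2, constantCoeff (![a, b] i) = 0 := fun i => by
    fin_cases i
    exacts [ha, hb]
  rw [map_subst (hasSubst_of_constantCoeff_zero h)]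
  congr 1
  funext i
  fin_cases i <;> rfl

theorem map_mem_coeffSubring {O : Subring M} (h : ∀ a, g a ∈ O) (φ : MvPowerSeries σ R) :
    map g φ ∈ coeffSubring σ O := fun d => by
  rw [coeff_map]
  exact h _

end MvPowerSeries

namespace FormalGroup

variable {R M : Type*} [CommRing R] [CommRing M] (g : R →+* M)

theorem IsComm.map {F : FormalGroup R} (h : F.IsComm) : (F.map g).IsComm where
  comm := by
    have h1 := congrArg (MvPowerSeries.map g) h.comm
    rwa [MvPowerSeries.map_subst_cons g (MvPowerSeries.constantCoeff_X _)
      (MvPowerSeries.constantCoeff_X _), MvPowerSeries.map_X, MvPowerSeries.map_X] at h1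

theorem natCast_le_order_map_sub {n : ℕ} {F : FormalGroup R}
    (h : (n : ℕ∞) ≤ (F.toPowerSeries - (MvPowerSeries.X 0 + MvPowerSeries.X 1)).order) :
    (n : ℕ∞) ≤ ((F.map g).toPowerSeries - (MvPowerSeries.X 0 + MvPowerSeries.X 1)).order := by
  have h1 := MvPowerSeries.natCast_le_order_map g h
  rwa [map_sub, map_add, MvPowerSeries.map_X, MvPowerSeries.map_X] at h1

end FormalGroup

/-! ### The axioms of the trace setting for `K / L`. -/

namespace ColemanTrace

open MvPowerSeries (lubinTateVar lubinTateDefect coeffSubring evalAt IsSmall)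

section Setting

variable {p : ℕ} [Fact p.Prime] {L K : Type*} [Field L] [Field K]
  [Algebra ℚ_[p] L] [Algebra ℚ_[p] K] [Algebra L K] [IsScalarTower ℚ_[p] L K]
  {πL : Integers p L} {πK : Integers p K}

/-- The inclusion of `𝒪_L` into the ring of integers of the field generated by the roots
of `f_K`. -/
noncomputable abbrev inclL (L : Type*) [Field L] [Algebra ℚ_[p] L] [Algebra L K]
    [IsScalarTower ℚ_[p] L K] (πK : Integers p K) : Integers p L →+* TorsionIntegers p πK :=
  (inclK p πK).comp (integersMap p L K)

theorem inclK_mem (a : Integers p K) : inclK p πK a ∈ (inclK p πK).range := ⟨_, rfl⟩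

theorem inclL_mem (a : Integers p L) : inclL L πK a ∈ (inclK p πK).range := ⟨_, rfl⟩

variable [FiniteDimensional ℚ_[p] L] [FiniteDimensional ℚ_[p] K]

/-- The formal group laws and the endomorphism `[β πL]` over the ring of integers of the field
generated by the roots of `f_K`. -/
noncomputable def traceSetting (hπL : Irreducible πL) (hπK : Irreducible πK)
    (hqL : 3 ≤ residueCard πL) (hram : πK ^ 2 ∣ integersMap p L K πL) (β : Integers p L) :
    TraceSetting (TorsionIntegers p πK) where
  O := (inclK p πK).range
  isCompact_O := by
    rw [RingHom.coe_range]
    exact isCompact_range continuous_integersMap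
  π := inclK p πK πK
  π_mem := ⟨_, rfl⟩
  π_ne_zero := (map_ne_zero_iff _ integersMap_injective).mpr hπK.ne_zero
  isTopologicallyNilpotent_π := by
    obtain ⟨n, hn⟩ := exists_natCast_dvd_uniformizer_pow hπK
    have h := map_dvd (inclK p πK) hn
    rw [map_pow, map_natCast] at h
    exact isTopologicallyNilpotent_of_pow_dvd h
  isClosed_span n := by
    refine isClosed_of_natCast_pow_mem (n := n) ?_
    rw [Ideal.mem_span_singleton]
    have h := map_dvd (inclK p πK) (uniformizer_dvd_natCast hπK)
    rw [map_natCast] at h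
    exact pow_dvd_pow_of_dvd h n
  mem_of_mul_mem a h := mem_range_integersMap_of_mul_mem hπK.ne_zero h
  q := residueCard πK
  two_le_q := (isLubinTatePrime_residueCard hπK).two_le
  π_dvd_q := by
    have h := map_dvd (inclK p πK) (uniformizer_dvd_residueCard hπK)
    rwa [map_natCast] at h
  u := inclK p πK (exists_mul_one_sub_residueCard hπK).choose
  u_mem := ⟨_, rfl⟩
  u_mul := by
    have h := congrArg (inclK p πK) (exists_mul_one_sub_residueCard hπK).choose_spec
    rwa [map_mul, map_sub, map_one, map_natCast] at h
  T := torsionPoints p πK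
  card_T := card_torsionPoints hπK
  root_T z hz := (mem_torsionPoints z (isLubinTatePrime_residueCard hπK).two_le).mp hz
  FK := (lubinTateLaw (basicSeries πK)).map (inclK p πK)
  defect_FK := by
    have hq := (isLubinTatePrime_residueCard hπK).two_le
    have h := congrArg (MvPowerSeries.map (inclK p πK))
      (lubinTateDefect_law (isLubinTatePrime_residueCard hπK))
    rwa [MvPowerSeries.map_lubinTateDefect _ (by omega), map_zero] at h
  FL := (lubinTateLaw (basicSeries πL)).map (inclL L πK)
  isComm := FormalGroup.IsComm.map _ (isComm_lubinTateLaw (isLubinTatePrime_residueCard hπL))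
  FL_mem := MvPowerSeries.map_mem_coeffSubring (inclL L πK) (fun a => inclL_mem a)
    (lubinTateLaw (basicSeries πL)).toPowerSeries
  order_FL := FormalGroup.natCast_le_order_map_sub _ (le_trans (Nat.cast_le.mpr hqL)
    (le_order_lubinTateLaw (isLubinTatePrime_residueCard hπL)))
  inv := MvPowerSeries.map (inclL L πK)
    (exists_inverse_lubinTateLaw (isLubinTatePrime_residueCard hπL)).choose
  inv_mem := MvPowerSeries.map_mem_coeffSubring (inclL L πK) (fun a => inclL_mem a) _
  inv_zero := MvPowerSeries.constantCoeff_map_eq_zero _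
    (exists_inverse_lubinTateLaw (isLubinTatePrime_residueCard hπL)).choose_spec.1
  subst_inv := by
    have h := (exists_inverse_lubinTateLaw (isLubinTatePrime_residueCard hπL)).choose_spec
    have h1 := congrArg (MvPowerSeries.map (inclL L πK)) h.2
    have hX : MvPowerSeries.map (inclL L πK) PowerSeries.X = PowerSeries.X :=
      MvPowerSeries.map_X _ ()
    rwa [MvPowerSeries.map_subst_cons (a := PowerSeries.X) _ (MvPowerSeries.constantCoeff_X ()) h.1,
      hX, map_zero] at h1
  φ := MvPowerSeries.map (inclL L πK) (lubinTateEndo (basicSeries πL) (β * πL))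
  φ_mem := MvPowerSeries.map_mem_coeffSubring (inclL L πK) (fun a => inclL_mem a) _
  φ_zero := MvPowerSeries.constantCoeff_map_eq_zero _
    ((isLubinTateEndo_iff _ _).mp
      (isLubinTateEndo_lubinTateEndo (isLubinTatePrime_residueCard hπL) _)).1
  subst_φ := by
    have h0 := ((isLubinTateEndo_iff _ _).mp
      (isLubinTateEndo_lubinTateEndo (isLubinTatePrime_residueCard hπL) (β * πL))).1
    have h := congrArg (MvPowerSeries.map (inclL L πK))
      (subst_lubinTateEndo (isLubinTatePrime_residueCard hπL) (β * πL))
    rw [PowerSeries.subst, MvPowerSeries.map_subst (MvPowerSeries.hasSubst_of_constantCoeff_zero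
      fun _ => FormalGroup.zero_constantCoeff _), MvPowerSeries.map_subst
      (MvPowerSeries.hasSubst_of_constantCoeff_zero fun i =>
        PowerSeries.constantCoeff_subst_eq_zero (MvPowerSeries.constantCoeff_X i) _ h0)] at h
    refine h.trans ?_
    congr 1
    funext i
    rw [PowerSeries.subst, MvPowerSeries.map_subst (MvPowerSeries.hasSubst_of_constantCoeff_zero
      fun _ => MvPowerSeries.constantCoeff_X i), MvPowerSeries.map_X, PowerSeries.subst]
  ψ := MvPowerSeries.map (inclL L πK) (lubinTateEndo (basicSeries πL) β)
  ψ_zero := MvPowerSeries.constantCoeff_map_eq_zero _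
    ((isLubinTateEndo_iff _ _).mp
      (isLubinTateEndo_lubinTateEndo (isLubinTatePrime_residueCard hπL) _)).1
  qL := residueCard πL
  three_le_qL := hqL
  ϖ := inclL L πK πL
  π_sq_dvd := by
    have h := map_dvd (inclK p πK) hram
    rwa [map_pow] at h
  φ_eq := by
    rw [lubinTateEndo_mul_self (isLubinTatePrime_residueCard hπL), PowerSeries.subst,
      basicSeries_eq, MvPowerSeries.map_subst (MvPowerSeries.hasSubst_of_constantCoeff_zero
        fun _ => MvPowerSeries.constantCoeff_lubinTateVar (by omega) _)]
    simp only [MvPowerSeries.map_lubinTateVar]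

end Setting

end ColemanTrace

/-! ### Comparison with the coefficientwise composites and conclusion. -/

namespace ColemanTrace

open FormalGroup FormalGroup.SmallPoint
open MvPowerSeries (coeffSubring evalAt IsSmall)
open scoped MvPowerSeries.WithPiTopology

section CompSeries

variable {p : ℕ} [Fact p.Prime] {F : Type*} [Field F] [Algebra ℚ_[p] F] [FiniteDimensional ℚ_[p] F]

/-- Coefficients are continuous, so they can be taken termwise in the sum defining the evaluation.
The topology in `compSeries` is the one underlying the uniform structure. -/
theorem compSeries_eq_evalAt {σ : Type*} [Finite σ] {g : σ → (Integers p F)⟦X⟧}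
    (hg : ∀ i, IsSmall (g i)) (h : MvPowerSeries σ (Integers p F)) :
    compSeries p h g = evalAt g h := by
  refine PowerSeries.ext fun n => ?_
  rw [compSeries, PowerSeries.coeff_mk]
  have h1 := (MvPowerSeries.hasSum_evalAt hg h).map
    (MvPowerSeries.coeff (R := Integers p F) (Finsupp.single () n))
    (MvPowerSeries.WithPiTopology.continuous_coeff (Integers p F) _)
  have h2 : ((MvPowerSeries.coeff (R := Integers p F) (Finsupp.single () n)) ∘
      fun d : σ →₀ ℕ => MvPowerSeries.C (MvPowerSeries.coeff d h) * d.prod fun i k => g i ^ k) =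
      fun d => MvPowerSeries.coeff d h * PowerSeries.coeff n (d.prod fun i k => g i ^ k) := by
    funext d
    exact MvPowerSeries.coeff_C_mul _ _ _
  rw [h2] at h1
  exact h1.tsum_eq

theorem comp₁_eq_evalAt {g : (Integers p F)⟦X⟧} (hg : IsSmall g) (h : (Integers p F)⟦X⟧) :
    comp₁ p h g = evalAt (fun _ => g) h :=
  compSeries_eq_evalAt (fun _ => hg) h

theorem fglAdd_eq_evalAt {g₁ g₂ : (Integers p F)⟦X⟧} (h₁ : IsSmall g₁) (h₂ : IsSmall g₂)
    (G : FormalGroup (Integers p F)) : fglAdd p G g₁ g₂ = evalAt ![g₁, g₂] G.toPowerSeries :=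
  compSeries_eq_evalAt (isSmall_cons h₁ h₂) G.toPowerSeries

theorem fglSum_eq_coe_sum (G : FormalGroup (Integers p F)) [G.IsComm] [G.HasInverse] {ι : Type*}
    (T : Finset ι) {g : ι → (Integers p F)⟦X⟧} {a : ι → G.SmallPoint Unit}
    (h : ∀ z ∈ T, g z = (a z).1) : fglSum p G T g = (∑ z ∈ T, a z).1 := by
  have hl : ∀ l : List ι, (∀ z ∈ l, g z = (a z).1) →
      l.foldr (fun z acc => fglAdd p G (g z) acc) 0 = (l.map a).sum.1 := by
    intro l hl
    induction l with
    | nil => rfl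
    | cons z l ih =>
      rw [List.foldr_cons, ih fun w hw => hl w (List.mem_cons_of_mem _ hw),
        hl z List.mem_cons_self, List.map_cons, List.sum_cons,
        fglAdd_eq_evalAt (a z).2 (SmallPoint.isSmall _)]
      rfl
  rw [fglSum, hl _ fun z hz => h z (Finset.mem_toList.mp hz), Finset.sum_map_toList]

end CompSeries

section Setting

variable {p : ℕ} [Fact p.Prime] {L K : Type*} [Field L] [Field K]
  [Algebra ℚ_[p] L] [Algebra ℚ_[p] K] [Algebra L K] [IsScalarTower ℚ_[p] L K]
  [FiniteDimensional ℚ_[p] L] [FiniteDimensional ℚ_[p] K]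
  {πL : Integers p L} {πK : Integers p K}
  (hπL : Irreducible πL) (hπK : Irreducible πK)
  (hqL : 3 ≤ residueCard πL) (hram : πK ^ 2 ∣ integersMap p L K πL) (β : Integers p L)

theorem isSmall_map_inclK (hπK : Irreducible πK) {s : (Integers p K)⟦X⟧}
    (hs : πK ∣ PowerSeries.constantCoeff s) :
    IsSmall (MvPowerSeries.map (inclK p πK) s) := by
  obtain ⟨n, hn⟩ := exists_natCast_dvd_uniformizer_pow hπK
  have h := map_dvd (inclK p πK) (hn.trans (pow_dvd_pow_of_dvd hs n))
  rw [map_natCast, map_pow] at h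
  exact isTopologicallyNilpotent_of_pow_dvd h

variable {S : TraceSetting (TorsionIntegers p πK)} (hS : S = traceSetting hπL hπK hqL hram β)

include hS

theorem translate_eq (z : S.T) : translate p πK z.1 = S.x z := by
  subst hS
  exact fglAdd_eq_evalAt ((traceSetting hπL hπK hqL hram β).isSmall_pair z 0)
    ((traceSetting hπL hπK hqL hram β).isSmall_pair z 1) _

theorem traceSum_eq (s : (Integers p K)⟦X⟧) (a : S.Pt Unit)
    (ha : a.1 = MvPowerSeries.map (inclK p πK) s) :
    traceSum p πL πK s = (S.trace a).1 := by
  classical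
  -- Extension by zero off the roots, to pass between a sum over a finite set and a sum over its
  -- subtype.
  let b : TorsionIntegers p πK → S.Pt Unit := fun z =>
    if h : z ∈ S.T then evalHom S.FL (fun _ => S.isSmall_x ⟨z, h⟩) a else 0
  have hb : ∀ z : S.T, b z.1 = evalHom S.FL (fun _ => S.isSmall_x z) a := fun z => dif_pos z.2
  have h : ∀ z ∈ S.T, comp₁ p (s.map (inclK p πK)) (translate p πK z) = (b z).1 := by
    intro z hz
    rw [hb ⟨z, hz⟩, coe_evalHom, ha, translate_eq hπL hπK hqL hram β hS ⟨z, hz⟩]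
    exact comp₁_eq_evalAt (S.isSmall_x _) _
  have h1 := fglSum_eq_coe_sum S.FL S.T h
  rw [S.trace_apply, ← Finset.sum_congr rfl fun z _ => hb z, Finset.sum_coe_sort S.T b, ← h1]
  subst hS
  rfl

theorem endoSide_eq (s : (Integers p K)⟦X⟧) (a : S.Pt Unit)
    (ha : a.1 = MvPowerSeries.map (inclK p πK) s) :
    endoSide p πL πK (β * πL) s = (S.endo a).1 := by
  have hy : (lubinTateEndo (basicSeries πK) πK).map (inclK p πK) = S.y := by
    rw [lubinTateEndo_self (isLubinTatePrime_residueCard hπK), basicSeries_eq]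
    subst hS
    exact MvPowerSeries.map_lubinTateVar _ _ _ _
  have hsmall : IsSmall (evalAt (fun _ : Unit => S.y) (MvPowerSeries.map (inclK p πK) s)) := by
    rw [← ha]
    exact (evalHom S.FL S.isSmall_y a).2
  rw [S.coe_endo, endoSide, hy, comp₁_eq_evalAt (S.isSmall_y ()), ha]
  subst hS
  exact comp₁_eq_evalAt hsmall _

theorem exists_interpolating_iff {s : (Integers p K)⟦X⟧}
    (hs : πK ∣ PowerSeries.constantCoeff s) :
    (∃ r ∈ interpolating p πL πK (β * πL), PowerSeries.C πK ∣ r - s) ↔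
      PowerSeries.C (inclK p πK πK ^ 2) ∣
        traceSum p πL πK s - endoSide p πL πK (β * πL) s := by
  have hSO : S.O = (inclK p πK).range := by
    subst hS
    rfl
  have hSπ : S.π = inclK p πK πK := by
    subst hS
    rfl
  let a : S.Pt Unit := ⟨_, isSmall_map_inclK hπK hs⟩
  have ha : a ∈ S.integral Unit :=
    MvPowerSeries.map_mem_coeffSubring _ (fun b => hSO ▸ inclK_mem b) _
  have h := S.exists_trace_eq_endo_iff ha
  rw [← traceSum_eq hπL hπK hqL hram β hS s a rfl, ← endoSide_eq hπL hπK hqL hram β hS s a rfl,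
    hSπ] at h
  refine Iff.trans ?_ h
  have hdvd : ∀ r : (Integers p K)⟦X⟧, PowerSeries.C πK ∣ r - s ↔
      MvPowerSeries.C (inclK p πK πK) ∣ MvPowerSeries.map (inclK p πK) r - a.1 := by
    intro r
    rw [show MvPowerSeries.map (inclK p πK) r - a.1 = MvPowerSeries.map (inclK p πK) (r - s) from
      (map_sub _ r s).symm, MvPowerSeries.C_dvd_iff]
    refine Iff.trans MvPowerSeries.C_dvd_iff (forall_congr' fun d => ?_)
    rw [MvPowerSeries.coeff_map]
    refine ⟨map_dvd _, ?_⟩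
    rintro ⟨c, hc⟩
    -- The quotient by `π_K`, a priori only in the larger ring, comes from `𝒪_K`.
    obtain ⟨c, rfl⟩ := mem_range_integersMap_of_mul_mem (a := c) hπK.ne_zero ⟨_, hc⟩
    refine ⟨c, integersMap_injective (F := TorsionField p πK) ?_⟩
    rw [map_mul]
    exact hc
  constructor
  · rintro ⟨r, ⟨hr0, hr⟩, hrs⟩
    refine ⟨⟨_, isSmall_map_inclK hπK hr0⟩,
      MvPowerSeries.map_mem_coeffSubring _ (fun b => hSO ▸ inclK_mem b) _, SmallPoint.ext ?_,
      (hdvd r).mp hrs⟩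
    rwa [← traceSum_eq hπL hπK hqL hram β hS r _ rfl, ← endoSide_eq hπL hπK hqL hram β hS r _ rfl]
  · rintro ⟨r', hr', hr, hrs⟩
    obtain ⟨r, hrr⟩ : ∃ r : (Integers p K)⟦X⟧, r'.1 = MvPowerSeries.map (inclK p πK) r := by
      have h1 : ∀ d, ∃ c, inclK p πK c = MvPowerSeries.coeff d r'.1 := fun d => by
        have := hr' d
        rwa [hSO] at this
      choose c hc using h1
      exact ⟨c, MvPowerSeries.ext fun d => ((MvPowerSeries.coeff_map _ _ _).trans (hc d)).symm⟩
    rw [hrr, ← hdvd] at hrs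
    refine ⟨r, ⟨?_, ?_⟩, hrs⟩
    -- The condition on `r(0)` is inherited from `s(0)` through the congruence modulo `π_K`.
    · have h1 := map_dvd PowerSeries.constantCoeff hrs
      rw [PowerSeries.constantCoeff_C, map_sub] at h1
      exact (dvd_iff_dvd_of_dvd_sub h1).mpr hs
    · rw [traceSum_eq hπL hπK hqL hram β hS r r' hrr, endoSide_eq hπL hπK hqL hram β hS r r' hrr, hr]

end Setting

end ColemanTrace

theorem theorem2p1p1 (p : ℕ) [Fact p.Prime] (L K : Type*) [Field L] [Field K]
    [Algebra ℚ_[p] L] [Algebra ℚ_[p] K] [Algebra L K] [IsScalarTower ℚ_[p] L K]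
    [FiniteDimensional ℚ_[p] L] [FiniteDimensional L K]
    (πL : ColemanTrace.Integers p L) (hπL : Irreducible πL)
    (πK : ColemanTrace.Integers p K) (hπK : Irreducible πK)
    (hqL : 3 ≤ ColemanTrace.residueCard πL)
    (hram : πK ^ 2 ∣ ColemanTrace.integersMap p L K πL)
    (f : ℕ) (hf : ColemanTrace.residueCard πK = ColemanTrace.residueCard πL ^ f)
    (α : ColemanTrace.Integers p L)
    (hα : α * πL ^ f = (ColemanTrace.residueCard πK : ColemanTrace.Integers p L))
    (hdvd : πL ∣ α)
    (s : PowerSeries (ColemanTrace.Integers p K))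
    (hs : πK ∣ PowerSeries.constantCoeff s) :
    (∃ r ∈ ColemanTrace.interpolating p πL πK α, PowerSeries.C πK ∣ r - s) ↔
      PowerSeries.C (ColemanTrace.inclK p πK πK ^ 2) ∣
        ColemanTrace.traceSum p πL πK s - ColemanTrace.endoSide p πL πK α s := by
  have : FiniteDimensional ℚ_[p] K := Module.Finite.trans L K
  obtain ⟨β, rfl⟩ := hdvd
  rw [mul_comm πL β]
  exact ColemanTrace.exists_interpolating_iff hπL hπK hqL hram β rfl hs
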